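/- **Notation.** Let $\Lambda=2w\mathbb Z+2w'\mathbb Z\subset\mathbb C$ be a period lattice ($2w,2w'$ linearly independent over $\mathbb R$) with Weierstrass functions $\sigma,\zeta,\wp$. The KP equation is $u_t+u_{xxx}+6uu_x+3\partial_x^{-1}u_{yy}=0$, meaning $u_t+u_{xxx}+6uu_x+3v_y=0$ with $v_x=u_y$. For $a,\eta\in\mathbb C$ put $$\Psi_x(k)=\frac{\sigma(x+a+k)}{\sigma(x+a)\sigma(k)}e^{-\zeta(k)x-\eta k},\qquad \Psi_x(k,l)=\frac{\sigma(x+a+k+l)}{\sigma(x+a)\sigma(k+l)}e^{-(\zeta(k)+\zeta(l))x-\eta(k+l)}$$ (the unshifted case is $a=\eta=0$; the shifted case is $a=w'$, $\eta=\zeta(w')$). For arbitrary functions $\rho_0,\gamma_0:\mathbb C\to\mathbb C$ put $\rho_k=\rho_0(k)e^{\wp(k)y-2\wp'(k)t}$ and $\gamma_{l}=\gamma_0(l)e^{-\wp(l)y-2\wp'(l)t}$. Let $k_1,\dots,k_N$ and $k'_1,\dots,k'_{N'}$ be complex numbers with $k_i,\ k'_j,\ k_i+k'_j\notin\Lambda$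 for all $i,j$. Expressions $\partial_x^2\ln F$ mean $\partial_x(F_x/F)$, and $\partial_y\partial_x\ln F$ means $\partial_y(F_x/F)$. **(1)** Let $B=(B_{j,i})$ be any complex $N'\times N$ matrix and $\mathrm d\lambda(l,l')=\sum_{i,j}B_{j,i}\,\delta(l-k_i)\delta(l'-k'_j)\,\mathrm dl\,\mathrm dl'$. Let $M$ be the $N\times N'$ dressed elliptic Cauchy matrix $M_{i,j}=\rho_{k_i}\Psi_x(k_i,k'_j)\gamma_{k'_j}$, let $\tau=\det(I+MB)$, $r_i=\rho_{k_i}\Psi_x(k_i)$, $s_j=\gamma_{k'_j}\Psi_x(k'_j)$, and let $\Omega=\{(x,y,t)\in\mathbb C^3: x+a\notin\Lambda,\ \tau\ne0\}$. Then the integral equation $$\psi(x,y,t;\kappa)+\rho_\kappa\iint\psi(x,y,t;l)\gamma_{l'}\Psi_x(\kappa,l')\,\mathrm d\lambda(l,l')=\Psi_x(\kappa)\rho_\kappa ,$$ required for $(x,y,t)\in\Omega$ and all $\kappa$ with $\kappa\notin\Lambda$ and $\kappa+k'_j\notin\Lambda$ for all $j$, has a solution; every solution satisfies $(\psi(\cdot;k_i))_i=(I+MB)^{-1}r$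 on $\Omega$; and on $\Omega$ $$u:=-2\wp(x+a)-2\partial_x\iint\psi(l)\gamma_{l'}\Psi_x(l')\,\mathrm d\lambda(l,l')=-2\wp(x+a)-2\partial_x\big(s^TB(I+MB)^{-1}r\big)=2\partial_x^2\ln\big(\sigma(x+a)\tau\big).$$ This $u$ is holomorphic on $\Omega$ and solves the KP equation there, with $v=\partial_x^{-1}u_y=2\partial_y\partial_x\ln(\sigma(x+a)\tau)$ holomorphic on $\Omega$. **(2)** If $N=N'$ and $B=I$, then for $x+a\notin\Lambda$ $$\tau=\sum_{J\subset\{1,\dots,N\}}\Big(\prod_{i\in J}c_i\Big)\Big(\prod_{i<j\in J}A_{i,j}\Big)\frac{\sigma\big(x+a+\sum_{i\in J}(k_i+k'_i)\big)}{\sigma(x+a)\prod_{i\in J}\sigma(k_i+k'_i)}\exp\Big(\sum_{i\in J}\theta_i\Big),$$ where $c_i=\rho_0(k_i)\gamma_0(k'_i)e^{-\eta(k_i+k'_i)}$, $\theta_i=-(\zeta(k_i)+\zeta(k'_i))x+(\wp(k_i)-\wp(k'_i))y-2(\wp'(k_i)+\wp'(k'_i))t$ and $$A_{i,j}=\frac{\sigma(k_i-k_j)\sigma(k'_i-k'_j)}{\sigma(k_i+k'_j)\sigma(k'_i+k_j)}.$$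 **(3)** Suppose $w>0$ and $w'\in i\mathbb R$, $\operatorname{Im}w'>0$. Let $N=N'$, let $k_i,k'_i,\tilde c_i\in\mathbb R$ (with $k_i,k'_j,k_i+k'_j\notin\Lambda$ for all $i,j$), and let $\tau_N$ be the sum in (2) with $a=w'$ and $c_i=\tilde c_ie^{-\zeta(w')(k_i+k'_i)}$. For all real $x,y,t$ one has $\sigma(x+w')\neq0$ and $\tau_N(x,y,t)\in\mathbb R$, and $\tau_N$ is real-analytic on $\mathbb R^3$. On the set of all $(x,y,t)\in\mathbb R^3$ with $\tau_N\neq0$ the functions $u=2\partial_x^2\ln(\sigma(x+w')\tau_N)$ and $v=2\partial_y\partial_x\ln(\sigma(x+w')\tau_N)$ are real-valued and real-analytic, and $u$ solves the KP equation with $\partial_x^{-1}u_y=v$. If moreover $\tilde c_i\,\sigma(k_i+k'_i)\ge0$ for all $i$ and $A_{i,j}\ge0$ for all $i<j$, then $\tau_N\ge1$ on $\mathbb R^3$, so that $u$ is a nonsingular real solution on all of $\mathbb R^3$. -/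

import Mathlib

open MeasureTheory
open scoped Matrix

noncomputable section

namespace EllipticKP

/-! ### Weierstrass functions

For `L : PeriodPair` the periods are `L.ω₁ = 2 w` and `L.ω₂ = 2 w'`. The functions `℘` and `℘'` are
Mathlib's `L.weierstrassP` and `L.derivWeierstrassP`. -/

/-- The nonzero lattice points. -/
abbrev NonzeroLattice (L : PeriodPair) : Type := {l : L.lattice // l ≠ 0}

/-- The Weierstrass zeta function
`ζ(z) = 1/z + ∑_{l ≠ 0} (1/(z-l) + 1/l + z/l²)`. -/
def zeta (L : PeriodPair) (z : ℂ) : ℂ :=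
  1 / z + ∑' l : NonzeroLattice L, (1 / (z - (l : ℂ)) + 1 / (l : ℂ) + z / (l : ℂ) ^ 2)

/-- The Weierstrass sigma function
`σ(z) = z ∏_{l ≠ 0} (1 - z/l) exp(z/l + z²/(2l²))`. -/
def sigma (L : PeriodPair) (z : ℂ) : ℂ :=
  z * ∏' l : NonzeroLattice L,
    ((1 - z / (l : ℂ)) * Complex.exp (z / (l : ℂ) + z ^ 2 / (2 * (l : ℂ) ^ 2)))

/-- The half period `w'`. -/
def halfPeriod' (L : PeriodPair) : ℂ := L.ω₂ / 2

/-! ### Lamé functions and plane wave factors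

The pair `(a, η)` is a shift: `a = η = 0` gives the Lamé functions `Ψ_x(k)`, `Ψ_x(k, l)`, while
`a = w'`, `η = ζ(w')` gives the shifted functions usually written with a tilde. -/

/-- The Lamé function `σ(x+a+k) / (σ(x+a) σ(k)) · exp(-ζ(k) x - η k)`. -/
def lame (L : PeriodPair) (a η x k : ℂ) : ℂ :=
  sigma L (x + a + k) / (sigma L (x + a) * sigma L k) * Complex.exp (-(zeta L k) * x - η * k)

/-- The generalized Lamé function
`σ(x+a+k+l) / (σ(x+a) σ(k+l)) · exp(-(ζ(k)+ζ(l)) x - η (k+l))`. -/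
def lame₂ (L : PeriodPair) (a η x k l : ℂ) : ℂ :=
  sigma L (x + a + (k + l)) / (sigma L (x + a) * sigma L (k + l)) *
    Complex.exp (-(zeta L k + zeta L l) * x - η * (k + l))

/-- `ρ_k(y,t) = ρ₀(k) exp(℘(k) y - 2 ℘'(k) t)`. -/
def rho (L : PeriodPair) (ρ₀ : ℂ → ℂ) (k y t : ℂ) : ℂ :=
  ρ₀ k * Complex.exp (L.weierstrassP k * y - 2 * L.derivWeierstrassP k * t)

/-- `γ_{l'}(y,t) = γ₀(l') exp(-℘(l') y - 2 ℘'(l') t)`. -/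
def gam (L : PeriodPair) (γ₀ : ℂ → ℂ) (l y t : ℂ) : ℂ :=
  γ₀ l * Complex.exp (-(L.weierstrassP l) * y - 2 * L.derivWeierstrassP l * t)

/-! ### The discrete measure and the integral equation -/

/-- The integral `∬ f(l,l') dλ(l,l')` for the discrete complex measure
`dλ = ∑ i, ∑ j, B_{j,i} δ(l - k_i) δ(l' - k'_j) dl dl'`. -/
def discreteIntegral {N N' : ℕ} (k : Fin N → ℂ) (k' : Fin N' → ℂ)
    (B : Matrix (Fin N') (Fin N) ℂ) (f : ℂ → ℂ → ℂ) : ℂ :=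
  ∑ i, ∑ j, B j i * ∫ p : ℂ × ℂ, f p.1 p.2 ∂(Measure.dirac (k i, k' j))

/-- The spectral points avoid the zeros of `σ` that occur in denominators (and the poles of
`ζ`, `℘`, `℘'`). -/
structure Admissible (L : PeriodPair) {N N' : ℕ} (k : Fin N → ℂ) (k' : Fin N' → ℂ) : Prop where
  left : ∀ i, k i ∉ L.lattice
  right : ∀ j, k' j ∉ L.lattice
  add : ∀ i j, k i + k' j ∉ L.lattice

/-- `ψ` solves, at all `(x,y,t) ∈ Ω`, the linear integral equation
`ψ(κ) + ρ_κ ∬ ψ(l) γ_{l'} Ψ_x(κ,l') dλ(l,l') = Ψ_x(κ) ρ_κ`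
for every spectral value `κ` at which its coefficients are defined. -/
def SolvesIntegralEq (L : PeriodPair) (a η : ℂ) (ρ₀ γ₀ : ℂ → ℂ) {N N' : ℕ}
    (k : Fin N → ℂ) (k' : Fin N' → ℂ) (B : Matrix (Fin N') (Fin N) ℂ)
    (Ω : Set (ℂ × ℂ × ℂ)) (ψ : ℂ → ℂ → ℂ → ℂ → ℂ) : Prop :=
  ∀ x y t : ℂ, (x, y, t) ∈ Ω → ∀ κ : ℂ, κ ∉ L.lattice → (∀ j, κ + k' j ∉ L.lattice) →
    ψ x y t κ + rho L ρ₀ κ y t *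
      discreteIntegral k k' B (fun l l' => ψ x y t l * gam L γ₀ l' y t * lame₂ L a η x κ l')
    = lame L a η x κ * rho L ρ₀ κ y t

/-! ### The dressed elliptic Cauchy matrix and the tau function -/

/-- The dressed elliptic Cauchy matrix `M_{i,j} = ρ_{k_i} Ψ_x(k_i,k'_j) γ_{k'_j}`. -/
def cauchyMatrix (L : PeriodPair) (a η : ℂ) (ρ₀ γ₀ : ℂ → ℂ) {N N' : ℕ}
    (k : Fin N → ℂ) (k' : Fin N' → ℂ) (x y t : ℂ) : Matrix (Fin N) (Fin N') ℂ :=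
  Matrix.of fun i j => rho L ρ₀ (k i) y t * lame₂ L a η x (k i) (k' j) * gam L γ₀ (k' j) y t

/-- The vector `r_i = ρ_{k_i} Ψ_x(k_i)`. -/
def rVec (L : PeriodPair) (a η : ℂ) (ρ₀ : ℂ → ℂ) {N : ℕ} (k : Fin N → ℂ) (x y t : ℂ) :
    Fin N → ℂ :=
  fun i => rho L ρ₀ (k i) y t * lame L a η x (k i)

/-- The vector `s_j = γ_{k'_j} Ψ_x(k'_j)`. -/
def sVec (L : PeriodPair) (a η : ℂ) (γ₀ : ℂ → ℂ) {N' : ℕ} (k' : Fin N' → ℂ) (x y t : ℂ) :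
    Fin N' → ℂ :=
  fun j => gam L γ₀ (k' j) y t * lame L a η x (k' j)

/-- `τ = det (I + M B)`. -/
def tau (L : PeriodPair) (a η : ℂ) (ρ₀ γ₀ : ℂ → ℂ) {N N' : ℕ}
    (k : Fin N → ℂ) (k' : Fin N' → ℂ) (B : Matrix (Fin N') (Fin N) ℂ) (x y t : ℂ) : ℂ :=
  (1 + cauchyMatrix L a η ρ₀ γ₀ k k' x y t * B).det

/-- The points where `x + a` is not a period (so that `M` is defined) and `det (I + M B) ≠ 0`. -/
def regularSet (L : PeriodPair) (a η : ℂ) (ρ₀ γ₀ : ℂ → ℂ) {N N' : ℕ}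
    (k : Fin N → ℂ) (k' : Fin N' → ℂ) (B : Matrix (Fin N') (Fin N) ℂ) : Set (ℂ × ℂ × ℂ) :=
  {p | p.1 + a ∉ L.lattice ∧ tau L a η ρ₀ γ₀ k k' B p.1 p.2.1 p.2.2 ≠ 0}

/-! ### The explicit (Hirota form) tau function -/

/-- `θ(x,y,t;k,k') = -(ζ(k)+ζ(k')) x + (℘(k)-℘(k')) y - 2 (℘'(k)+℘'(k')) t`. -/
def theta (L : PeriodPair) (x y t k k' : ℂ) : ℂ :=
  -(zeta L k + zeta L k') * x + (L.weierstrassP k - L.weierstrassP k') * y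
    - 2 * (L.derivWeierstrassP k + L.derivWeierstrassP k') * t

/-- `A_{i,j} = σ(k_i-k_j) σ(k'_i-k'_j) / (σ(k_i+k'_j) σ(k'_i+k_j))`. -/
def phaseA (L : PeriodPair) {N : ℕ} (k k' : Fin N → ℂ) (i j : Fin N) : ℂ :=
  sigma L (k i - k j) * sigma L (k' i - k' j) / (sigma L (k i + k' j) * sigma L (k' i + k j))

/-- The tau function in Hirota form, a sum over all subsets `J` of the index set. -/
def tauHirota (L : PeriodPair) (a : ℂ) {N : ℕ} (c k k' : Fin N → ℂ) (x y t : ℂ) : ℂ :=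
  ∑ J : Finset (Fin N),
    (∏ i ∈ J, c i) * (∏ i ∈ J, ∏ j ∈ J with i < j, phaseA L k k' i j) *
      (sigma L (x + a + ∑ i ∈ J, (k i + k' i)) /
        (sigma L (x + a) * ∏ i ∈ J, sigma L (k i + k' i))) *
      Complex.exp (∑ i ∈ J, theta L x y t (k i) (k' i))

/-! ### The KP equation -/

section Derivatives

variable {𝕜 E : Type*} [NontriviallyNormedField 𝕜] [NormedAddCommGroup E] [NormedSpace 𝕜 E]

/-- `∂_x`. -/
def pdx (f : 𝕜 → 𝕜 → 𝕜 → E) (x y t : 𝕜) : E := deriv (fun s => f s y t) x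

/-- `∂_y`. -/
def pdy (f : 𝕜 → 𝕜 → 𝕜 → E) (x y t : 𝕜) : E := deriv (fun s => f x s t) y

/-- `∂_t`. -/
def pdt (f : 𝕜 → 𝕜 → 𝕜 → E) (x y t : 𝕜) : E := deriv (fun s => f x y s) t

end Derivatives

/-- `u` solves the KP equation `u_t + u_xxx + 6 u u_x + 3 ∂_x⁻¹ u_yy = 0` on `Ω`, where
`v = ∂_x⁻¹ u_y`, that is, `v_x = u_y`; both functions are (real or complex) analytic. -/
structure IsKPSolutionOn {𝕜 : Type*} [NontriviallyNormedField 𝕜] (Ω : Set (𝕜 × 𝕜 × 𝕜))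
    (u v : 𝕜 → 𝕜 → 𝕜 → 𝕜) : Prop where
  analytic_u : AnalyticOnNhd 𝕜 (fun p : 𝕜 × 𝕜 × 𝕜 => u p.1 p.2.1 p.2.2) Ω
  analytic_v : AnalyticOnNhd 𝕜 (fun p : 𝕜 × 𝕜 × 𝕜 => v p.1 p.2.1 p.2.2) Ω
  potential : ∀ x y t : 𝕜, (x, y, t) ∈ Ω → pdx v x y t = pdy u x y t
  equation : ∀ x y t : 𝕜, (x, y, t) ∈ Ω →
    pdt u x y t + pdx (pdx (pdx u)) x y t + 6 * u x y t * pdx u x y t + 3 * pdy v x y t = 0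

section LogDerivatives

variable {𝕜 : Type*} [NontriviallyNormedField 𝕜] [NormedAlgebra 𝕜 ℂ]

/-- `∂_x ln F = F_x / F` (independent of a branch of the logarithm). -/
def dxLog (F : 𝕜 → 𝕜 → 𝕜 → ℂ) (x y t : 𝕜) : ℂ := logDeriv (fun s => F s y t) x

/-- `2 ∂_x² ln F`. -/
def twoDxxLog (F : 𝕜 → 𝕜 → 𝕜 → ℂ) (x y t : 𝕜) : ℂ := 2 * pdx (dxLog F) x y t

/-- `2 ∂_y ∂_x ln F`, the natural choice of `∂_x⁻¹ ∂_y (2 ∂_x² ln F)`. -/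
def twoDyxLog (F : 𝕜 → 𝕜 → 𝕜 → ℂ) (x y t : 𝕜) : ℂ := 2 * pdy (dxLog F) x y t

end LogDerivatives

end EllipticKP

end

/-!
The proof rests on the Lamé functions `Ψ_x(k)` and their two-parameter version `Ψ_x(k, l)`. With
`℘ = ℘(x + a)` they satisfy, as functions of `x`,

* `Ψ(k)'' = (2 ℘ + ℘(k)) Ψ(k)` and `2 (℘ - ℘(k)) Ψ(k)' = (℘' - ℘'(k)) Ψ(k)`,
* `∂_x Ψ(k, l) = -Ψ(k) Ψ(l)`, while `℘(k) - ℘(l)` and `℘'(k) + ℘'(l)` act on `Ψ(k, l)` as bilinear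
  expressions in the derivatives of `Ψ(k)` and `Ψ(l)` (`hasDerivAt_lame₂`, `lame₂_y_eq`,
  `lame₂_t_eq`).

All of these come from addition formulas for `ζ`, which follow from the product formula for
`℘(u) - ℘(v)` (`weierstrassP_sub_eq`, a consequence of Liouville's theorem) and from Weierstrass'
three-term relation `sigma_three_term`. They are verified where no argument is a period and then
extended by density, as each excluded set is countable.

Consequently `M_x = -r sᵀ`, and `M_y` and `M_t` are sums of few terms of the form
`∂_x^i r (∂_x^j s)ᵀ`. Put `Q = B (1 + M B)⁻¹`, so that `∂Q = -Q (∂M) Q`, and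
`S_{m,n} = (∂_x^m s)ᵀ Q (∂_x^n r)`. The derivatives of these scalars are polynomials in them, with
coefficients that depend on `℘`, `℘'` and `℘''` only (`DressingData.hasDerivAt_Sc_x` and its
analogues for `y` and `t`). Since `∂_x ln τ = -S_{0,0}`, both `u` and `v` are such polynomials, and
the KP equation becomes a polynomial identity (`DressingData.kp_equation`). Evaluated at `κ = k_i`,
the integral equation is the linear system with matrix `1 + M B`.

For diagonal `B`, the expansion of `det (1 + M B)` into principal minors gives a sum over subsets
whose terms are elliptic Cauchy determinants. Frobenius' formula for them (`det_sigmaKernel`) is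
proved by Schur complements: by the three-term relation the Schur complement of an elliptic Cauchy
matrix is again one, with shifted argument (`sigmaKernel_schur`).

For a rectangular lattice, complex conjugation commutes with `σ`, `ζ`, `℘` and `℘'`, and the
quasi-periodicity of `σ` shows that `exp(-ζ(w') K) σ(x + w' + K) / σ(x + w')` is real for real `x`
and `K`. It has no zeros and equals `1` at `K = 0`, hence is positive (`halfPeriodRatio_re_pos`). So
the tau function is real, and under the sign conditions it is a sum of nonnegative terms that
includes the term `1` of the empty set.
-/

namespace EllipticKP

open Filter Topology

section

variable (L : PeriodPair)

/-! ### The functions `σ` and `ζ` -/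

lemma NonzeroLattice.coe_ne_zero {L : PeriodPair} (l : NonzeroLattice L) :
    ((l : L.lattice) : ℂ) ≠ 0 := by
  simpa using l.2

lemma summable_norm_nonzeroLattice :
    Summable fun l : NonzeroLattice L => (‖((l : L.lattice) : ℂ)‖ ^ 3)⁻¹ := by
  have h := ZLattice.summable_norm_pow_inv (L := L.lattice) 3 (by simp)
  have h' := h.comp_injective (i := fun l : NonzeroLattice L => l.1) Subtype.val_injective
  simpa [Function.comp_def, inv_pow] using h'

lemma eventually_lt_norm_nonzeroLattice (r : ℝ) :
    ∀ᶠ l : NonzeroLattice L in cofinite, r < ‖((l : L.lattice) : ℂ)‖ := by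
  have h := (summable_norm_nonzeroLattice L).tendsto_cofinite_zero
  have hr : (0 : ℝ) < ((|r| + 1) ^ 3)⁻¹ := by positivity
  filter_upwards [h.eventually_lt_const hr] with l hl
  have hl0 : 0 < ‖((l : L.lattice) : ℂ)‖ := norm_pos_iff.mpr l.coe_ne_zero
  rw [inv_lt_inv₀ (by positivity) (by positivity)] at hl
  have := lt_of_pow_lt_pow_left₀ 3 hl0.le hl
  linarith [le_abs_self r]

/-- The Weierstrass primary factor of genus two differs from `1` by a term of third order. -/
lemma norm_primaryFactor_sub_one_le (w : ℂ) (hw : ‖w‖ ≤ 1 / 2) :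
    ‖(1 - w) * Complex.exp (w + w ^ 2 / 2) - 1‖ ≤ 2 * ‖w‖ ^ 3 := by
  set v := w + w ^ 2 / 2 with hv
  have hw0 := norm_nonneg w
  have hvn : ‖v‖ ≤ 5 / 4 * ‖w‖ := by
    calc ‖v‖ ≤ ‖w‖ + ‖w ^ 2 / 2‖ := norm_add_le _ _
      _ = ‖w‖ + ‖w‖ ^ 2 / 2 := by simp
      _ ≤ _ := by nlinarith
  have hv1 : ‖v‖ ≤ 1 := by linarith
  have he := Complex.exp_bound hv1 (n := 3) (by norm_num)
  simp only [Finset.sum_range_succ, Finset.sum_range_zero, Nat.factorial] at he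
  norm_num at he
  set e := Complex.exp v - (1 + v + v ^ 2 / 2) with hedef
  have key : (1 - w) * Complex.exp v - 1
      = w ^ 3 * (-(1 / 2) - 3 / 8 * w - w ^ 2 / 8) + (1 - w) * e := by
    rw [hedef, hv]; ring
  have he' : ‖e‖ ≤ ‖w‖ ^ 3 / 2 := by
    refine he.trans ?_
    have : ‖v‖ ^ 3 ≤ (5 / 4 * ‖w‖) ^ 3 := by gcongr
    have h3 : 0 ≤ ‖w‖ ^ 3 := by positivity
    nlinarith
  have h1 : ‖-(1 / 2 : ℂ) - 3 / 8 * w - w ^ 2 / 8‖ ≤ 1 := by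
    calc _ ≤ ‖-(1 / 2 : ℂ)‖ + ‖3 / 8 * w‖ + ‖w ^ 2 / 8‖ :=
          (norm_sub_le _ _).trans (by gcongr; exact norm_sub_le _ _)
      _ = 1 / 2 + 3 / 8 * ‖w‖ + ‖w‖ ^ 2 / 8 := by norm_num
      _ ≤ 1 := by nlinarith
  have h2 : ‖1 - w‖ ≤ 2 := by
    calc _ ≤ ‖(1 : ℂ)‖ + ‖w‖ := norm_sub_le _ _
      _ ≤ 2 := by norm_num; linarith
  rw [key]
  calc _ ≤ ‖w‖ ^ 3 * 1 + 2 * (‖w‖ ^ 3 / 2) := by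
        refine (norm_add_le _ _).trans ?_
        rw [norm_mul, norm_mul, norm_pow]
        gcongr
    _ = 2 * ‖w‖ ^ 3 := by ring

/-- The factor of `σ` belonging to a nonzero lattice point. -/
noncomputable def sigmaFactor (l z : ℂ) : ℂ :=
  (1 - z / l) * Complex.exp (z / l + z ^ 2 / (2 * l ^ 2))

/-- The product `σ(z) / z` over the nonzero lattice points. -/
noncomputable def sigmaProd (z : ℂ) : ℂ := ∏' l : NonzeroLattice L, sigmaFactor l z

lemma sigma_eq (z : ℂ) : sigma L z = z * sigmaProd L z := rfl

lemma differentiable_sigmaFactor (l : ℂ) : Differentiable ℂ (sigmaFactor l) := by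
  unfold sigmaFactor
  fun_prop

lemma norm_sigmaFactor_sub_one_le {r : ℝ} {l z : ℂ} (hl : 2 * r < ‖l‖) (hz : ‖z‖ < r) :
    ‖sigmaFactor l z - 1‖ ≤ 2 * r ^ 3 * (‖l‖ ^ 3)⁻¹ := by
  have hr : 0 < r := (norm_nonneg z).trans_lt hz
  have hl0 : 0 < ‖l‖ := by linarith
  have hle : ‖z / l‖ ≤ r / ‖l‖ := by rw [norm_div]; gcongr
  have h := norm_primaryFactor_sub_one_le (z / l) (hle.trans (by rw [div_le_iff₀ hl0]; linarith))
  have e : (z / l) ^ 2 / 2 = z ^ 2 / (2 * l ^ 2) := by rw [div_pow, div_div, mul_comm]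
  rw [e] at h
  calc _ ≤ 2 * ‖z / l‖ ^ 3 := h
    _ ≤ 2 * (r / ‖l‖) ^ 3 := by gcongr
    _ = _ := by rw [div_pow]; ring

lemma eventually_norm_sigmaFactor_sub_one_le (r : ℝ) :
    ∀ᶠ l : NonzeroLattice L in cofinite, ∀ z ∈ Metric.ball (0 : ℂ) r,
      ‖sigmaFactor l z - 1‖ ≤ 2 * r ^ 3 * (‖((l : L.lattice) : ℂ)‖ ^ 3)⁻¹ := by
  filter_upwards [eventually_lt_norm_nonzeroLattice L (2 * r)] with l hl z hz
  exact norm_sigmaFactor_sub_one_le hl (by simpa using hz)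

lemma summable_norm_sigmaFactor_sub_one (z : ℂ) :
    Summable fun l : NonzeroLattice L => ‖sigmaFactor l z - 1‖ := by
  refine Summable.of_norm_bounded_eventually
    ((summable_norm_nonzeroLattice L).mul_left (2 * (‖z‖ + 1) ^ 3)) ?_
  filter_upwards [eventually_norm_sigmaFactor_sub_one_le L (‖z‖ + 1)] with l hl
  simpa using hl z (by simp)

lemma hasProdLocallyUniformlyOn_sigmaFactor (r : ℝ) :
    HasProdLocallyUniformlyOn (fun (l : NonzeroLattice L) z => sigmaFactor l z) (sigmaProd L)
      (Metric.ball (0 : ℂ) r) := by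
  have h := Summable.hasProdLocallyUniformlyOn_one_add (K := Metric.ball (0 : ℂ) r)
    (f := fun (l : NonzeroLattice L) z => sigmaFactor l z - 1) Metric.isOpen_ball
    ((summable_norm_nonzeroLattice L).mul_left (2 * r ^ 3))
    (eventually_norm_sigmaFactor_sub_one_le L r)
    (fun l => ((differentiable_sigmaFactor _).sub_const 1).continuous.continuousOn)
  simpa [sigmaProd, Function.comp_def] using! h

lemma differentiable_sigmaProd : Differentiable ℂ (sigmaProd L) := by
  intro z
  have h := (hasProdLocallyUniformlyOn_sigmaFactor L (‖z‖ + 1))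
  refine (h.differentiableOn (.of_forall fun s => ?_) Metric.isOpen_ball).differentiableAt
    (Metric.isOpen_ball.mem_nhds (by simp))
  exact (DifferentiableOn.fun_finsetProd fun i _ => (differentiable_sigmaFactor _).differentiableOn)

lemma differentiable_sigma : Differentiable ℂ (sigma L) := by
  have : sigma L = fun z => z * sigmaProd L z := rfl
  rw [this]
  exact differentiable_id.mul (differentiable_sigmaProd L)

lemma sigmaFactor_ne_zero {l z : ℂ} (hl : l ≠ 0) (h : z ≠ l) : sigmaFactor l z ≠ 0 := by
  refine mul_ne_zero ?_ (Complex.exp_ne_zero _)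
  rw [sub_ne_zero, ne_comm, Ne, div_eq_one_iff_eq hl]
  exact h

lemma sigmaProd_ne_zero {z : ℂ} (h : ∀ l : NonzeroLattice L, z ≠ (l : L.lattice)) :
    sigmaProd L z ≠ 0 := by
  have := tprod_one_add_ne_zero_of_summable
    (f := fun l : NonzeroLattice L => sigmaFactor l z - 1)
    (fun l => by simpa using sigmaFactor_ne_zero l.coe_ne_zero (h l))
    (summable_norm_sigmaFactor_sub_one L z)
  simpa [sigmaProd] using this

@[simp] lemma sigmaProd_zero : sigmaProd L 0 = 1 := by simp [sigmaProd, sigmaFactor]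

@[simp] lemma sigma_zero : sigma L 0 = 0 := by simp [sigma]

lemma ne_coe_of_notMem {z : ℂ} (hz : z ∉ L.lattice) (l : NonzeroLattice L) :
    z ≠ ((l : L.lattice) : ℂ) := by
  rintro rfl; exact hz (l : L.lattice).2

lemma ne_zero_of_notMem {L : PeriodPair} {z : ℂ} (hz : z ∉ L.lattice) : z ≠ 0 := by
  rintro rfl; exact hz (zero_mem _)

lemma sigma_ne_zero {L : PeriodPair} {z : ℂ} (hz : z ∉ L.lattice) : sigma L z ≠ 0 := by
  rw [sigma_eq]
  exact mul_ne_zero (ne_zero_of_notMem hz) (sigmaProd_ne_zero L (ne_coe_of_notMem L hz))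

lemma sigma_eq_zero {L : PeriodPair} {z : ℂ} (hz : z ∈ L.lattice) : sigma L z = 0 := by
  by_cases h0 : z = 0
  · simp [h0]
  rw [sigma_eq, sigmaProd, tprod_of_exists_eq_zero, mul_zero]
  exact ⟨⟨⟨z, hz⟩, by simpa using h0⟩, by simp [sigmaFactor, h0]⟩

/-- Negation on the nonzero lattice points. -/
def negNonzeroLattice : NonzeroLattice L ≃ NonzeroLattice L :=
  (Equiv.neg L.lattice).subtypeEquiv (by simp)

lemma coe_negNonzeroLattice (l : NonzeroLattice L) :
    ((negNonzeroLattice L l : L.lattice) : ℂ) = -((l : L.lattice) : ℂ) := rfl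

lemma sigma_neg (z : ℂ) : sigma L (-z) = -sigma L z := by
  have : sigmaProd L (-z) = sigmaProd L z := by
    rw [sigmaProd, ← (negNonzeroLattice L).tprod_eq]
    refine tprod_congr fun l => ?_
    simp [sigmaFactor, coe_negNonzeroLattice]
  rw [sigma_eq, sigma_eq, this, neg_mul]

lemma zeta_neg (z : ℂ) : zeta L (-z) = -zeta L z := by
  rw [zeta, ← (negNonzeroLattice L).tsum_eq, zeta, neg_add, ← tsum_neg]
  congr 1
  · simp [div_neg]
  refine tsum_congr fun l => ?_
  rw [coe_negNonzeroLattice]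
  rw [show -z - -((l : L.lattice) : ℂ) = -(z - (l : L.lattice)) by ring]
  simp only [div_neg, neg_sq, neg_div]
  ring

/-- The summand of `ζ` belonging to a nonzero lattice point. -/
noncomputable def zetaTerm (l z : ℂ) : ℂ := 1 / (z - l) + 1 / l + z / l ^ 2

lemma zetaTerm_eq {l z : ℂ} (hl : l ≠ 0) (h : z ≠ l) :
    zetaTerm l z = z ^ 2 / (l ^ 2 * (z - l)) := by
  have := sub_ne_zero.mpr h
  rw [zetaTerm]
  field_simp
  ring

lemma logDeriv_sigmaFactor {l z : ℂ} (hl : l ≠ 0) (h : z ≠ l) :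
    logDeriv (sigmaFactor l) z = zetaTerm l z := by
  have h0 := sub_ne_zero.mpr h
  have h1 : (1 - z / l) ≠ 0 := by
    rw [sub_ne_zero, ne_comm, Ne, div_eq_one_iff_eq hl]; exact h
  have hd1 : HasDerivAt (fun z => 1 - z / l) (-(1 / l)) z := by
    simpa using! ((hasDerivAt_id z).div_const l).const_sub 1
  have hd2 : HasDerivAt (fun z : ℂ => z / l + z ^ 2 / (2 * l ^ 2))
      (1 / l + 2 * z / (2 * l ^ 2)) z := by
    simpa using! ((hasDerivAt_id z).div_const l).add
      (((hasDerivAt_id z).pow 2).div_const (2 * l ^ 2))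
  have hd := hd1.mul hd2.cexp
  rw [logDeriv_apply, show sigmaFactor l = (fun z => 1 - z / l) * fun z =>
    Complex.exp (z / l + z ^ 2 / (2 * l ^ 2)) from rfl, hd.deriv, Pi.mul_apply]
  have he := Complex.exp_ne_zero (z / l + z ^ 2 / (2 * l ^ 2))
  generalize Complex.exp (z / l + z ^ 2 / (2 * l ^ 2)) = e at he
  have hlz : l - z ≠ 0 := by rw [← neg_sub]; exact neg_ne_zero.mpr h0
  rw [zetaTerm, show 1 - z / l = (l - z) / l by field_simp]
  rw [show z - l = -(l - z) by ring]
  field_simp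
  ring

/-- Off the lattice, `z` has a neighbourhood on which the distance to a lattice point `l` is
bounded below by a multiple of `‖l‖`, uniformly in `l`. -/
lemma exists_norm_sub_lattice_ge {z : ℂ} (hz : z ∉ L.lattice) :
    ∃ ε > 0, ∃ c > 0, ∀ w ∈ Metric.ball z ε, ∀ l ∈ L.lattice, c * ‖l‖ ≤ ‖w - l‖ ∧ w ≠ l := by
  obtain ⟨δ, hδ, hδ'⟩ := Metric.isOpen_iff.mp L.isClosed_lattice.isOpen_compl z hz
  refine ⟨δ / 2, by positivity, (1 + (‖z‖ + δ / 2) / (δ / 2))⁻¹, by positivity, fun w hw l hl => ?_⟩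
  rw [Metric.mem_ball, dist_eq_norm] at hw
  have hzl : δ ≤ ‖z - l‖ := by
    by_contra! h
    exact hδ' (show l ∈ Metric.ball z δ by rwa [Metric.mem_ball, dist_comm, dist_eq_norm]) hl
  have h1 : δ / 2 ≤ ‖w - l‖ := by
    have : ‖z - l‖ ≤ ‖w - z‖ + ‖w - l‖ := by
      rw [norm_sub_rev w z]
      simpa using norm_add_le (z - w) (w - l)
    linarith
  have h2 : ‖l‖ ≤ ‖w - l‖ + (‖z‖ + δ / 2) := by
    have e1 : ‖l‖ ≤ ‖w‖ + ‖w - l‖ := by simpa using norm_sub_le w (w - l)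
    have e2 : ‖w‖ ≤ ‖w - z‖ + ‖z‖ := by simpa using norm_add_le (w - z) z
    linarith
  refine ⟨?_, fun h => ?_⟩
  · rw [inv_mul_le_iff₀ (by positivity)]
    have : ‖z‖ + δ / 2 ≤ (‖z‖ + δ / 2) / (δ / 2) * ‖w - l‖ := by
      rw [div_mul_eq_mul_div, le_div_iff₀ (by positivity)]
      gcongr
    linarith
  · rw [h, sub_self, norm_zero] at h1
    linarith

/-- Locally uniform bound for the summands of `ζ`. -/
lemma exists_norm_zetaTerm_le {z : ℂ} (hz : z ∉ L.lattice) :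
    ∃ ε > 0, ∃ C : ℝ, ∀ w ∈ Metric.ball z ε, ∀ l : NonzeroLattice L,
      ‖zetaTerm l w‖ ≤ C * (‖((l : L.lattice) : ℂ)‖ ^ 3)⁻¹ ∧ w ≠ (l : L.lattice) := by
  obtain ⟨ε, hε, c, hc, h⟩ := exists_norm_sub_lattice_ge L hz
  refine ⟨ε, hε, (‖z‖ + ε) ^ 2 / c, fun w hw l => ?_⟩
  obtain ⟨h1, h2⟩ := h w hw l (l : L.lattice).2
  refine ⟨?_, h2⟩
  have hl : 0 < ‖((l : L.lattice) : ℂ)‖ := norm_pos_iff.mpr l.coe_ne_zero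
  have hw' : ‖w‖ ≤ ‖z‖ + ε := by
    rw [Metric.mem_ball, dist_eq_norm] at hw
    have e2 : ‖w‖ ≤ ‖w - z‖ + ‖z‖ := by simpa using norm_add_le (w - z) z
    linarith
  rw [zetaTerm_eq l.coe_ne_zero h2, norm_div, norm_mul, norm_pow, norm_pow]
  calc _ ≤ (‖z‖ + ε) ^ 2 / (‖((l : L.lattice) : ℂ)‖ ^ 2 * (c * ‖((l : L.lattice) : ℂ)‖)) := by
        gcongr
    _ = _ := by field_simp

lemma summable_zetaTerm {z : ℂ} (hz : z ∉ L.lattice) :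
    Summable fun l : NonzeroLattice L => zetaTerm l z := by
  obtain ⟨ε, hε, C, h⟩ := exists_norm_zetaTerm_le L hz
  exact Summable.of_norm_bounded ((summable_norm_nonzeroLattice L).mul_left C)
    fun l => (h z (Metric.mem_ball_self hε) l).1

lemma logDeriv_sigma {z : ℂ} (hz : z ∉ L.lattice) : logDeriv (sigma L) z = zeta L z := by
  have hP : logDeriv (sigmaProd L) z = ∑' l : NonzeroLattice L, zetaTerm l z := by
    have hfun : sigmaProd L = (∏' l : NonzeroLattice L, sigmaFactor l ·) := rfl
    rw [hfun, logDeriv_tprod_eq_tsum (s := Metric.ball 0 (‖z‖ + 1)) Metric.isOpen_ball (by simp)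
      (fun l => sigmaFactor_ne_zero l.coe_ne_zero (ne_coe_of_notMem L hz l))
      (fun l => (differentiable_sigmaFactor _).differentiableOn) ?_
      (hasProdLocallyUniformlyOn_sigmaFactor L _).multipliableLocallyUniformlyOn
      (sigmaProd_ne_zero L (ne_coe_of_notMem L hz))]
    · exact tsum_congr fun l => logDeriv_sigmaFactor l.coe_ne_zero (ne_coe_of_notMem L hz l)
    · refine (summable_zetaTerm L hz).congr fun l => ?_
      rw [logDeriv_sigmaFactor l.coe_ne_zero (ne_coe_of_notMem L hz l)]
  have : sigma L = fun z => z * sigmaProd L z := rfl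
  rw [this, logDeriv_mul (f := fun z => z) z (ne_zero_of_notMem hz)
    (sigmaProd_ne_zero L (ne_coe_of_notMem L hz))
    differentiableAt_id (differentiable_sigmaProd L z), hP]
  rw [show logDeriv (fun z : ℂ => z) z = 1 / z by simp [logDeriv_apply]]
  rfl

lemma hasDerivAt_sigma {z : ℂ} (hz : z ∉ L.lattice) :
    HasDerivAt (sigma L) (zeta L z * sigma L z) z := by
  have h := (differentiable_sigma L z).hasDerivAt
  rwa [show deriv (sigma L) z = zeta L z * sigma L z by
    rw [← logDeriv_sigma L hz, logDeriv_apply, div_mul_cancel₀ _ (sigma_ne_zero hz)]] at h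

lemma hasDerivAt_zeta {z : ℂ} (hz : z ∉ L.lattice) :
    HasDerivAt (zeta L) (-L.weierstrassP z) z := by
  obtain ⟨ε, hε, C, h⟩ := exists_norm_zetaTerm_le L hz
  have hz0 := ne_zero_of_notMem hz
  have hdt : ∀ (l : NonzeroLattice L), ∀ w ∈ Metric.ball z ε,
      HasDerivAt (zetaTerm l)
        (-(1 / (w - (l : L.lattice)) ^ 2 - 1 / ((l : L.lattice) : ℂ) ^ 2)) w := by
    intro l w hw
    have hne := sub_ne_zero.mpr (h w hw l).2
    have h1 := (((hasDerivAt_id w).sub_const ((l : L.lattice) : ℂ)).inv hne).add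
      ((hasDerivAt_id w).div_const (((l : L.lattice) : ℂ) ^ 2))
    have h2 := h1.add_const (1 / ((l : L.lattice) : ℂ))
    refine (h2.congr_deriv ?_).congr_of_eventuallyEq (.of_forall fun x => ?_)
    · simp only [id]; ring
    · simp [zetaTerm]; ring
  have hF := Complex.hasSum_deriv_of_summable_norm (U := Metric.ball z ε)
    (F := fun (l : NonzeroLattice L) w => zetaTerm l w)
    ((summable_norm_nonzeroLattice L).mul_left C)
    (fun l w hw => (hdt l w hw).differentiableAt.differentiableWithinAt) Metric.isOpen_ball
    (fun l w hw => (h w hw l).1) (Metric.mem_ball_self hε)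
  have hD := Complex.differentiableOn_tsum_of_summable_norm (U := Metric.ball z ε)
    (F := fun (l : NonzeroLattice L) w => zetaTerm l w)
    ((summable_norm_nonzeroLattice L).mul_left C)
    (fun l w hw => (hdt l w hw).differentiableAt.differentiableWithinAt) Metric.isOpen_ball
    (fun l w hw => (h w hw l).1)
  have hD' :=
    (hD.differentiableAt (Metric.isOpen_ball.mem_nhds (Metric.mem_ball_self hε))).hasDerivAt
  have hz1 := (hasDerivAt_id z).inv hz0
  have hsum := hz1.add hD'
  refine (hsum.congr_deriv ?_).congr_of_eventuallyEq (.of_forall fun x => ?_)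
  · rw [← hF.tsum_eq]
    have e1 : ∀ l : NonzeroLattice L, deriv (zetaTerm l) z
        = -(1 / (z - (l : L.lattice)) ^ 2 - 1 / ((l : L.lattice) : ℂ) ^ 2) :=
      fun l => (hdt l z (Metric.mem_ball_self hε)).deriv
    simp only [e1]
    rw [tsum_neg]
    have hs := L.hasSum_weierstrassP z
    have h0 := hs.summable.tsum_eq_add_tsum_ite (0 : L.lattice)
    rw [← hs.tsum_eq, h0]
    have h1 : (∑' l : NonzeroLattice L,
        (1 / (z - (l : L.lattice)) ^ 2 - 1 / ((l : L.lattice) : ℂ) ^ 2))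
      = ∑' l : L.lattice, if l = 0 then 0 else (1 / (z - l) ^ 2 - 1 / (l : ℂ) ^ 2) := by
      have := tsum_subtype {l : L.lattice | l ≠ 0} (fun l => (1 / (z - l) ^ 2 - 1 / (l : ℂ) ^ 2))
      refine Eq.trans this (tsum_congr fun l => ?_)
      by_cases hl : l = 0 <;> simp [Set.indicator, hl]
    rw [h1]
    simp only [id, ZeroMemClass.coe_zero, sub_zero]
    ring
  · simp [zeta, zetaTerm]

end

section

variable (L : PeriodPair)

/-! ### Elliptic functions and quasi-periodicity -/

lemma isOpen_compl_lattice : IsOpen ((L.lattice : Set ℂ)ᶜ) := L.isClosed_lattice.isOpen_compl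

lemma eventually_notMem {z : ℂ} (hz : z ∉ L.lattice) : ∀ᶠ w in 𝓝 z, w ∉ L.lattice :=
  (isOpen_compl_lattice L).mem_nhds hz

lemma countable_lattice : (L.lattice : Set ℂ).Countable := by
  have : Countable L.lattice := L.latticeEquivProd.toEquiv.countable_iff.mpr inferInstance
  exact Set.countable_coe_iff.mp this

lemma isPreconnected_compl_lattice : IsPreconnected ((L.lattice : Set ℂ)ᶜ) :=
  ((countable_lattice L).isConnected_compl_of_one_lt_rank (by simp)).isPreconnected

lemma add_coe_notMem {z l : ℂ} (hz : z ∉ L.lattice) (hl : l ∈ L.lattice) : z + l ∉ L.lattice :=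
  fun h => hz (by simpa using sub_mem h hl)

lemma neg_notMem {L : PeriodPair} {z : ℂ} (hz : z ∉ L.lattice) : -z ∉ L.lattice :=
  fun h => hz (by simpa using neg_mem h)

/-- Liouville's theorem for elliptic functions: if the only possible singularities are the
lattice points, and these are removable with value `c`, then the function is constant. -/
lemma eq_const_of_periodic {f : ℂ → ℂ} {c : ℂ}
    (hper : ∀ z ∉ L.lattice, ∀ l ∈ L.lattice, f (z + l) = f z)
    (hd : DifferentiableOn ℂ f (L.lattice : Set ℂ)ᶜ) (h0 : Tendsto f (𝓝[≠] 0) (𝓝 c))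
    {z : ℂ} (hz : z ∉ L.lattice) : f z = c := by
  classical
  set F : ℂ → ℂ := fun w => if w ∈ L.lattice then c else f w with hF
  have hFper : ∀ w, ∀ l ∈ L.lattice, F (w + l) = F w := by
    intro w l hl
    by_cases hw : w ∈ L.lattice
    · simp [hF, hw, add_mem hw hl]
    · simp [hF, hw, add_coe_notMem L hw hl, hper w hw l hl]
  have hoff : ∀ w ∉ L.lattice, DifferentiableAt ℂ F w := by
    intro w hw
    refine (hd.differentiableAt ((isOpen_compl_lattice L).mem_nhds hw)).congr_of_eventuallyEq ?_
    filter_upwards [eventually_notMem L hw] with x hx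
    simp [hF, hx]
  have hnear : ∀ᶠ w in 𝓝[≠] (0 : ℂ), w ∉ L.lattice := by
    filter_upwards [self_mem_nhdsWithin,
      mem_nhdsWithin_of_mem_nhds (L.compl_lattice_sdiff_singleton_mem_nhds 0)] with w hw hw'
    intro h
    exact hw' ⟨h, hw⟩
  have hat0 : DifferentiableAt ℂ F 0 := by
    refine (Complex.analyticAt_of_differentiable_on_punctured_nhds_of_continuousAt
      (hnear.mono fun w hw => hoff w hw) ?_).differentiableAt
    rw [continuousAt_iff_punctured_nhds]
    have hF0 : F 0 = c := by simp [hF]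
    rw [hF0]
    refine h0.congr' ?_
    filter_upwards [hnear] with w hw
    simp [hF, hw]
  have hdiff : Differentiable ℂ F := by
    intro w
    by_cases hw : w ∈ L.lattice
    · have : F = fun x => F (x - w) := by
        ext x
        rw [← hFper (x - w) w hw, sub_add_cancel]
      rw [this]
      refine DifferentiableAt.comp w (g := F) (f := fun x => x - w) ?_ (by fun_prop)
      simpa using hat0
    · exact hoff w hw
  have := hdiff.apply_eq_apply_of_bounded (IsZLattice.isCompact_range_of_periodic L.lattice F
    hdiff.continuous fun z w hw => hFper z w hw).isBounded z 0
  simpa [hF, hz] using this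

/-- The quasi-period `ζ(z + l) - ζ(z)` of a lattice point `l`. It does not depend on `z`, and the
half period `ω₁ / 2` is chosen to evaluate it. -/
noncomputable def quasiPeriod (l : ℂ) : ℂ :=
  zeta L (L.ω₁ / 2 + l) - zeta L (L.ω₁ / 2)

/-- The complement of the lattice is connected, as the lattice is countable, so a function whose
derivative vanishes there is constant. -/
lemma eq_of_deriv_zero {f : ℂ → ℂ} (hf : ∀ z ∉ L.lattice, HasDerivAt f 0 z) {z w : ℂ}
    (hz : z ∉ L.lattice) (hw : w ∉ L.lattice) : f z = f w := by
  refine (isOpen_compl_lattice L).is_const_of_deriv_eq_zero (isPreconnected_compl_lattice L)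
    (fun x hx => (hf x hx).differentiableAt.differentiableWithinAt) (fun x hx => (hf x hx).deriv)
    hz hw

lemma zeta_add_coe {z l : ℂ} (hz : z ∉ L.lattice) (hl : l ∈ L.lattice) :
    zeta L (z + l) = zeta L z + quasiPeriod L l := by
  have key : ∀ z ∉ L.lattice, HasDerivAt (fun w => zeta L (w + l) - zeta L w) 0 z := by
    intro z hz
    have h1 := (hasDerivAt_zeta L (add_coe_notMem L hz hl)).comp_add_const z l
    refine (h1.sub (hasDerivAt_zeta L hz)).congr_deriv ?_
    have := L.weierstrassP_add_coe z ⟨l, hl⟩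
    simp only at this
    rw [this]; ring
  have := eq_of_deriv_zero L key hz L.ω₁_div_two_notMem_lattice
  rw [quasiPeriod, ← this]; ring

/-- The quasi-periodicity factor of `σ` under translation by a lattice point. -/
lemma exists_sigma_add_coe {l : ℂ} (hl : l ∈ L.lattice) :
    ∃ C : ℂ, C ≠ 0 ∧ ∀ z, sigma L (z + l) = C * Complex.exp (quasiPeriod L l * z) * sigma L z := by
  have key : ∀ z ∉ L.lattice, HasDerivAt
      (fun w => sigma L (w + l) * (Complex.exp (-(quasiPeriod L l * w)) / sigma L w)) 0 z := by
    intro z hz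
    have h1 := (hasDerivAt_sigma L (add_coe_notMem L hz hl)).comp_add_const z l
    have h2 := hasDerivAt_sigma L hz
    have h3 : HasDerivAt (fun w => Complex.exp (-(quasiPeriod L l * w)))
        (Complex.exp (-(quasiPeriod L l * z)) * -(quasiPeriod L l * 1)) z :=
      (((hasDerivAt_id z).const_mul _).neg).cexp
    refine (h1.mul (h3.div h2 (sigma_ne_zero hz))).congr_deriv ?_
    rw [zeta_add_coe L hz hl]
    have := sigma_ne_zero hz
    simp only [Pi.div_apply]
    field_simp
    ring
  set h := L.ω₁ / 2
  have hh : h ∉ L.lattice := L.ω₁_div_two_notMem_lattice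
  refine ⟨sigma L (h + l) * (Complex.exp (-(quasiPeriod L l * h)) / sigma L h), ?_, fun z => ?_⟩
  · exact mul_ne_zero (sigma_ne_zero (add_coe_notMem L hh hl))
      (div_ne_zero (Complex.exp_ne_zero _) (sigma_ne_zero hh))
  · by_cases hz : z ∈ L.lattice
    · rw [sigma_eq_zero hz, sigma_eq_zero (add_mem hz hl), mul_zero]
    · have e := eq_of_deriv_zero L key hz hh
      rw [← e, Complex.exp_neg]
      have := sigma_ne_zero hz
      have := Complex.exp_ne_zero (quasiPeriod L l * z)
      field_simp

/-! ### The addition theorem for `℘` -/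

/-- An even entire function vanishing at `0` is `O(u²)`, with a limit of `A(u) / u²`. -/
lemma exists_tendsto_div_sq {A : ℂ → ℂ} (hA : Differentiable ℂ A) (h0 : A 0 = 0)
    (heven : ∀ u, A (-u) = A u) : ∃ c, Tendsto (fun u => A u / u ^ 2) (𝓝[≠] 0) (𝓝 c) := by
  have hd0 : deriv A 0 = 0 := by
    have h1 : HasDerivAt A (deriv A 0) (-0) := by simpa using (hA 0).hasDerivAt
    have h2 := h1.scomp (0 : ℂ) (hasDerivAt_neg (0 : ℂ))
    have h3 : A ∘ Neg.neg = A := by ext u; simp [heven]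
    rw [h3] at h2
    have h4 := h2.unique (hA 0).hasDerivAt
    simp only [smul_eq_mul, neg_mul, one_mul] at h4
    exact self_eq_neg.mp h4.symm
  have hs : Differentiable ℂ (dslope A 0) := by
    rw [← differentiableOn_univ] at hA ⊢
    exact (Complex.differentiableOn_dslope (by simp)).mpr hA
  have hs2 : Differentiable ℂ (dslope (dslope A 0) 0) := by
    rw [← differentiableOn_univ] at hs ⊢
    exact (Complex.differentiableOn_dslope (by simp)).mpr hs
  refine ⟨_, ((hs2.continuous.tendsto 0).mono_left nhdsWithin_le_nhds).congr' ?_⟩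
  filter_upwards [self_mem_nhdsWithin] with u hu
  have hu : u ≠ 0 := hu
  rw [dslope_of_ne _ hu, slope_def_field, dslope_of_ne _ hu, slope_def_field, dslope_same, hd0, h0]
  field_simp
  ring

/-- `℘(u) - ℘(v) = -σ(u+v) σ(u-v) / (σ(u)² σ(v)²)`. -/
lemma weierstrassP_sub_eq {u v : ℂ} (hu : u ∉ L.lattice) (hv : v ∉ L.lattice) :
    L.weierstrassP u - L.weierstrassP v
      = -(sigma L (u + v) * sigma L (u - v)) / (sigma L u ^ 2 * sigma L v ^ 2) := by
  -- the elliptic function `g` has a removable singularity at `0`, hence is constant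
  set g : ℂ → ℂ := fun u => sigma L (u + v) * sigma L (u - v) / sigma L u ^ 2
    + sigma L v ^ 2 * L.weierstrassP u with hg
  have hper : ∀ z ∉ L.lattice, ∀ l ∈ L.lattice, g (z + l) = g z := by
    intro z hz l hl
    obtain ⟨C, hC, h⟩ := exists_sigma_add_coe L hl
    have hP := L.weierstrassP_add_coe z ⟨l, hl⟩
    simp only at hP
    simp only [hg, hP]
    congr 1
    rw [show z + l + v = z + v + l by ring, show z + l - v = z - v + l by ring, h, h, h]
    have := sigma_ne_zero hz
    have e : Complex.exp (quasiPeriod L l * (z + v)) * Complex.exp (quasiPeriod L l * (z - v))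
        = Complex.exp (quasiPeriod L l * z) ^ 2 := by
      rw [← Complex.exp_add, ← Complex.exp_nat_mul]
      congr 1; push_cast; ring
    have hE := Complex.exp_ne_zero (quasiPeriod L l * z)
    rw [div_eq_div_iff (by positivity) (by positivity)]
    linear_combination (C ^ 2 * sigma L (z + v) * sigma L (z - v) * sigma L z ^ 2) * e
  have hσ := differentiable_sigma L
  have hdiff : DifferentiableOn ℂ g (L.lattice : Set ℂ)ᶜ := by
    refine DifferentiableOn.add (DifferentiableOn.div ?_ ?_ ?_) ?_
    · exact Differentiable.differentiableOn (by fun_prop)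
    · exact Differentiable.differentiableOn (by fun_prop)
    · exact fun x hx => pow_ne_zero 2 (sigma_ne_zero hx)
    · exact L.differentiableOn_weierstrassP.const_mul _
  set A : ℂ → ℂ := fun u => sigma L (u + v) * sigma L (u - v) + sigma L v ^ 2 * sigmaProd L u ^ 2
    with hA
  have hPd := differentiable_sigmaProd L
  obtain ⟨c, hc⟩ := exists_tendsto_div_sq (A := A) (by fun_prop)
    (by simp [hA, sigma_neg]; ring) (fun u => by
      have hPneg : sigmaProd L (-u) = sigmaProd L u := by
        by_cases h : u = 0
        · simp [h]
        · have := sigma_neg L u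
          rw [sigma_eq, sigma_eq] at this
          exact mul_left_cancel₀ h (by linear_combination -this)
      simp only [hA, hPneg]
      rw [show -u + v = -(u - v) by ring, show -u - v = -(u + v) by ring, sigma_neg, sigma_neg]
      ring)
  have hnear : ∀ᶠ w in 𝓝[≠] (0 : ℂ), w ∉ L.lattice := by
    filter_upwards [self_mem_nhdsWithin,
      mem_nhdsWithin_of_mem_nhds (L.compl_lattice_sdiff_singleton_mem_nhds 0)] with w hw hw'
    exact fun h => hw' ⟨h, hw⟩
  have hlim : Tendsto g (𝓝[≠] 0) (𝓝 (c / sigmaProd L 0 ^ 2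
      + sigma L v ^ 2 * L.weierstrassPExcept 0 0)) := by
    have hW : Tendsto (L.weierstrassPExcept 0) (𝓝[≠] 0) (𝓝 (L.weierstrassPExcept 0 0)) :=
      ((L.analyticAt_weierstrassPExcept 0).continuousAt.tendsto).mono_left nhdsWithin_le_nhds
    have hP : Tendsto (sigmaProd L) (𝓝[≠] 0) (𝓝 (sigmaProd L 0)) :=
      (hPd.continuous.tendsto 0).mono_left nhdsWithin_le_nhds
    refine ((hc.div (hP.pow 2) (by simp)).add (hW.const_mul (sigma L v ^ 2))).congr' ?_
    filter_upwards [hnear] with w hw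
    have hw0 := ne_zero_of_notMem hw
    have hp : sigmaProd L w ≠ 0 := sigmaProd_ne_zero L (ne_coe_of_notMem L hw)
    have hW := L.weierstrassPExcept_add 0 w
    simp only [ZeroMemClass.coe_zero, sub_zero] at hW
    simp only [hg, ← hW, hA, Pi.div_apply, sigma_eq L w]
    field_simp
    ring
  have h1 := eq_const_of_periodic L hper hdiff hlim hu
  have h2 := eq_const_of_periodic L hper hdiff hlim hv
  rw [← h2] at h1
  simp only [hg, sub_self, sigma_zero, mul_zero, zero_div, zero_add] at h1
  have hu0 := sigma_ne_zero hu
  have hv0 := sigma_ne_zero hv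
  rw [eq_div_iff (by positivity)]
  field_simp at h1
  linear_combination h1

/-! ### The differential equation of second order -/

lemma hasDerivAt_weierstrassP {z : ℂ} (hz : z ∉ L.lattice) :
    HasDerivAt L.weierstrassP (L.derivWeierstrassP z) z := by
  have := (L.analyticOnNhd_weierstrassP z hz).differentiableAt.hasDerivAt
  rwa [L.deriv_weierstrassP] at this

/-- `℘'' = 6 ℘² - g₂/2`. -/
lemma hasDerivAt_derivWeierstrassP {z : ℂ} (hz : z ∉ L.lattice) :
    HasDerivAt L.derivWeierstrassP (6 * L.weierstrassP z ^ 2 - L.g₂ / 2) z := by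
  have hd : ∀ w ∉ L.lattice, HasDerivAt L.derivWeierstrassP (deriv L.derivWeierstrassP w) w :=
    fun w hw => (L.analyticOnNhd_derivWeierstrassP w hw).differentiableAt.hasDerivAt
  -- differentiating the equation of first order gives the claim after multiplication by `℘'`
  have hmul : ∀ w ∉ L.lattice, L.derivWeierstrassP w *
      (2 * deriv L.derivWeierstrassP w - 12 * L.weierstrassP w ^ 2 + L.g₂) = 0 := by
    intro w hw
    have h1 := (hd w hw).pow 2
    have h2 := ((((hasDerivAt_weierstrassP L hw).pow 3).const_mul 4).sub
      ((hasDerivAt_weierstrassP L hw).const_mul L.g₂)).sub_const L.g₃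
    have h3 : HasDerivAt (fun z => 4 * L.weierstrassP z ^ 3 - L.g₂ * L.weierstrassP z - L.g₃) _ w :=
      h1.congr_of_eventuallyEq (by
        filter_upwards [eventually_notMem L hw] with x hx
        rw [Pi.pow_apply, L.derivWeierstrassP_sq x hx])
    have h4 := h3.unique h2
    norm_num at h4
    linear_combination h4
  by_contra hne
  have hne' : 2 * deriv L.derivWeierstrassP z - 12 * L.weierstrassP z ^ 2 + L.g₂ ≠ 0 := by
    intro h
    refine hne ((hd z hz).congr_deriv ?_)
    linear_combination h / 2
  have hcont : ContinuousAt (fun z => 2 * deriv L.derivWeierstrassP z - 12 * L.weierstrassP z ^ 2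
      + L.g₂) z := by
    have h1 := (L.analyticOnNhd_derivWeierstrassP z hz).deriv.continuousAt
    have h2 := (L.analyticOnNhd_weierstrassP z hz).continuousAt
    fun_prop
  have hzero : L.derivWeierstrassP =ᶠ[𝓝 z] 0 := by
    filter_upwards [hcont.eventually_ne hne', eventually_notMem L hz] with w hw hw'
    exact (mul_eq_zero.mp (hmul w hw')).resolve_right hw
  have hall := L.analyticOnNhd_derivWeierstrassP.eqOn_zero_of_preconnected_of_eventuallyEq_zero
    (isPreconnected_compl_lattice L) hz hzero
  -- `℘` would be constant, which contradicts its pole at the origin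
  have hconst : ∀ w ∉ L.lattice, L.weierstrassP w = L.weierstrassP z := fun w hw =>
    eq_of_deriv_zero L (fun x hx => by
      simpa [hall hx] using hasDerivAt_weierstrassP L hx) hw hz
  have hW : Tendsto (L.weierstrassPExcept 0) (𝓝[≠] 0) (𝓝 (L.weierstrassPExcept 0 0)) :=
    ((L.analyticAt_weierstrassPExcept 0).continuousAt.tendsto).mono_left nhdsWithin_le_nhds
  have hsq : Tendsto (fun w : ℂ => w ^ 2) (𝓝[≠] 0) (𝓝 (0 ^ 2)) :=
    ((continuous_pow 2).tendsto 0).mono_left nhdsWithin_le_nhds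
  have hlim1 : Tendsto (fun w : ℂ => (L.weierstrassP z - L.weierstrassPExcept 0 w) * w ^ 2) (𝓝[≠] 0)
      (𝓝 ((L.weierstrassP z - L.weierstrassPExcept 0 0) * 0 ^ 2)) := (hW.const_sub _).mul hsq
  have hlim2 : Tendsto (fun w : ℂ => (L.weierstrassP z - L.weierstrassPExcept 0 w) * w ^ 2) (𝓝[≠] 0)
      (𝓝 1) := by
    refine tendsto_const_nhds.congr' ?_
    filter_upwards [self_mem_nhdsWithin,
      mem_nhdsWithin_of_mem_nhds (L.compl_lattice_sdiff_singleton_mem_nhds 0)] with w hw hw'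
    have hw0 : w ≠ 0 := hw
    have hw1 : w ∉ L.lattice := fun h => hw' ⟨h, hw⟩
    have hW := L.weierstrassPExcept_add 0 w
    simp only [ZeroMemClass.coe_zero, sub_zero] at hW
    rw [← hconst w hw1, ← hW]
    field_simp
    ring
  have := tendsto_nhds_unique hlim1 hlim2
  norm_num at this

end

section

variable (L : PeriodPair)

/-! ### Addition formulas -/

lemma dense_compl_lattice : Dense ((L.lattice : Set ℂ)ᶜ) := (countable_lattice L).dense_compl ℂ

lemma eq_of_eqOn_compl_lattice {f g : ℂ → ℂ} (hf : Continuous f) (hg : Continuous g)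
    (h : ∀ z ∉ L.lattice, f z = g z) (z : ℂ) : f z = g z :=
  congrFun (hf.ext_on (dense_compl_lattice L) hg fun z hz => h z hz) z

/-- Weierstrass' three-term relation. Off the lattice it is an identity between differences of
values of `℘`; the general case follows by density. -/
lemma sigma_three_term (p q r s : ℂ) :
    sigma L (p + q) * sigma L (p - q) * (sigma L (r + s) * sigma L (r - s))
      + sigma L (q + r) * sigma L (q - r) * (sigma L (p + s) * sigma L (p - s))
      + sigma L (r + p) * sigma L (r - p) * (sigma L (q + s) * sigma L (q - s)) = 0 := by
  have hc : Continuous (sigma L) := (differentiable_sigma L).continuous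
  have key : ∀ {u v}, u ∉ L.lattice → v ∉ L.lattice → sigma L (u + v) * sigma L (u - v)
      = -(L.weierstrassP u - L.weierstrassP v) * (sigma L u ^ 2 * sigma L v ^ 2) := by
    intro u v hu hv
    rw [weierstrassP_sub_eq L hu hv]
    have := sigma_ne_zero hu
    have := sigma_ne_zero hv
    field_simp
  let T : ℂ → ℂ → ℂ → ℂ → ℂ := fun p q r s =>
    sigma L (p + q) * sigma L (p - q) * (sigma L (r + s) * sigma L (r - s))
      + sigma L (q + r) * sigma L (q - r) * (sigma L (p + s) * sigma L (p - s))
      + sigma L (r + p) * sigma L (r - p) * (sigma L (q + s) * sigma L (q - s))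
  change T p q r s = 0
  refine eq_of_eqOn_compl_lattice L (f := fun p => T p q r s) (g := fun _ => 0)
    (by fun_prop) (by fun_prop) (fun p hp => ?_) p
  refine eq_of_eqOn_compl_lattice L (f := fun q => T p q r s) (g := fun _ => 0)
    (by fun_prop) (by fun_prop) (fun q hq => ?_) q
  refine eq_of_eqOn_compl_lattice L (f := fun r => T p q r s) (g := fun _ => 0)
    (by fun_prop) (by fun_prop) (fun r hr => ?_) r
  refine eq_of_eqOn_compl_lattice L (f := fun s => T p q r s) (g := fun _ => 0)
    (by fun_prop) (by fun_prop) (fun s hs => ?_) s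
  simp only [T]
  rw [key hp hq, key hr hs, key hq hr, key hp hs, key hr hp, key hq hs]
  ring

lemma hasDerivAt_sigma_zero : HasDerivAt (sigma L) 1 0 := by
  have h := (hasDerivAt_id (0 : ℂ)).mul (differentiable_sigmaProd L 0).hasDerivAt
  refine (h.congr_deriv (by simp)).congr_of_eventuallyEq (.of_forall fun z => ?_)
  simp [sigma_eq]

/-- The derivative of the three-term relation at coinciding arguments. -/
lemma zeta_add_add_sub {a b c : ℂ} (ha : a ∉ L.lattice) (hb : b ∉ L.lattice) (hc : c ∉ L.lattice)
    (habc : a + b + c ∉ L.lattice) :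
    zeta L a + zeta L b + zeta L c - zeta L (a + b + c)
      = sigma L (a + b) * sigma L (b + c) * sigma L (c + a)
        / (sigma L a * sigma L b * sigma L c * sigma L (a + b + c)) := by
  set q := (a + b) / 2 with hq
  set r := (a - b) / 2 with hr
  set s := q + c with hs
  have e1 : q + r = a := by rw [hq, hr]; ring
  have e2 : q - r = b := by rw [hq, hr]; ring
  have e3 : q + s = a + b + c := by rw [hs, hq]; ring
  have e4 : q - s = -c := by rw [hs]; ring
  have e5 : r + s = c + a := by rw [hs, hq, hr]; ring
  have e6 : r - s = -(b + c) := by rw [hs, hq, hr]; ring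
  have e7 : q + q = a + b := by rw [hq]; ring
  have hT : ∀ p, sigma L (p + q) * sigma L (p - q) * (sigma L (r + s) * sigma L (r - s))
      + sigma L (q + r) * sigma L (q - r) * (sigma L (p + s) * sigma L (p - s))
      - sigma L (p + r) * sigma L (p - r) * (sigma L (q + s) * sigma L (q - s)) = 0 := by
    intro p
    have h := sigma_three_term L p q r s
    rw [show r - p = -(p - r) by ring, sigma_neg, add_comm r p] at h
    linear_combination h
  have hσ : ∀ w, w ∉ L.lattice → ∀ d : ℂ, ∀ p, p + d = w →
      HasDerivAt (fun p => sigma L (p + d)) (zeta L w * sigma L w) p := by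
    intro w hw d p h
    subst h
    exact (hasDerivAt_sigma L hw).comp_add_const p d
  have d1 : HasDerivAt (fun p => sigma L (p + q)) (deriv (sigma L) (q + q)) q :=
    ((differentiable_sigma L (q + q)).hasDerivAt).comp_add_const q q
  have d2 : HasDerivAt (fun p => sigma L (p - q)) 1 q := by
    have : HasDerivAt (sigma L) 1 (q - q) := by simpa using hasDerivAt_sigma_zero L
    exact this.comp_sub_const q q
  have d3 := hσ _ habc s q e3
  have d4 := hσ _ (neg_notMem hc) (-s) q (by rw [← sub_eq_add_neg, e4])
  have d5 := hσ _ ha r q e1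
  have d6 := hσ _ hb (-r) q (by rw [← sub_eq_add_neg, e2])
  simp only [← sub_eq_add_neg] at d4 d6
  have D := (((d1.mul d2).mul_const (sigma L (r + s) * sigma L (r - s))).add
    ((d3.mul d4).const_mul (sigma L (q + r) * sigma L (q - r)))).sub
    ((d5.mul d6).mul_const (sigma L (q + s) * sigma L (q - s)))
  have D0 : HasDerivAt (fun _ : ℂ => (0 : ℂ)) _ q :=
    D.congr_of_eventuallyEq (.of_forall fun p => (hT p).symm)
  have E := D0.unique (hasDerivAt_const q 0)
  simp only [sub_self, sigma_zero, mul_zero, mul_one, e1, e2, e3, e4, e5, e6, e7, zero_add,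
    sigma_neg, zeta_neg] at E
  have h1 := sigma_ne_zero ha
  have h2 := sigma_ne_zero hb
  have h3 := sigma_ne_zero hc
  have h4 := sigma_ne_zero habc
  rw [eq_div_iff (by positivity)]
  linear_combination E

/-- Logarithmic derivative of the product formula for `℘(u) - ℘(v)`. -/
lemma derivWeierstrassP_eq_mul {u v : ℂ} (hu : u ∉ L.lattice) (hv : v ∉ L.lattice)
    (huv : u + v ∉ L.lattice) (huv' : u - v ∉ L.lattice) :
    L.derivWeierstrassP u = (L.weierstrassP u - L.weierstrassP v)
      * (zeta L (u + v) + zeta L (u - v) - 2 * zeta L u) := by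
  have h1 := (hasDerivAt_weierstrassP L hu).sub_const (L.weierstrassP v)
  have h2 := (((hasDerivAt_sigma L huv).comp_add_const u v).mul
    ((hasDerivAt_sigma L huv').comp_sub_const u v)).neg.div
    (((hasDerivAt_sigma L hu).pow 2).mul_const (sigma L v ^ 2))
    (mul_ne_zero (pow_ne_zero 2 (sigma_ne_zero hu)) (pow_ne_zero 2 (sigma_ne_zero hv)))
  have h3 := h2.congr_of_eventuallyEq (f₁ := fun w => L.weierstrassP w - L.weierstrassP v) (by
    filter_upwards [eventually_notMem L hu] with w hw
    rw [weierstrassP_sub_eq L hw hv]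
    rfl)
  rw [h1.unique h3, weierstrassP_sub_eq L hu hv]
  have := sigma_ne_zero hu
  have := sigma_ne_zero hv
  simp only [Pi.mul_apply, Pi.pow_apply, Pi.neg_apply]
  field_simp
  ring

lemma zeta_add_mul {u v : ℂ} (hu : u ∉ L.lattice) (hv : v ∉ L.lattice)
    (huv : u + v ∉ L.lattice) (huv' : u - v ∉ L.lattice) :
    2 * (L.weierstrassP u - L.weierstrassP v) * (zeta L (u + v) - zeta L u - zeta L v)
      = L.derivWeierstrassP u - L.derivWeierstrassP v := by
  have h1 := derivWeierstrassP_eq_mul L hu hv huv huv'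
  have h2 := derivWeierstrassP_eq_mul L hv hu (by rwa [add_comm])
    (by simpa using neg_notMem huv')
  rw [show v - u = -(u - v) by ring, zeta_neg, add_comm v u] at h2
  rw [h1, h2]
  ring

lemma weierstrassP_sub_ne_zero {u v : ℂ} (hu : u ∉ L.lattice) (hv : v ∉ L.lattice)
    (huv : u + v ∉ L.lattice) (huv' : u - v ∉ L.lattice) :
    L.weierstrassP u - L.weierstrassP v ≠ 0 := by
  rw [weierstrassP_sub_eq L hu hv]
  have := sigma_ne_zero hu
  have := sigma_ne_zero hv
  have := sigma_ne_zero huv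
  have := sigma_ne_zero huv'
  exact div_ne_zero (neg_ne_zero.mpr (by positivity)) (by positivity)

/-- Addition theorem for `℘` in terms of `ζ`. -/
lemma zeta_add_sq {u v : ℂ} (hu : u ∉ L.lattice) (hv : v ∉ L.lattice)
    (huv : u + v ∉ L.lattice) (huv' : u - v ∉ L.lattice) :
    (zeta L (u + v) - zeta L u - zeta L v) ^ 2
      = L.weierstrassP u + L.weierstrassP v + L.weierstrassP (u + v) := by
  have hne := weierstrassP_sub_ne_zero L hu hv huv huv'
  have h0 := zeta_add_mul L hu hv huv huv'
  have h1 := (((hasDerivAt_weierstrassP L hu).sub_const (L.weierstrassP v)).const_mul 2).mul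
    ((((hasDerivAt_zeta L huv).comp_add_const u v).sub (hasDerivAt_zeta L hu)).sub_const (zeta L v))
  have h2 := (hasDerivAt_derivWeierstrassP L hu).sub_const (L.derivWeierstrassP v)
  have hev : ∀ᶠ w in 𝓝 u, w + v ∉ L.lattice :=
    (continuous_add_const v).continuousAt.eventually (eventually_notMem L huv)
  have hev' : ∀ᶠ w in 𝓝 u, w - v ∉ L.lattice :=
    (by fun_prop : Continuous fun w : ℂ => w - v).continuousAt.eventually (eventually_notMem L huv')
  have h3 := h1.congr_of_eventuallyEq
    (f₁ := fun w => L.derivWeierstrassP w - L.derivWeierstrassP v) (by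
      filter_upwards [eventually_notMem L hu, hev, hev'] with w hw hw1 hw2
      exact (zeta_add_mul L hw hv hw1 hw2).symm)
  have h4 := h3.unique h2
  simp only [Pi.sub_apply] at h4
  have o1 := L.derivWeierstrassP_sq u hu
  have o2 := L.derivWeierstrassP_sq v hv
  generalize zeta L (u + v) - zeta L u - zeta L v = P at *
  generalize L.weierstrassP u = X at *
  generalize L.weierstrassP v = Y at *
  generalize L.weierstrassP (u + v) = Z at *
  generalize L.derivWeierstrassP u = X' at *
  generalize L.derivWeierstrassP v = Y' at *
  -- eliminate `℘'` by `(℘')² = 4 ℘³ - g₂ ℘ - g₃` at both points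
  have : (X - Y) ^ 2 * (P ^ 2 - (X + Y + Z)) = 0 := by
    linear_combination (X - Y) / 2 * h4 + (2 * (X - Y) * P + (X' - Y') - 2 * X') / 4 * h0
      - o1 / 4 + o2 / 4
  have := (mul_eq_zero.mp this).resolve_left (pow_ne_zero 2 hne)
  linear_combination this

/-- With `E = ζ(z) + ζ(k) + ζ(l) - ζ(z+k+l)`, the identity `E (P - R) = -(℘(k) - ℘(l))`, where
`P = ζ(z+k) - ζ(z) - ζ(k)` and `R = ζ(z+l) - ζ(z) - ζ(l)`. -/
lemma zeta_product_identity {z k l : ℂ} (hz : z ∉ L.lattice) (hk : k ∉ L.lattice)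
    (hl : l ∉ L.lattice) (hzk : z + k ∉ L.lattice) (hzl : z + l ∉ L.lattice)
    (hzkl : z + k + l ∉ L.lattice) :
    (zeta L z + zeta L k + zeta L l - zeta L (z + k + l))
      * (zeta L (z + k) - zeta L k - (zeta L (z + l) - zeta L l))
      = -(L.weierstrassP k - L.weierstrassP l) := by
  have h1 := zeta_add_add_sub L hz hk hl hzkl
  have h2 := zeta_add_add_sub L hzk (neg_notMem hk) hl (by simpa using hzl)
  rw [show z + k + -k + l = z + l by ring, show z + k + -k = z by ring,
    show -k + l = -(k - l) by ring, show l + (z + k) = z + k + l by ring,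
    zeta_neg, sigma_neg, sigma_neg] at h2
  have e : zeta L (z + k) - zeta L k - (zeta L (z + l) - zeta L l)
      = zeta L (z + k) + -zeta L k + zeta L l - zeta L (z + l) := by ring
  rw [e, h1, h2, weierstrassP_sub_eq L hk hl, add_comm l z]
  have := sigma_ne_zero hz
  have := sigma_ne_zero hk
  have := sigma_ne_zero hl
  have := sigma_ne_zero hzk
  have := sigma_ne_zero hzl
  have := sigma_ne_zero hzkl
  field_simp

/-- The identity `E (℘(z) + ℘(k) + ℘(l) - P R) = -(℘'(k) + ℘'(l)) / 2`, obtained from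
`zeta_product_identity` by differentiation in `k` and in `l`. -/
lemma zeta_product_identity' {z k l : ℂ} (hz : z ∉ L.lattice) (hk : k ∉ L.lattice)
    (hl : l ∉ L.lattice) (hzk : z + k ∉ L.lattice) (hzl : z + l ∉ L.lattice)
    (hzkl : z + k + l ∉ L.lattice) (hzk' : z - k ∉ L.lattice) (hzl' : z - l ∉ L.lattice) :
    (zeta L z + zeta L k + zeta L l - zeta L (z + k + l))
      * (L.weierstrassP z + L.weierstrassP k + L.weierstrassP l
        - (zeta L (z + k) - zeta L z - zeta L k) * (zeta L (z + l) - zeta L z - zeta L l))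
      = -(L.derivWeierstrassP k + L.derivWeierstrassP l) / 2 := by
  have h0 := zeta_product_identity L hz hk hl hzk hzl hzkl
  have zk := (hasDerivAt_zeta L hzk).comp_const_add z k
  have zl := (hasDerivAt_zeta L hzl).comp_const_add z l
  have zkl1 := ((hasDerivAt_zeta L hzkl).comp_add_const (z + k) l).comp_const_add z k
  have zkl2 := (hasDerivAt_zeta L hzkl).comp_const_add (z + k) l
  have hk' := hasDerivAt_zeta L hk
  have hl' := hasDerivAt_zeta L hl
  have evk : ∀ᶠ w in 𝓝 k, z + w ∉ L.lattice :=
    (continuous_const_add z).continuousAt.eventually (eventually_notMem L hzk)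
  have evl : ∀ᶠ w in 𝓝 l, z + w ∉ L.lattice :=
    (continuous_const_add z).continuousAt.eventually (eventually_notMem L hzl)
  have evk2 : ∀ᶠ w in 𝓝 k, z + w + l ∉ L.lattice :=
    ((continuous_const_add z).add_const l).continuousAt.eventually (eventually_notMem L hzkl)
  have evl2 : ∀ᶠ w in 𝓝 l, z + k + w ∉ L.lattice :=
    (continuous_const_add (z + k)).continuousAt.eventually (eventually_notMem L hzkl)
  have A := (((hk'.const_add (zeta L z)).add_const (zeta L l)).sub zkl1).mul
    ((zk.sub hk').sub_const (zeta L (z + l) - zeta L l))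
  have A' := A.congr_of_eventuallyEq (f₁ := fun w => -(L.weierstrassP w - L.weierstrassP l)) (by
      filter_upwards [eventually_notMem L hk, evk, evk2] with w hw hw1 hw2
      exact (zeta_product_identity L hz hw hl hw1 hzl hw2).symm)
  have A'' := A'.unique ((hasDerivAt_weierstrassP L hk).sub_const (L.weierstrassP l)).neg
  have B := ((hl'.const_add (zeta L z + zeta L k)).sub zkl2).mul
    ((zl.sub hl').const_sub (zeta L (z + k) - zeta L k))
  have B' := B.congr_of_eventuallyEq (f₁ := fun w => -(L.weierstrassP k - L.weierstrassP w)) (by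
      filter_upwards [eventually_notMem L hl, evl, evl2] with w hw hw1 hw2
      exact (zeta_product_identity L hz hk hw hzk hw1 hw2).symm)
  have B'' := B'.unique ((hasDerivAt_weierstrassP L hl).const_sub (L.weierstrassP k)).neg
  have s1 := zeta_add_sq L hz hk hzk hzk'
  have s2 := zeta_add_sq L hz hl hzl hzl'
  simp only [Pi.sub_apply] at A'' B''
  set E := zeta L z + zeta L k + zeta L l - zeta L (z + k + l) with hE
  linear_combination (A'' - B'' + (zeta L (z + k) - zeta L k - (zeta L (z + l) - zeta L l)) * h0
    - E * s1 - E * s2) / 2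

end

section

variable (L : PeriodPair)

/-! ### Lamé functions -/

/-- The values of `x` at which the Lamé functions with shift `a` are regular. -/
def shiftedCompl (a : ℂ) : Set ℂ := {x | x + a ∉ L.lattice}

lemma isOpen_shiftedCompl (a : ℂ) : IsOpen (shiftedCompl L a) :=
  (isOpen_compl_lattice L).preimage (continuous_add_const a)

/-- `∂_x^n Ψ_x(k)`. -/
noncomputable def lameD (a η : ℂ) (n : ℕ) (k x : ℂ) : ℂ :=
  iteratedDeriv n (fun x => lame L a η x k) x

lemma lameD_zero (a η k x : ℂ) : lameD L a η 0 k x = lame L a η x k := by simp [lameD]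

lemma analyticAt_sigma (z : ℂ) : AnalyticAt ℂ (sigma L) z := (differentiable_sigma L).analyticAt z

lemma analyticAt_lame (a η k : ℂ) {x : ℂ} (hx : x + a ∉ L.lattice) :
    AnalyticAt ℂ (fun x => lame L a η x k) x := by
  have h : AnalyticAt ℂ (fun x => sigma L (x + a + k) * (sigma L (x + a))⁻¹ * (sigma L k)⁻¹ *
      Complex.exp (-(zeta L k) * x - η * k)) x := by
    have h1 : AnalyticAt ℂ (fun x => sigma L (x + a + k)) x :=
      (analyticAt_sigma L _).comp (f := fun x => x + a + k) (by fun_prop)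
    have h2 : AnalyticAt ℂ (fun x => sigma L (x + a)) x :=
      (analyticAt_sigma L _).comp (f := fun x => x + a) (by fun_prop)
    have h3 := h2.inv (sigma_ne_zero hx)
    have h4 : AnalyticAt ℂ (fun x => Complex.exp (-(zeta L k) * x - η * k)) x := by fun_prop
    exact ((h1.mul h3).mul analyticAt_const).mul h4
  refine h.congr (.of_forall fun w => ?_)
  simp only [lame, div_eq_mul_inv, mul_inv]
  ring

lemma analyticAt_lameD (a η k : ℂ) (n : ℕ) {x : ℂ} (hx : x + a ∉ L.lattice) :
    AnalyticAt ℂ (lameD L a η n k) x := by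
  have h := (analyticAt_lame L a η k hx).iterated_deriv n
  rwa [← iteratedDeriv_eq_iterate] at h

lemma hasDerivAt_lameD (a η k : ℂ) (n : ℕ) {x : ℂ} (hx : x + a ∉ L.lattice) :
    HasDerivAt (lameD L a η n k) (lameD L a η (n + 1) k x) x := by
  have h := (analyticAt_lameD L a η k n hx).differentiableAt.hasDerivAt
  have e : lameD L a η (n + 1) k = deriv (lameD L a η n k) := iteratedDeriv_succ
  rwa [e]

lemma continuousOn_lameD (a η k : ℂ) (n : ℕ) : ContinuousOn (lameD L a η n k) (shiftedCompl L a) :=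
  fun _ hx => (hasDerivAt_lameD L a η k n hx).continuousAt.continuousWithinAt

lemma hasDerivAt_weierstrassP_shift {a x : ℂ} (hx : x + a ∉ L.lattice) :
    HasDerivAt (fun x => L.weierstrassP (x + a)) (L.derivWeierstrassP (x + a)) x :=
  (hasDerivAt_weierstrassP L hx).comp_add_const x a

/-- `℘''`, in its expression by `℘`. -/
noncomputable def deriv2P (z : ℂ) : ℂ := 6 * L.weierstrassP z ^ 2 - L.g₂ / 2

lemma hasDerivAt_derivWeierstrassP_shift {a x : ℂ} (hx : x + a ∉ L.lattice) :
    HasDerivAt (fun x => L.derivWeierstrassP (x + a)) (deriv2P L (x + a)) x :=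
  (hasDerivAt_derivWeierstrassP L hx).comp_add_const x a

lemma hasDerivAt_deriv2P_shift {a x : ℂ} (hx : x + a ∉ L.lattice) :
    HasDerivAt (fun x => deriv2P L (x + a))
      (12 * L.weierstrassP (x + a) * L.derivWeierstrassP (x + a)) x := by
  have h := (((hasDerivAt_weierstrassP_shift L hx).pow 2).const_mul 6).sub_const (L.g₂ / 2)
  exact h.congr_deriv (by norm_num; ring)

lemma countable_shifted (c : ℂ) : {x : ℂ | x + c ∈ L.lattice}.Countable :=
  (countable_lattice L).preimage (add_left_injective c)

/-- Identities between continuous functions need only be checked off a countable set. -/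
lemma eqOn_of_eqOn_compl_countable {U S : Set ℂ} (hU : IsOpen U) (hS : S.Countable) {f g : ℂ → ℂ}
    (hf : ContinuousOn f U) (hg : ContinuousOn g U) (h : ∀ x ∈ U, x ∉ S → f x = g x) :
    Set.EqOn f g U := by
  refine Set.EqOn.of_subset_closure (s := U ∩ Sᶜ) (fun x hx => h x hx.1 hx.2) hf hg
    Set.inter_subset_left ((hS.dense_compl ℂ).open_subset_closure_inter hU)

lemma hasDerivAt_lame_of_notMem (a η : ℂ) {k x : ℂ} (hx : x + a ∉ L.lattice)
    (hxk : x + a + k ∉ L.lattice) :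
    HasDerivAt (fun x => lame L a η x k)
      (lame L a η x k * (zeta L (x + a + k) - zeta L (x + a) - zeta L k)) x := by
  have h1 : HasDerivAt (fun x => sigma L (x + a + k)) _ x :=
    ((hasDerivAt_sigma L hxk).comp_add_const (x + a) k).comp_add_const x a
  have h2 := (hasDerivAt_sigma L hx).comp_add_const x a
  have h3 : HasDerivAt (fun x => Complex.exp (-(zeta L k) * x - η * k)) _ x :=
    (((hasDerivAt_id x).const_mul (-(zeta L k))).sub_const (η * k)).cexp
  have h4 := ((h1.mul_const (sigma L k)⁻¹).div h2 (sigma_ne_zero hx)).mul h3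
  refine (h4.congr_deriv ?_).congr_of_eventuallyEq (.of_forall fun w => ?_)
  · simp only [lame, Pi.div_apply, div_eq_mul_inv, mul_inv, id]
    have := sigma_ne_zero hx
    field_simp
    ring
  · simp only [lame, Pi.mul_apply, Pi.div_apply]
    simp only [div_eq_mul_inv, mul_inv]
    ring

lemma lameD_one_of_notMem (a η : ℂ) {k x : ℂ} (hx : x + a ∉ L.lattice)
    (hxk : x + a + k ∉ L.lattice) :
    lameD L a η 1 k x = lame L a η x k * (zeta L (x + a + k) - zeta L (x + a) - zeta L k) := by
  rw [lameD, iteratedDeriv_one]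
  exact (hasDerivAt_lame_of_notMem L a η hx hxk).deriv

/-- The first order identity `2 (℘(x+a) - ℘(k)) Ψ' = (℘'(x+a) - ℘'(k)) Ψ`. -/
lemma lameD_one_eq (a η : ℂ) {k : ℂ} (hk : k ∉ L.lattice) {x : ℂ} (hx : x + a ∉ L.lattice) :
    2 * (L.weierstrassP (x + a) - L.weierstrassP k) * lameD L a η 1 k x
      = (L.derivWeierstrassP (x + a) - L.derivWeierstrassP k) * lameD L a η 0 k x := by
  have hcP : ContinuousOn (fun x => L.weierstrassP (x + a)) (shiftedCompl L a) := fun y hy =>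
    (hasDerivAt_weierstrassP_shift L hy).continuousAt.continuousWithinAt
  have hcP' : ContinuousOn (fun x => L.derivWeierstrassP (x + a)) (shiftedCompl L a) := fun y hy =>
    (hasDerivAt_derivWeierstrassP_shift L hy).continuousAt.continuousWithinAt
  have h0 := continuousOn_lameD L a η k 0
  have h1 := continuousOn_lameD L a η k 1
  refine eqOn_of_eqOn_compl_countable (isOpen_shiftedCompl L a)
    ((countable_shifted L (a + k)).union (countable_shifted L (a - k)))
    (f := fun x => 2 * (L.weierstrassP (x + a) - L.weierstrassP k) * lameD L a η 1 k x)
    (g := fun x => (L.derivWeierstrassP (x + a) - L.derivWeierstrassP k) * lameD L a η 0 k x)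
    (by fun_prop) (by fun_prop) (fun y hy hyS => ?_) hx
  simp only [Set.mem_union, Set.mem_ofPred_eq, not_or, ← add_assoc, ← add_sub_assoc] at hyS
  have := zeta_add_mul L hy hk hyS.1 hyS.2
  simp only [lameD_one_of_notMem L a η hy hyS.1, lameD_zero]
  linear_combination lame L a η y k * this

/-- The Lamé equation `Ψ'' = (2 ℘(x+a) + ℘(k)) Ψ`. -/
lemma lameD_two_eq (a η : ℂ) {k : ℂ} (hk : k ∉ L.lattice) {x : ℂ} (hx : x + a ∉ L.lattice) :
    lameD L a η 2 k x
      = (2 * L.weierstrassP (x + a) + L.weierstrassP k) * lameD L a η 0 k x := by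
  have hcP : ContinuousOn (fun x => L.weierstrassP (x + a)) (shiftedCompl L a) := fun y hy =>
    (hasDerivAt_weierstrassP_shift L hy).continuousAt.continuousWithinAt
  have h0 := continuousOn_lameD L a η k 0
  have h1 := continuousOn_lameD L a η k 2
  refine eqOn_of_eqOn_compl_countable (isOpen_shiftedCompl L a)
    ((countable_shifted L (a + k)).union (countable_shifted L (a - k)))
    (g := fun x => (2 * L.weierstrassP (x + a) + L.weierstrassP k) * lameD L a η 0 k x)
    h1 (by fun_prop) (fun y hy hyS => ?_) hx
  simp only [Set.mem_union, Set.mem_ofPred_eq, not_or, ← add_assoc, ← add_sub_assoc] at hyS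
  have hs := zeta_add_sq L hy hk hyS.1 hyS.2
  have hd := (hasDerivAt_lame_of_notMem L a η hy hyS.1).mul
    (((((hasDerivAt_zeta L hyS.1).comp_add_const (y + a) k).comp_add_const y a).sub
      ((hasDerivAt_zeta L hy).comp_add_const y a)).sub_const (zeta L k))
  have hev : ∀ᶠ w in 𝓝 y, w + a + k ∉ L.lattice :=
    (by fun_prop : Continuous fun w : ℂ => w + a + k).continuousAt.eventually
      (eventually_notMem L hyS.1)
  have hd' := hd.congr_of_eventuallyEq (f₁ := lameD L a η 1 k) (by
    filter_upwards [(isOpen_shiftedCompl L a).mem_nhds hy, hev] with w hw hw'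
    exact lameD_one_of_notMem L a η hw hw')
  rw [(hasDerivAt_lameD L a η k 1 hy).unique hd', lameD_zero]
  simp only [Pi.sub_apply]
  linear_combination lame L a η y k * hs

lemma lameD_three_eq (a η : ℂ) {k : ℂ} (hk : k ∉ L.lattice) {x : ℂ} (hx : x + a ∉ L.lattice) :
    lameD L a η 3 k x = (2 * L.weierstrassP (x + a) + L.weierstrassP k) * lameD L a η 1 k x
      + 2 * L.derivWeierstrassP (x + a) * lameD L a η 0 k x := by
  have h := ((((hasDerivAt_weierstrassP_shift L hx).const_mul 2).add_const (L.weierstrassP k)).mul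
    (hasDerivAt_lameD L a η k 0 hx)).congr_of_eventuallyEq (f₁ := lameD L a η 2 k) (by
      filter_upwards [(isOpen_shiftedCompl L a).mem_nhds hx] with w hw
      exact lameD_two_eq L a η hk hw)
  rw [(hasDerivAt_lameD L a η k 2 hx).unique h]
  ring

lemma lameD_four_eq (a η : ℂ) {k : ℂ} (hk : k ∉ L.lattice) {x : ℂ} (hx : x + a ∉ L.lattice) :
    lameD L a η 4 k x = (2 * L.weierstrassP (x + a) + L.weierstrassP k) * lameD L a η 2 k x
      + 4 * L.derivWeierstrassP (x + a) * lameD L a η 1 k x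
      + 2 * deriv2P L (x + a) * lameD L a η 0 k x := by
  have h := (((((hasDerivAt_weierstrassP_shift L hx).const_mul 2).add_const (L.weierstrassP k)).mul
    (hasDerivAt_lameD L a η k 1 hx)).add
      (((hasDerivAt_derivWeierstrassP_shift L hx).const_mul 2).mul
        (hasDerivAt_lameD L a η k 0 hx))).congr_of_eventuallyEq (f₁ := lameD L a η 3 k) (by
      filter_upwards [(isOpen_shiftedCompl L a).mem_nhds hx] with w hw
      exact lameD_three_eq L a η hk hw)
  rw [(hasDerivAt_lameD L a η k 3 hx).unique h]
  ring

/-- The third order operator that governs the time evolution. -/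
lemma lameD_time_eq (a η : ℂ) {k : ℂ} (hk : k ∉ L.lattice) {x : ℂ} (hx : x + a ∉ L.lattice) :
    -2 * L.derivWeierstrassP k * lameD L a η 0 k x
      = -4 * lameD L a η 3 k x + 12 * L.weierstrassP (x + a) * lameD L a η 1 k x
        + 6 * L.derivWeierstrassP (x + a) * lameD L a η 0 k x := by
  rw [lameD_three_eq L a η hk hx]
  linear_combination -2 * lameD_one_eq L a η hk hx

lemma lameD_time_eq' (a η : ℂ) {k : ℂ} (hk : k ∉ L.lattice) {x : ℂ} (hx : x + a ∉ L.lattice) :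
    -2 * L.derivWeierstrassP k * lameD L a η 1 k x
      = -4 * lameD L a η 4 k x + 12 * L.weierstrassP (x + a) * lameD L a η 2 k x
        + 18 * L.derivWeierstrassP (x + a) * lameD L a η 1 k x
        + 6 * deriv2P L (x + a) * lameD L a η 0 k x := by
  have h1 := (hasDerivAt_lameD L a η k 0 hx).const_mul (-2 * L.derivWeierstrassP k)
  have h2 := ((((hasDerivAt_lameD L a η k 3 hx).const_mul (-4)).add
    (((hasDerivAt_weierstrassP_shift L hx).const_mul 12).mul (hasDerivAt_lameD L a η k 1 hx))).add
    (((hasDerivAt_derivWeierstrassP_shift L hx).const_mul 6).mul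
      (hasDerivAt_lameD L a η k 0 hx))).congr_of_eventuallyEq
    (f₁ := fun x => -2 * L.derivWeierstrassP k * lameD L a η 0 k x) (by
      filter_upwards [(isOpen_shiftedCompl L a).mem_nhds hx] with w hw
      exact lameD_time_eq L a η hk hw)
  rw [h1.unique h2]
  ring

/-! ### Generalized Lamé functions -/

lemma analyticAt_lame₂ (a η k l : ℂ) {x : ℂ} (hx : x + a ∉ L.lattice) :
    AnalyticAt ℂ (fun x => lame₂ L a η x k l) x := by
  have h : AnalyticAt ℂ (fun x => sigma L (x + a + (k + l)) * (sigma L (x + a))⁻¹ *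
      (sigma L (k + l))⁻¹ * Complex.exp (-(zeta L k + zeta L l) * x - η * (k + l))) x := by
    have h1 : AnalyticAt ℂ (fun x => sigma L (x + a + (k + l))) x :=
      (analyticAt_sigma L _).comp (f := fun x => x + a + (k + l)) (by fun_prop)
    have h2 : AnalyticAt ℂ (fun x => sigma L (x + a)) x :=
      (analyticAt_sigma L _).comp (f := fun x => x + a) (by fun_prop)
    have h3 := h2.inv (sigma_ne_zero hx)
    have h4 : AnalyticAt ℂ (fun x => Complex.exp (-(zeta L k + zeta L l) * x - η * (k + l))) x := by
      fun_prop
    exact ((h1.mul h3).mul analyticAt_const).mul h4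
  refine h.congr (.of_forall fun w => ?_)
  simp only [lame₂, div_eq_mul_inv, mul_inv]
  ring

/-- The bilinear factor `E = ζ(z) + ζ(k) + ζ(l) - ζ(z+k+l)` relates the product of two Lamé
functions to the generalized Lamé function. -/
lemma lame_mul_lame (a η : ℂ) {k l x : ℂ} (hk : k ∉ L.lattice) (hl : l ∉ L.lattice)
    (hkl : k + l ∉ L.lattice) (hx : x + a ∉ L.lattice) (hxkl : x + a + k + l ∉ L.lattice) :
    lame L a η x k * lame L a η x l
      = (zeta L (x + a) + zeta L k + zeta L l - zeta L (x + a + k + l)) * lame₂ L a η x k l := by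
  rw [zeta_add_add_sub L hx hk hl hxkl]
  have h1 := sigma_ne_zero hx
  have h2 := sigma_ne_zero hk
  have h3 := sigma_ne_zero hl
  have h4 := sigma_ne_zero hkl
  have h5 := sigma_ne_zero hxkl
  have he : Complex.exp (-(zeta L k) * x - η * k) * Complex.exp (-(zeta L l) * x - η * l)
      = Complex.exp (-(zeta L k + zeta L l) * x - η * (k + l)) := by
    rw [← Complex.exp_add]; congr 1; ring
  simp only [lame, lame₂, ← add_assoc]
  rw [← he, show l + x + a = x + a + l by ring]
  generalize Complex.exp (-(zeta L k) * x - η * k) = e₁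
  generalize Complex.exp (-(zeta L l) * x - η * l) = e₂
  field_simp

lemma hasDerivAt_lame₂_of_notMem (a η : ℂ) {k l x : ℂ} (hx : x + a ∉ L.lattice)
    (hxkl : x + a + k + l ∉ L.lattice) :
    HasDerivAt (fun x => lame₂ L a η x k l)
      (lame₂ L a η x k l * -(zeta L (x + a) + zeta L k + zeta L l - zeta L (x + a + k + l))) x := by
  have h1 : HasDerivAt (fun x => sigma L (x + a + k + l)) _ x :=
    (((hasDerivAt_sigma L hxkl).comp_add_const (x + a + k) l).comp_add_const
      (x + a) k).comp_add_const x a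
  have h2 := (hasDerivAt_sigma L hx).comp_add_const x a
  have h3 : HasDerivAt (fun x => Complex.exp (-(zeta L k + zeta L l) * x - η * (k + l))) _ x :=
    (((hasDerivAt_id x).const_mul (-(zeta L k + zeta L l))).sub_const (η * (k + l))).cexp
  have h4 := ((h1.mul_const (sigma L (k + l))⁻¹).div h2 (sigma_ne_zero hx)).mul h3
  refine (h4.congr_deriv ?_).congr_of_eventuallyEq (.of_forall fun w => ?_)
  · simp only [lame₂, Pi.div_apply, div_eq_mul_inv, mul_inv, id, ← add_assoc]
    have := sigma_ne_zero hx
    field_simp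
    ring
  · simp only [lame₂, Pi.mul_apply, Pi.div_apply, ← add_assoc]
    simp only [div_eq_mul_inv, mul_inv]
    ring

lemma continuousOn_lame₂ (a η k l : ℂ) :
    ContinuousOn (fun x => lame₂ L a η x k l) (shiftedCompl L a) :=
  fun _ hy => (analyticAt_lame₂ L a η k l hy).continuousAt.continuousWithinAt

/-- The `x`-derivative of the generalized Lamé function factorizes. -/
lemma hasDerivAt_lame₂ (a η : ℂ) {k l x : ℂ} (hk : k ∉ L.lattice) (hl : l ∉ L.lattice)
    (hkl : k + l ∉ L.lattice) (hx : x + a ∉ L.lattice) :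
    HasDerivAt (fun x => lame₂ L a η x k l)
    (-(lameD L a η 0 k x * lameD L a η 0 l x)) x := by
  have hd : ∀ y ∈ shiftedCompl L a, HasDerivAt (fun x => lame₂ L a η x k l)
      (deriv (fun x => lame₂ L a η x k l) y) y :=
    fun y hy => (analyticAt_lame₂ L a η k l hy).differentiableAt.hasDerivAt
  refine (hd x hx).congr_deriv ?_
  have h0 := continuousOn_lameD L a η k 0
  have h1 := continuousOn_lameD L a η l 0
  refine eqOn_of_eqOn_compl_countable (isOpen_shiftedCompl L a) (countable_shifted L (a + k + l))
    (g := fun x => -(lameD L a η 0 k x * lameD L a η 0 l x))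
    (fun y hy => (analyticAt_lame₂ L a η k l hy).deriv.continuousAt.continuousWithinAt)
    (by fun_prop) (fun y hy hyS => ?_) hx
  simp only [Set.mem_ofPred_eq, ← add_assoc] at hyS
  rw [(hasDerivAt_lame₂_of_notMem L a η hy hyS).deriv]
  simp only [lameD_zero]
  rw [lame_mul_lame L a η hk hl hkl hy hyS]
  ring

/-- The `y`-derivative of the generalized Lamé function as a bilinear expression. -/
lemma lame₂_y_eq (a η : ℂ) {k l x : ℂ} (hk : k ∉ L.lattice) (hl : l ∉ L.lattice)
    (hkl : k + l ∉ L.lattice) (hx : x + a ∉ L.lattice) :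
    (L.weierstrassP k - L.weierstrassP l) * lame₂ L a η x k l
    = -(lameD L a η 1 k x * lameD L a η 0 l x - lameD L a η 0 k x * lameD L a η 1 l x) := by
  have h0 := continuousOn_lameD L a η k 0
  have h1 := continuousOn_lameD L a η l 0
  have h2 := continuousOn_lameD L a η k 1
  have h3 := continuousOn_lameD L a η l 1
  have h4 := continuousOn_lame₂ L a η k l
  refine eqOn_of_eqOn_compl_countable (isOpen_shiftedCompl L a)
    ((countable_shifted L (a + k + l)).union
      ((countable_shifted L (a + k)).union (countable_shifted L (a + l))))
    (f := fun x => (L.weierstrassP k - L.weierstrassP l) * lame₂ L a η x k l)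
    (g := fun x => -(lameD L a η 1 k x * lameD L a η 0 l x
      - lameD L a η 0 k x * lameD L a η 1 l x))
    (by fun_prop) (by fun_prop) (fun y hy hyS => ?_) hx
  simp only [Set.mem_union, Set.mem_ofPred_eq, not_or, ← add_assoc] at hyS
  obtain ⟨s1, s2, s3⟩ := hyS
  simp only [lameD_zero, lameD_one_of_notMem L a η hy s2, lameD_one_of_notMem L a η hy s3]
  have e1 := zeta_product_identity L hy hk hl s2 s3 s1
  have e2 := lame_mul_lame L a η hk hl hkl hy s1
  linear_combination lame₂ L a η y k l * e1 + (zeta L (y + a + k) - zeta L k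
    - (zeta L (y + a + l) - zeta L l)) * e2

/-- The `t`-derivative of the generalized Lamé function as a bilinear expression. -/
lemma lame₂_t_eq (a η : ℂ) {k l x : ℂ} (hk : k ∉ L.lattice) (hl : l ∉ L.lattice)
    (hkl : k + l ∉ L.lattice) (hx : x + a ∉ L.lattice) :
    -2 * (L.derivWeierstrassP k + L.derivWeierstrassP l) * lame₂ L a η x k l
    = 4 * (lameD L a η 2 k x * lameD L a η 0 l x - lameD L a η 1 k x * lameD L a η 1 l x
        + lameD L a η 0 k x * lameD L a η 2 l x)
      - 12 * L.weierstrassP (x + a) * (lameD L a η 0 k x * lameD L a η 0 l x) := by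
  rw [lameD_two_eq L a η hk hx, lameD_two_eq L a η hl hx]
  have hcP : ContinuousOn (fun x => L.weierstrassP (x + a)) (shiftedCompl L a) := fun y hy =>
    (hasDerivAt_weierstrassP_shift L hy).continuousAt.continuousWithinAt
  have h0 := continuousOn_lameD L a η k 0
  have h1 := continuousOn_lameD L a η l 0
  have h2 := continuousOn_lameD L a η k 1
  have h3 := continuousOn_lameD L a η l 1
  have h4 := continuousOn_lame₂ L a η k l
  refine eqOn_of_eqOn_compl_countable (isOpen_shiftedCompl L a)
    ((countable_shifted L (a + k + l)).union
      (((countable_shifted L (a + k)).union (countable_shifted L (a - k))).union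
      ((countable_shifted L (a + l)).union (countable_shifted L (a - l)))))
    (f := fun x => -2 * (L.derivWeierstrassP k + L.derivWeierstrassP l) * lame₂ L a η x k l)
    (g := fun x => 4 * ((2 * L.weierstrassP (x + a) + L.weierstrassP k) * lameD L a η 0 k x
        * lameD L a η 0 l x - lameD L a η 1 k x * lameD L a η 1 l x
        + lameD L a η 0 k x * ((2 * L.weierstrassP (x + a) + L.weierstrassP l)
          * lameD L a η 0 l x))
      - 12 * L.weierstrassP (x + a) * (lameD L a η 0 k x * lameD L a η 0 l x))
    (by fun_prop) (by fun_prop) (fun y hy hyS => ?_) hx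
  simp only [Set.mem_union, Set.mem_ofPred_eq, not_or, ← add_assoc, ← add_sub_assoc] at hyS
  obtain ⟨s1, ⟨s2, s2'⟩, s3, s3'⟩ := hyS
  simp only [lameD_zero, lameD_one_of_notMem L a η hy s2, lameD_one_of_notMem L a η hy s3]
  have e1 := zeta_product_identity' L hy hk hl s2 s3 s1 s2' s3'
  have e2 := lame_mul_lame L a η hk hl hkl hy s1
  linear_combination -4 * lame₂ L a η y k l * e1 - 4 * (L.weierstrassP (y + a)
    + L.weierstrassP k + L.weierstrassP l - (zeta L (y + a + k) - zeta L (y + a) - zeta L k)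
      * (zeta L (y + a + l) - zeta L (y + a) - zeta L l)) * e2

end

/-! ### Determinants and inverses of matrix functions -/

section MatrixCalculus

variable {m n : Type*} [Fintype m] [Fintype n]

/-- Jacobi's formula for the derivative of a determinant. -/
lemma hasDerivAt_det [DecidableEq n] {A : ℂ → Matrix n n ℂ} {A' : Matrix n n ℂ} {x : ℂ}
    (hA : ∀ i j, HasDerivAt (fun s => A s i j) (A' i j) x) :
    HasDerivAt (fun s => (A s).det) ((A x).adjugate * A').trace x := by
  have h1 : HasDerivAt (fun s => ∑ σ : Equiv.Perm n, (Equiv.Perm.sign σ : ℂ) * ∏ i, A s (σ i) i)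
      (∑ σ : Equiv.Perm n, (Equiv.Perm.sign σ : ℂ) *
        ∑ i, (∏ j ∈ Finset.univ.erase i, A x (σ j) j) • A' (σ i) i) x :=
    HasDerivAt.fun_sum fun σ _ => (HasDerivAt.fun_finsetProd fun i _ => hA (σ i) i).const_mul _
  have h2 : ∀ i, ((A x).adjugate * A') i i = ((A x).updateCol i (fun k => A' k i)).det := by
    intro i
    rw [← Matrix.cramer_apply, Matrix.cramer_eq_adjugate_mulVec]
    rfl
  simp only [Matrix.det_apply'] at h2 ⊢
  refine h1.congr_deriv ?_
  rw [Matrix.trace]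
  simp only [Matrix.diag_apply, h2, Finset.mul_sum]
  rw [Finset.sum_comm]
  refine Finset.sum_congr rfl fun i _ => Finset.sum_congr rfl fun σ _ => ?_
  rw [← Finset.mul_prod_erase _ _ (Finset.mem_univ i), Matrix.updateCol_self, smul_eq_mul]
  rw [mul_comm (A' (σ i) i)]
  congr 2
  refine Finset.prod_congr rfl fun j hj => ?_
  rw [Matrix.updateCol_ne (Finset.ne_of_mem_erase hj)]

variable {E : Type*} [NormedAddCommGroup E] [NormedSpace ℂ E]

lemma analyticAt_det [DecidableEq n] {A : E → Matrix n n ℂ} {p : E}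
    (hA : ∀ i j, AnalyticAt ℂ (fun q => A q i j) p) :
    AnalyticAt ℂ (fun q => (A q).det) p := by
  simp only [Matrix.det_apply']
  exact Finset.analyticAt_fun_sum _ fun σ _ => analyticAt_const.mul
    (Finset.analyticAt_fun_prod _ fun i _ => hA _ _)

lemma analyticAt_inv_apply [DecidableEq n] {A : E → Matrix n n ℂ} {p : E}
    (hA : ∀ i j, AnalyticAt ℂ (fun q => A q i j) p) (hdet : (A p).det ≠ 0) (i j : n) :
    AnalyticAt ℂ (fun q => (A q)⁻¹ i j) p := by
  have h : ∀ q, (A q)⁻¹ i j = ((A q).det)⁻¹ * ((A q).updateRow j (Pi.single i 1)).det := by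
    intro q
    rw [Matrix.inv_def, Matrix.smul_apply, Matrix.adjugate_apply, smul_eq_mul,
      Ring.inverse_eq_inv']
  simp only [h]
  refine ((analyticAt_det hA).inv hdet).mul (analyticAt_det fun a b => ?_)
  by_cases hab : a = j
  · subst hab
    simp only [Matrix.updateRow_self]
    exact analyticAt_const
  · simp only [Matrix.updateRow_ne hab]
    exact hA a b

/-- Entrywise product rule for matrices. -/
lemma hasDerivAt_matrix_mul {l n : Type*} {A : ℂ → Matrix l m ℂ} {A' : Matrix l m ℂ}
    {C : ℂ → Matrix m n ℂ} {C' : Matrix m n ℂ} {x : ℂ}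
    (hA : ∀ i j, HasDerivAt (fun s => A s i j) (A' i j) x)
    (hC : ∀ i j, HasDerivAt (fun s => C s i j) (C' i j) x) (i : l) (j : n) :
    HasDerivAt (fun s => (A s * C s) i j) ((A' * C x + A x * C') i j) x := by
  simp only [Matrix.mul_apply, Matrix.add_apply, ← Finset.sum_add_distrib]
  exact HasDerivAt.fun_sum fun k _ => (hA i k).mul (hC k j)

/-- The matrix `Q = B (1 + M B)⁻¹` of the dressing transformation. -/
noncomputable def dressingMatrix [DecidableEq n] (M : Matrix n m ℂ) (B : Matrix m n ℂ) :
    Matrix m n ℂ :=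
  B * (1 + M * B)⁻¹

/-- The derivative of `Q = B (1 + M B)⁻¹` is `-Q M' Q`. -/
lemma hasDerivAt_dressingMatrix [DecidableEq n] {M : ℂ → Matrix n m ℂ} {M' : Matrix n m ℂ} {x : ℂ}
    (B : Matrix m n ℂ) (hM : ∀ i j, HasDerivAt (fun s => M s i j) (M' i j) x)
    (hdet : (1 + M x * B).det ≠ 0)
    (hd : ∀ i j, DifferentiableAt ℂ (fun s => (1 + M s * B : Matrix n n ℂ)⁻¹ i j) x)
    (i : m) (j : n) :
    HasDerivAt (fun s => dressingMatrix (M s) B i j)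
      ((-(dressingMatrix (M x) B * M' * dressingMatrix (M x) B) : Matrix m n ℂ) i j) x := by
  set G : ℂ → Matrix n n ℂ := fun s => (1 + M s * B)⁻¹ with hG
  set G' : Matrix n n ℂ := Matrix.of fun i j => deriv (fun s => G s i j) x with hG'
  have hGd : ∀ i j, HasDerivAt (fun s => G s i j) (G' i j) x := fun i j => (hd i j).hasDerivAt
  have hB : ∀ i j, HasDerivAt (fun _ : ℂ => B i j) ((0 : Matrix m n ℂ) i j) x :=
    fun i j => hasDerivAt_const x _
  have hMB : ∀ i j, HasDerivAt (fun s => (1 + M s * B : Matrix n n ℂ) i j) ((M' * B) i j) x := by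
    intro i j
    have := (hasDerivAt_matrix_mul hM hB i j).const_add ((1 : Matrix n n ℂ) i j)
    simpa using this
  have hcont : ContinuousAt (fun s => (1 + M s * B).det) x := (hasDerivAt_det hMB).continuousAt
  have hone : ∀ i j, HasDerivAt (fun s => (G s * (1 + M s * B) : Matrix n n ℂ) i j)
      ((0 : Matrix n n ℂ) i j) x := by
    intro i j
    refine (hasDerivAt_const x ((1 : Matrix n n ℂ) i j)).congr_of_eventuallyEq ?_
    filter_upwards [hcont.eventually_ne hdet] with s hs
    rw [hG, Matrix.nonsing_inv_mul _ (isUnit_iff_ne_zero.mpr hs)]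
  have heq : G' * (1 + M x * B) + G x * (M' * B) = 0 := by
    ext i j
    exact (hasDerivAt_matrix_mul hGd hMB i j).unique (hone i j)
  have hinv : (1 + M x * B) * G x = 1 := Matrix.mul_nonsing_inv _ (isUnit_iff_ne_zero.mpr hdet)
  have hG'eq : G' = -(G x * (M' * B) * G x) := by
    have h1 : (G' * (1 + M x * B) + G x * (M' * B)) * G x = 0 := by rw [heq, Matrix.zero_mul]
    rw [Matrix.add_mul, Matrix.mul_assoc, hinv, Matrix.mul_one] at h1
    exact eq_neg_of_add_eq_zero_left h1
  refine (hasDerivAt_matrix_mul hB hGd i j).congr_deriv ?_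
  rw [hG'eq]
  simp only [Matrix.zero_mul, zero_add, Matrix.mul_neg, Matrix.mul_assoc, hG, dressingMatrix]

/-- Product rule for the bilinear expression `p ⬝ Q r`. -/
lemma hasDerivAt_dotProduct_mulVec {p : ℂ → m → ℂ} {p' : m → ℂ} {r : ℂ → n → ℂ} {r' : n → ℂ}
    {Q : ℂ → Matrix m n ℂ} {Q' : Matrix m n ℂ} {x : ℂ}
    (hp : ∀ i, HasDerivAt (fun s => p s i) (p' i) x)
    (hr : ∀ j, HasDerivAt (fun s => r s j) (r' j) x)
    (hQ : ∀ i j, HasDerivAt (fun s => Q s i j) (Q' i j) x) :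
    HasDerivAt (fun s => p s ⬝ᵥ (Q s *ᵥ r s))
      (p' ⬝ᵥ (Q x *ᵥ r x) + p x ⬝ᵥ (Q x *ᵥ r') + p x ⬝ᵥ (Q' *ᵥ r x)) x := by
  simp only [dotProduct, Matrix.mulVec]
  rw [← Finset.sum_add_distrib, ← Finset.sum_add_distrib]
  refine HasDerivAt.fun_sum fun i _ => ?_
  have h := (hp i).mul (HasDerivAt.fun_sum (u := Finset.univ) fun j _ => (hQ i j).mul (hr j))
  refine h.congr_deriv ?_
  rw [Finset.sum_add_distrib]
  simp only [Pi.mul_apply]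
  ring

lemma dotProduct_mulVec_vecMulVec (p : m → ℂ) (Q : Matrix m n ℂ) (a : n → ℂ) (b : m → ℂ)
    (r : n → ℂ) :
    p ⬝ᵥ ((Q * Matrix.vecMulVec a b * Q) *ᵥ r) = (p ⬝ᵥ (Q *ᵥ a)) * (b ⬝ᵥ (Q *ᵥ r)) := by
  rw [← Matrix.mulVec_mulVec, ← Matrix.mulVec_mulVec, Matrix.vecMulVec_mulVec]
  simp [Matrix.mulVec_smul, mul_comm]

end MatrixCalculus

/-! ### The dressing of the elliptic background -/

/-- The spectral data of a solution: a shift, plane wave amplitudes, spectral points and a coupling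
matrix. -/
structure DressingData (L : PeriodPair) where
  a : ℂ
  η : ℂ
  ρ₀ : ℂ → ℂ
  γ₀ : ℂ → ℂ
  N : ℕ
  N' : ℕ
  k : Fin N → ℂ
  k' : Fin N' → ℂ
  B : Matrix (Fin N') (Fin N) ℂ
  adm : Admissible L k k'

namespace DressingData

variable {L : PeriodPair} (D : DressingData L)

/-- The dressed elliptic Cauchy matrix of the spectral data. -/
noncomputable def M (x y t : ℂ) : Matrix (Fin D.N) (Fin D.N') ℂ :=
  cauchyMatrix L D.a D.η D.ρ₀ D.γ₀ D.k D.k' x y t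

/-- The tau function of the spectral data. -/
noncomputable def τ (x y t : ℂ) : ℂ := tau L D.a D.η D.ρ₀ D.γ₀ D.k D.k' D.B x y t

lemma τ_eq (x y t : ℂ) : D.τ x y t = (1 + D.M x y t * D.B).det := rfl

/-- The regular set of the spectral data. -/
def Ω : Set (ℂ × ℂ × ℂ) := regularSet L D.a D.η D.ρ₀ D.γ₀ D.k D.k' D.B

/-- `∂_x^n r`. -/
noncomputable def R (n : ℕ) (x y t : ℂ) : Fin D.N → ℂ :=
  fun i => rho L D.ρ₀ (D.k i) y t * lameD L D.a D.η n (D.k i) x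

/-- `∂_x^n s`. -/
noncomputable def S (n : ℕ) (x y t : ℂ) : Fin D.N' → ℂ :=
  fun j => gam L D.γ₀ (D.k' j) y t * lameD L D.a D.η n (D.k' j) x

/-- The matrix `Q = B (1 + M B)⁻¹`. -/
noncomputable def Q (x y t : ℂ) : Matrix (Fin D.N') (Fin D.N) ℂ :=
  dressingMatrix (D.M x y t) D.B

/-- The bilinear form `⟨p, r⟩ = p ⬝ Q r`. -/
noncomputable def br (x y t : ℂ) (p : Fin D.N' → ℂ) (r : Fin D.N → ℂ) : ℂ :=
  p ⬝ᵥ (D.Q x y t *ᵥ r)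

/-- The scalars `S_{m,n} = ⟨∂_x^m s, ∂_x^n r⟩`. -/
noncomputable def Sc (m n : ℕ) (x y t : ℂ) : ℂ := D.br x y t (D.S m x y t) (D.R n x y t)

lemma br_add_left (x y t : ℂ) (p q : Fin D.N' → ℂ) (r : Fin D.N → ℂ) :
    D.br x y t (p + q) r = D.br x y t p r + D.br x y t q r := add_dotProduct _ _ _

lemma br_smul_left (x y t c : ℂ) (p : Fin D.N' → ℂ) (r : Fin D.N → ℂ) :
    D.br x y t (c • p) r = c * D.br x y t p r := smul_dotProduct _ _ _

lemma br_add_right (x y t : ℂ) (p : Fin D.N' → ℂ) (r q : Fin D.N → ℂ) :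
    D.br x y t p (r + q) = D.br x y t p r + D.br x y t p q := by
  simp [br, Matrix.mulVec_add]

lemma br_smul_right (x y t c : ℂ) (p : Fin D.N' → ℂ) (r : Fin D.N → ℂ) :
    D.br x y t p (c • r) = c * D.br x y t p r := by
  simp [br, Matrix.mulVec_smul]

/-! ### Plane wave evolution -/

lemma hasDerivAt_rho_y (ρ₀ : ℂ → ℂ) (k y t : ℂ) :
    HasDerivAt (fun y => rho L ρ₀ k y t) (L.weierstrassP k * rho L ρ₀ k y t) y := by
  have h := ((((hasDerivAt_id y).const_mul (L.weierstrassP k)).sub_const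
    (2 * L.derivWeierstrassP k * t)).cexp).const_mul (ρ₀ k)
  exact h.congr_deriv (by simp only [rho, id]; ring)

lemma hasDerivAt_rho_t (ρ₀ : ℂ → ℂ) (k y t : ℂ) :
    HasDerivAt (fun t => rho L ρ₀ k y t) (-2 * L.derivWeierstrassP k * rho L ρ₀ k y t) t := by
  have h := ((((hasDerivAt_id t).const_mul (2 * L.derivWeierstrassP k)).const_sub
    (L.weierstrassP k * y)).cexp).const_mul (ρ₀ k)
  exact h.congr_deriv (by simp only [rho, id]; ring)

lemma hasDerivAt_gam_y (γ₀ : ℂ → ℂ) (k y t : ℂ) :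
    HasDerivAt (fun y => gam L γ₀ k y t) (-L.weierstrassP k * gam L γ₀ k y t) y := by
  have h := ((((hasDerivAt_id y).const_mul (-L.weierstrassP k)).sub_const
    (2 * L.derivWeierstrassP k * t)).cexp).const_mul (γ₀ k)
  exact h.congr_deriv (by simp only [gam, id]; ring)

lemma hasDerivAt_gam_t (γ₀ : ℂ → ℂ) (k y t : ℂ) :
    HasDerivAt (fun t => gam L γ₀ k y t) (-2 * L.derivWeierstrassP k * gam L γ₀ k y t) t := by
  have h := ((((hasDerivAt_id t).const_mul (2 * L.derivWeierstrassP k)).const_sub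
    (-L.weierstrassP k * y)).cexp).const_mul (γ₀ k)
  exact h.congr_deriv (by simp only [gam, id]; ring)

variable {D} {x y t : ℂ}

lemma hasDerivAt_R_x (hx : x + D.a ∉ L.lattice) (n : ℕ) (i : Fin D.N) :
    HasDerivAt (fun s => D.R n s y t i) (D.R (n + 1) x y t i) x :=
  (hasDerivAt_lameD L D.a D.η (D.k i) n hx).const_mul _

lemma hasDerivAt_S_x (hx : x + D.a ∉ L.lattice) (n : ℕ) (j : Fin D.N') :
    HasDerivAt (fun s => D.S n s y t j) (D.S (n + 1) x y t j) x :=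
  (hasDerivAt_lameD L D.a D.η (D.k' j) n hx).const_mul _

lemma hasDerivAt_R_y (n : ℕ) (i : Fin D.N) :
    HasDerivAt (fun s => D.R n x s t i) (L.weierstrassP (D.k i) * D.R n x y t i) y :=
  ((hasDerivAt_rho_y D.ρ₀ (D.k i) y t).mul_const _).congr_deriv (by rw [R]; ring)

lemma hasDerivAt_S_y (n : ℕ) (j : Fin D.N') :
    HasDerivAt (fun s => D.S n x s t j) (-L.weierstrassP (D.k' j) * D.S n x y t j) y :=
  ((hasDerivAt_gam_y D.γ₀ (D.k' j) y t).mul_const _).congr_deriv (by rw [S]; ring)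

lemma hasDerivAt_R_t (n : ℕ) (i : Fin D.N) :
    HasDerivAt (fun s => D.R n x y s i) (-2 * L.derivWeierstrassP (D.k i) * D.R n x y t i) t :=
  ((hasDerivAt_rho_t D.ρ₀ (D.k i) y t).mul_const _).congr_deriv (by rw [R]; ring)

lemma hasDerivAt_S_t (n : ℕ) (j : Fin D.N') :
    HasDerivAt (fun s => D.S n x y s j) (-2 * L.derivWeierstrassP (D.k' j) * D.S n x y t j) t :=
  ((hasDerivAt_gam_t D.γ₀ (D.k' j) y t).mul_const _).congr_deriv (by rw [S]; ring)

/-- `M_x = -r sᵀ`. -/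
lemma hasDerivAt_M_x (hx : x + D.a ∉ L.lattice) (i : Fin D.N) (j : Fin D.N') :
    HasDerivAt (fun s => D.M s y t i j)
      ((-Matrix.vecMulVec (D.R 0 x y t) (D.S 0 x y t) : Matrix _ _ ℂ) i j) x := by
  have h := (((hasDerivAt_lame₂ L D.a D.η (D.adm.left i) (D.adm.right j) (D.adm.add i j)
    hx).const_mul (rho L D.ρ₀ (D.k i) y t)).mul_const (gam L D.γ₀ (D.k' j) y t))
  exact h.congr_deriv (by simp only [Matrix.neg_apply, Matrix.vecMulVec_apply, R, S]; ring)

/-- `M_y = -(r_x sᵀ - r s_xᵀ)`. -/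
lemma hasDerivAt_M_y (hx : x + D.a ∉ L.lattice) (i : Fin D.N) (j : Fin D.N') :
    HasDerivAt (fun s => D.M x s t i j)
      ((Matrix.vecMulVec (D.R 0 x y t) (D.S 1 x y t)
        - Matrix.vecMulVec (D.R 1 x y t) (D.S 0 x y t) : Matrix _ _ ℂ) i j) y := by
  have h := ((hasDerivAt_rho_y (L := L) D.ρ₀ (D.k i) y t).mul_const
    (lame₂ L D.a D.η x (D.k i) (D.k' j))).mul (hasDerivAt_gam_y (L := L) D.γ₀ (D.k' j) y t)
  refine h.congr_deriv ?_
  have e := lame₂_y_eq L D.a D.η (D.adm.left i) (D.adm.right j) (D.adm.add i j) hx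
  simp only [Matrix.sub_apply, Matrix.vecMulVec_apply, R, S]
  linear_combination (rho L D.ρ₀ (D.k i) y t * gam L D.γ₀ (D.k' j) y t) * e

/-- `M_t = 4 (r_xx sᵀ - r_x s_xᵀ + r s_xxᵀ) - 12 ℘ r sᵀ`. -/
lemma hasDerivAt_M_t (hx : x + D.a ∉ L.lattice) (i : Fin D.N) (j : Fin D.N') :
    HasDerivAt (fun s => D.M x y s i j)
      (((4 : ℂ) • (Matrix.vecMulVec (D.R 2 x y t) (D.S 0 x y t)
        - Matrix.vecMulVec (D.R 1 x y t) (D.S 1 x y t)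
        + Matrix.vecMulVec (D.R 0 x y t) (D.S 2 x y t))
        - (12 * L.weierstrassP (x + D.a)) • Matrix.vecMulVec (D.R 0 x y t) (D.S 0 x y t) :
          Matrix _ _ ℂ) i j) t := by
  have h := ((hasDerivAt_rho_t (L := L) D.ρ₀ (D.k i) y t).mul_const
    (lame₂ L D.a D.η x (D.k i) (D.k' j))).mul (hasDerivAt_gam_t (L := L) D.γ₀ (D.k' j) y t)
  refine h.congr_deriv ?_
  have e := lame₂_t_eq L D.a D.η (D.adm.left i) (D.adm.right j) (D.adm.add i j) hx
  simp only [Matrix.sub_apply, Matrix.add_apply, Matrix.smul_apply, smul_eq_mul,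
    Matrix.vecMulVec_apply, R, S]
  linear_combination (rho L D.ρ₀ (D.k i) y t * gam L D.γ₀ (D.k' j) y t) * e

/-! ### Analyticity -/

lemma analyticAt_snd_fst (p : ℂ × ℂ × ℂ) : AnalyticAt ℂ (fun p : ℂ × ℂ × ℂ => p.2.1) p :=
  ((ContinuousLinearMap.fst ℂ ℂ ℂ).comp (ContinuousLinearMap.snd ℂ ℂ (ℂ × ℂ))).analyticAt p

lemma analyticAt_snd_snd (p : ℂ × ℂ × ℂ) : AnalyticAt ℂ (fun p : ℂ × ℂ × ℂ => p.2.2) p :=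
  ((ContinuousLinearMap.snd ℂ ℂ ℂ).comp (ContinuousLinearMap.snd ℂ ℂ (ℂ × ℂ))).analyticAt p

lemma analyticAt_rho (ρ₀ : ℂ → ℂ) (k : ℂ) (p : ℂ × ℂ × ℂ) :
    AnalyticAt ℂ (fun p : ℂ × ℂ × ℂ => rho L ρ₀ k p.2.1 p.2.2) p :=
  analyticAt_const.mul ((analyticAt_const.mul (analyticAt_snd_fst p)).sub
    (analyticAt_const.mul (analyticAt_snd_snd p))).cexp

lemma analyticAt_gam (γ₀ : ℂ → ℂ) (k : ℂ) (p : ℂ × ℂ × ℂ) :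
    AnalyticAt ℂ (fun p : ℂ × ℂ × ℂ => gam L γ₀ k p.2.1 p.2.2) p :=
  analyticAt_const.mul ((analyticAt_const.mul (analyticAt_snd_fst p)).sub
    (analyticAt_const.mul (analyticAt_snd_snd p))).cexp

lemma analyticAt_R (hx : x + D.a ∉ L.lattice) (n : ℕ) (i : Fin D.N) :
    AnalyticAt ℂ (fun p : ℂ × ℂ × ℂ => D.R n p.1 p.2.1 p.2.2 i) (x, y, t) := by
  have h1 : AnalyticAt ℂ (fun p : ℂ × ℂ × ℂ => lameD L D.a D.η n (D.k i) p.1) (x, y, t) :=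
    (analyticAt_lameD L D.a D.η (D.k i) n hx).comp (f := fun p : ℂ × ℂ × ℂ => p.1) analyticAt_fst
  have h2 : AnalyticAt ℂ (fun p : ℂ × ℂ × ℂ => rho L D.ρ₀ (D.k i) p.2.1 p.2.2) (x, y, t) :=
    analyticAt_rho _ _ _
  exact h2.mul h1

lemma analyticAt_S (hx : x + D.a ∉ L.lattice) (n : ℕ) (j : Fin D.N') :
    AnalyticAt ℂ (fun p : ℂ × ℂ × ℂ => D.S n p.1 p.2.1 p.2.2 j) (x, y, t) := by
  have h1 : AnalyticAt ℂ (fun p : ℂ × ℂ × ℂ => lameD L D.a D.η n (D.k' j) p.1) (x, y, t) :=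
    (analyticAt_lameD L D.a D.η (D.k' j) n hx).comp (f := fun p : ℂ × ℂ × ℂ => p.1) analyticAt_fst
  have h2 : AnalyticAt ℂ (fun p : ℂ × ℂ × ℂ => gam L D.γ₀ (D.k' j) p.2.1 p.2.2) (x, y, t) :=
    analyticAt_gam _ _ _
  exact h2.mul h1

lemma analyticAt_M (hx : x + D.a ∉ L.lattice) (i : Fin D.N) (j : Fin D.N') :
    AnalyticAt ℂ (fun p : ℂ × ℂ × ℂ => D.M p.1 p.2.1 p.2.2 i j) (x, y, t) := by
  have h1 : AnalyticAt ℂ (fun p : ℂ × ℂ × ℂ => lame₂ L D.a D.η p.1 (D.k i) (D.k' j)) (x, y, t) :=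
    (analyticAt_lame₂ L D.a D.η (D.k i) (D.k' j) hx).comp
      (g := fun x => lame₂ L D.a D.η x (D.k i) (D.k' j))
      (f := fun p : ℂ × ℂ × ℂ => p.1) analyticAt_fst
  have h2 : AnalyticAt ℂ (fun p : ℂ × ℂ × ℂ => rho L D.ρ₀ (D.k i) p.2.1 p.2.2) (x, y, t) :=
    analyticAt_rho _ _ _
  have h3 : AnalyticAt ℂ (fun p : ℂ × ℂ × ℂ => gam L D.γ₀ (D.k' j) p.2.1 p.2.2) (x, y, t) :=
    analyticAt_gam _ _ _
  exact (h2.mul h1).mul h3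

lemma analyticAt_one_add_M (hx : x + D.a ∉ L.lattice) (i j : Fin D.N) :
    AnalyticAt ℂ (fun p : ℂ × ℂ × ℂ => (1 + D.M p.1 p.2.1 p.2.2 * D.B : Matrix _ _ ℂ) i j)
      (x, y, t) := by
  simp only [Matrix.add_apply, Matrix.mul_apply]
  exact analyticAt_const.add (Finset.analyticAt_fun_sum _ fun l _ =>
    (analyticAt_M hx i l).mul analyticAt_const)

lemma analyticAt_τ (hx : x + D.a ∉ L.lattice) :
    AnalyticAt ℂ (fun p : ℂ × ℂ × ℂ => D.τ p.1 p.2.1 p.2.2) (x, y, t) :=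
  analyticAt_det (analyticAt_one_add_M hx)

lemma analyticAt_inv (h : (x, y, t) ∈ D.Ω) (i j : Fin D.N) :
    AnalyticAt ℂ (fun p : ℂ × ℂ × ℂ => (1 + D.M p.1 p.2.1 p.2.2 * D.B : Matrix _ _ ℂ)⁻¹ i j)
      (x, y, t) :=
  analyticAt_inv_apply (analyticAt_one_add_M h.1) h.2 i j

lemma analyticAt_Sc (h : (x, y, t) ∈ D.Ω) (m n : ℕ) :
    AnalyticAt ℂ (fun p : ℂ × ℂ × ℂ => D.Sc m n p.1 p.2.1 p.2.2) (x, y, t) := by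
  simp only [Sc, br, dotProduct, Matrix.mulVec, Q, dressingMatrix, Matrix.mul_apply]
  exact Finset.analyticAt_fun_sum _ fun j _ => (analyticAt_S h.1 m j).mul
    (Finset.analyticAt_fun_sum _ fun i _ =>
      (Finset.analyticAt_fun_sum _ fun l _ => analyticAt_const.mul (analyticAt_inv h l i)).mul
        (analyticAt_R h.1 n i))

lemma isOpen_Ω : IsOpen D.Ω := by
  rw [isOpen_iff_mem_nhds]
  rintro ⟨x, y, t⟩ h
  have h1 : ∀ᶠ p : ℂ × ℂ × ℂ in 𝓝 (x, y, t), p.1 + D.a ∉ L.lattice :=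
    (by fun_prop : Continuous fun p : ℂ × ℂ × ℂ => p.1 + D.a).continuousAt.eventually
      (eventually_notMem L h.1)
  filter_upwards [h1, (analyticAt_τ h.1).continuousAt.eventually_ne h.2] with p hp hp'
  exact ⟨hp, hp'⟩

end DressingData

section Slices

variable {f : ℂ × ℂ × ℂ → ℂ} {x y t : ℂ}

lemma differentiableAt_slice_x (h : AnalyticAt ℂ f (x, y, t)) :
    DifferentiableAt ℂ (fun s => f (s, y, t)) x :=
  h.differentiableAt.comp x (f := fun s => (s, y, t)) (by fun_prop)

lemma differentiableAt_slice_y (h : AnalyticAt ℂ f (x, y, t)) :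
    DifferentiableAt ℂ (fun s => f (x, s, t)) y :=
  h.differentiableAt.comp y (f := fun s => (x, s, t)) (by fun_prop)

lemma differentiableAt_slice_t (h : AnalyticAt ℂ f (x, y, t)) :
    DifferentiableAt ℂ (fun s => f (x, y, s)) t :=
  h.differentiableAt.comp t (f := fun s => (x, y, s)) (by fun_prop)

end Slices

namespace DressingData

variable {L : PeriodPair} {D : DressingData L} {x y t : ℂ}

/-! ### Evolution of the scalars `S_{m,n}` -/

lemma br_neg_Q (p : Fin D.N' → ℂ) (W : Matrix (Fin D.N') (Fin D.N) ℂ) (r : Fin D.N → ℂ) :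
    p ⬝ᵥ ((-W) *ᵥ r) = -(p ⬝ᵥ (W *ᵥ r)) := by
  rw [Matrix.neg_mulVec, dotProduct_neg]

/-- The last term comes from `∂_x Q = Q r sᵀ Q`, a consequence of `M_x = -r sᵀ`. -/
lemma hasDerivAt_Sc_x (h : (x, y, t) ∈ D.Ω) (m n : ℕ) :
    HasDerivAt (fun s => D.Sc m n s y t)
      (D.Sc (m + 1) n x y t + D.Sc m (n + 1) x y t + D.Sc m 0 x y t * D.Sc 0 n x y t) x := by
  have hQ := hasDerivAt_dressingMatrix D.B (hasDerivAt_M_x (y := y) (t := t) h.1) h.2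
    (fun i j => differentiableAt_slice_x (analyticAt_inv h i j))
  refine (hasDerivAt_dotProduct_mulVec (hasDerivAt_S_x h.1 m) (hasDerivAt_R_x h.1 n)
    hQ).congr_deriv ?_
  rw [Matrix.mul_neg, Matrix.neg_mul, neg_neg, dotProduct_mulVec_vecMulVec]
  rfl

/-- The spectral factors `℘(k_i)` and `℘(k'_j)` from the plane waves remain inside the bilinear
form; the linear problems for `r` and `s` turn them into `x`-derivatives. -/
lemma hasDerivAt_Sc_y (h : (x, y, t) ∈ D.Ω) (m n : ℕ) :
    HasDerivAt (fun s => D.Sc m n x s t)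
      (D.br x y t (fun j => -L.weierstrassP (D.k' j) * D.S m x y t j) (D.R n x y t)
        + D.br x y t (D.S m x y t) (fun i => L.weierstrassP (D.k i) * D.R n x y t i)
        + D.Sc m 1 x y t * D.Sc 0 n x y t - D.Sc m 0 x y t * D.Sc 1 n x y t) y := by
  have hQ := hasDerivAt_dressingMatrix D.B (hasDerivAt_M_y (y := y) (t := t) h.1) h.2
    (fun i j => differentiableAt_slice_y (analyticAt_inv h i j))
  refine (hasDerivAt_dotProduct_mulVec (hasDerivAt_S_y m) (hasDerivAt_R_y n) hQ).congr_deriv ?_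
  rw [br_neg_Q, Matrix.mul_sub, Matrix.sub_mul, Matrix.sub_mulVec, dotProduct_sub,
    dotProduct_mulVec_vecMulVec, dotProduct_mulVec_vecMulVec]
  simp only [Sc, br, Q]
  ring

lemma hasDerivAt_Sc_t (h : (x, y, t) ∈ D.Ω) (m n : ℕ) :
    HasDerivAt (fun s => D.Sc m n x y s)
      (D.br x y t (fun j => -2 * L.derivWeierstrassP (D.k' j) * D.S m x y t j) (D.R n x y t)
        + D.br x y t (D.S m x y t) (fun i => -2 * L.derivWeierstrassP (D.k i) * D.R n x y t i)
        - (4 * (D.Sc m 2 x y t * D.Sc 0 n x y t - D.Sc m 1 x y t * D.Sc 1 n x y t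
            + D.Sc m 0 x y t * D.Sc 2 n x y t)
          - 12 * L.weierstrassP (x + D.a) * (D.Sc m 0 x y t * D.Sc 0 n x y t))) t := by
  have hQ := hasDerivAt_dressingMatrix D.B (hasDerivAt_M_t (y := y) (t := t) h.1) h.2
    (fun i j => differentiableAt_slice_t (analyticAt_inv h i j))
  refine (hasDerivAt_dotProduct_mulVec (hasDerivAt_S_t m) (hasDerivAt_R_t n) hQ).congr_deriv ?_
  rw [br_neg_Q]
  simp only [Matrix.mul_sub, Matrix.sub_mul, Matrix.sub_mulVec, dotProduct_sub, Matrix.mul_add,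
    Matrix.add_mul, Matrix.add_mulVec, dotProduct_add, Matrix.mul_smul, Matrix.smul_mul,
    Matrix.smul_mulVec, dotProduct_smul, smul_eq_mul, dotProduct_mulVec_vecMulVec]
  simp only [Sc, br, Q]
  ring

/-- `∂_x ln τ = -S_{0,0}`. -/
lemma hasDerivAt_τ_x (h : (x, y, t) ∈ D.Ω) :
    HasDerivAt (fun s => D.τ s y t) (-(D.τ x y t * D.Sc 0 0 x y t)) x := by
  have hM : ∀ i j, HasDerivAt (fun s => (1 + D.M s y t * D.B : Matrix _ _ ℂ) i j)
      ((-Matrix.vecMulVec (D.R 0 x y t) (D.S 0 x y t) * D.B : Matrix _ _ ℂ) i j) x := by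
    intro i j
    have := (hasDerivAt_matrix_mul (hasDerivAt_M_x (y := y) (t := t) h.1)
      (C := fun _ => D.B) (C' := 0) (fun i j => hasDerivAt_const x _) i j).const_add
      ((1 : Matrix _ _ ℂ) i j)
    simpa using this
  refine (hasDerivAt_det hM).congr_deriv ?_
  have hadj : (1 + D.M x y t * D.B).adjugate = D.τ x y t • (1 + D.M x y t * D.B)⁻¹ := by
    have hne : (1 + D.M x y t * D.B).det ≠ 0 := h.2
    rw [Matrix.inv_def, smul_smul, Ring.inverse_eq_inv', τ_eq, mul_inv_cancel₀ hne, one_smul]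
  rw [hadj, Matrix.neg_mul, Matrix.vecMulVec_mul, Matrix.mul_neg, Matrix.smul_mul,
    Matrix.mul_vecMulVec, Matrix.trace_neg, Matrix.trace_smul, Matrix.trace_vecMulVec, smul_eq_mul]
  congr 2
  rw [dotProduct_comm, ← Matrix.dotProduct_mulVec, Matrix.mulVec_mulVec]
  rfl

end DressingData

namespace DressingData

variable {L : PeriodPair} {D : DressingData L} {x y t : ℂ}

/-! ### The linear problems satisfied by `r` and `s` -/

lemma R_y_zero (hx : x + D.a ∉ L.lattice) :
    (fun i => L.weierstrassP (D.k i) * D.R 0 x y t i)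
      = D.R 2 x y t + (-2 * L.weierstrassP (x + D.a)) • D.R 0 x y t := by
  funext i
  simp only [R, Pi.add_apply, Pi.smul_apply, smul_eq_mul, lameD_two_eq L D.a D.η (D.adm.left i) hx]
  ring

lemma R_y_one (hx : x + D.a ∉ L.lattice) :
    (fun i => L.weierstrassP (D.k i) * D.R 1 x y t i)
      = D.R 3 x y t + (-2 * L.weierstrassP (x + D.a)) • D.R 1 x y t
        + (-2 * L.derivWeierstrassP (x + D.a)) • D.R 0 x y t := by
  funext i
  simp only [R, Pi.add_apply, Pi.smul_apply, smul_eq_mul,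
    lameD_three_eq L D.a D.η (D.adm.left i) hx]
  ring

lemma R_y_two (hx : x + D.a ∉ L.lattice) :
    (fun i => L.weierstrassP (D.k i) * D.R 2 x y t i)
      = D.R 4 x y t + (-2 * L.weierstrassP (x + D.a)) • D.R 2 x y t
        + (-4 * L.derivWeierstrassP (x + D.a)) • D.R 1 x y t
        + (-2 * deriv2P L (x + D.a)) • D.R 0 x y t := by
  funext i
  simp only [R, Pi.add_apply, Pi.smul_apply, smul_eq_mul,
    lameD_four_eq L D.a D.η (D.adm.left i) hx]
  ring

lemma S_y_zero (hx : x + D.a ∉ L.lattice) :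
    (fun j => -L.weierstrassP (D.k' j) * D.S 0 x y t j)
      = (-1 : ℂ) • D.S 2 x y t + (2 * L.weierstrassP (x + D.a)) • D.S 0 x y t := by
  funext j
  simp only [S, Pi.add_apply, Pi.smul_apply, smul_eq_mul,
    lameD_two_eq L D.a D.η (D.adm.right j) hx]
  ring

lemma S_y_one (hx : x + D.a ∉ L.lattice) :
    (fun j => -L.weierstrassP (D.k' j) * D.S 1 x y t j)
      = (-1 : ℂ) • D.S 3 x y t + (2 * L.weierstrassP (x + D.a)) • D.S 1 x y t
        + (2 * L.derivWeierstrassP (x + D.a)) • D.S 0 x y t := by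
  funext j
  simp only [S, Pi.add_apply, Pi.smul_apply, smul_eq_mul,
    lameD_three_eq L D.a D.η (D.adm.right j) hx]
  ring

lemma S_y_two (hx : x + D.a ∉ L.lattice) :
    (fun j => -L.weierstrassP (D.k' j) * D.S 2 x y t j)
      = (-1 : ℂ) • D.S 4 x y t + (2 * L.weierstrassP (x + D.a)) • D.S 2 x y t
        + (4 * L.derivWeierstrassP (x + D.a)) • D.S 1 x y t
        + (2 * deriv2P L (x + D.a)) • D.S 0 x y t := by
  funext j
  simp only [S, Pi.add_apply, Pi.smul_apply, smul_eq_mul,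
    lameD_four_eq L D.a D.η (D.adm.right j) hx]
  ring

lemma R_t_zero (hx : x + D.a ∉ L.lattice) :
    (fun i => -2 * L.derivWeierstrassP (D.k i) * D.R 0 x y t i)
      = (-4 : ℂ) • D.R 3 x y t + (12 * L.weierstrassP (x + D.a)) • D.R 1 x y t
        + (6 * L.derivWeierstrassP (x + D.a)) • D.R 0 x y t := by
  funext i
  simp only [R, Pi.add_apply, Pi.smul_apply, smul_eq_mul]
  linear_combination rho L D.ρ₀ (D.k i) y t * lameD_time_eq L D.a D.η (D.adm.left i) hx

lemma R_t_one (hx : x + D.a ∉ L.lattice) :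
    (fun i => -2 * L.derivWeierstrassP (D.k i) * D.R 1 x y t i)
      = (-4 : ℂ) • D.R 4 x y t + (12 * L.weierstrassP (x + D.a)) • D.R 2 x y t
        + (18 * L.derivWeierstrassP (x + D.a)) • D.R 1 x y t
        + (6 * deriv2P L (x + D.a)) • D.R 0 x y t := by
  funext i
  simp only [R, Pi.add_apply, Pi.smul_apply, smul_eq_mul]
  linear_combination rho L D.ρ₀ (D.k i) y t * lameD_time_eq' L D.a D.η (D.adm.left i) hx

lemma S_t_zero (hx : x + D.a ∉ L.lattice) :
    (fun j => -2 * L.derivWeierstrassP (D.k' j) * D.S 0 x y t j)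
      = (-4 : ℂ) • D.S 3 x y t + (12 * L.weierstrassP (x + D.a)) • D.S 1 x y t
        + (6 * L.derivWeierstrassP (x + D.a)) • D.S 0 x y t := by
  funext j
  simp only [S, Pi.add_apply, Pi.smul_apply, smul_eq_mul]
  linear_combination gam L D.γ₀ (D.k' j) y t * lameD_time_eq L D.a D.η (D.adm.right j) hx

lemma S_t_one (hx : x + D.a ∉ L.lattice) :
    (fun j => -2 * L.derivWeierstrassP (D.k' j) * D.S 1 x y t j)
      = (-4 : ℂ) • D.S 4 x y t + (12 * L.weierstrassP (x + D.a)) • D.S 2 x y t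
        + (18 * L.derivWeierstrassP (x + D.a)) • D.S 1 x y t
        + (6 * deriv2P L (x + D.a)) • D.S 0 x y t := by
  funext j
  simp only [S, Pi.add_apply, Pi.smul_apply, smul_eq_mul]
  linear_combination gam L D.γ₀ (D.k' j) y t * lameD_time_eq' L D.a D.η (D.adm.right j) hx

end DressingData

/-! ### Partial derivatives on open sets -/

section Pd

variable {𝕜 : Type*} [NontriviallyNormedField 𝕜] {E : Type*} [NormedAddCommGroup E]
  [NormedSpace 𝕜 E] {Ω : Set (𝕜 × 𝕜 × 𝕜)} {f g : 𝕜 → 𝕜 → 𝕜 → E} {x y t : 𝕜}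

lemma eventually_slice_x (hΩ : IsOpen Ω) (h : (x, y, t) ∈ Ω) : ∀ᶠ s in 𝓝 x, (s, y, t) ∈ Ω :=
  (by fun_prop : Continuous fun s : 𝕜 => (s, y, t)).continuousAt.eventually (hΩ.mem_nhds h)

lemma eventually_slice_y (hΩ : IsOpen Ω) (h : (x, y, t) ∈ Ω) : ∀ᶠ s in 𝓝 y, (x, s, t) ∈ Ω :=
  (by fun_prop : Continuous fun s : 𝕜 => (x, s, t)).continuousAt.eventually (hΩ.mem_nhds h)

lemma eventually_slice_t (hΩ : IsOpen Ω) (h : (x, y, t) ∈ Ω) : ∀ᶠ s in 𝓝 t, (x, y, s) ∈ Ω :=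
  (by fun_prop : Continuous fun s : 𝕜 => (x, y, s)).continuousAt.eventually (hΩ.mem_nhds h)

lemma pdx_congr (hΩ : IsOpen Ω) (hfg : ∀ x y t, (x, y, t) ∈ Ω → f x y t = g x y t)
    (h : (x, y, t) ∈ Ω) : pdx f x y t = pdx g x y t :=
  EventuallyEq.deriv_eq ((eventually_slice_x hΩ h).mono fun _ hs => hfg _ _ _ hs)

lemma pdy_congr (hΩ : IsOpen Ω) (hfg : ∀ x y t, (x, y, t) ∈ Ω → f x y t = g x y t)
    (h : (x, y, t) ∈ Ω) : pdy f x y t = pdy g x y t :=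
  EventuallyEq.deriv_eq ((eventually_slice_y hΩ h).mono fun _ hs => hfg _ _ _ hs)

lemma pdt_congr (hΩ : IsOpen Ω) (hfg : ∀ x y t, (x, y, t) ∈ Ω → f x y t = g x y t)
    (h : (x, y, t) ∈ Ω) : pdt f x y t = pdt g x y t :=
  EventuallyEq.deriv_eq ((eventually_slice_t hΩ h).mono fun _ hs => hfg _ _ _ hs)

end Pd

namespace DressingData

variable {L : PeriodPair} (D : DressingData L) {x y t : ℂ}

/-! ### The KP equation -/

/-- The function `σ(x+a) τ`. -/
noncomputable def F (x y t : ℂ) : ℂ := sigma L (x + D.a) * D.τ x y t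

/-- The solution `u = -2 ℘(x+a) - 2 ∂_x S_{0,0}` in terms of the scalars `S_{m,n}`. -/
noncomputable def u (x y t : ℂ) : ℂ :=
  -2 * L.weierstrassP (x + D.a) - 2 * (D.Sc 1 0 x y t + D.Sc 0 1 x y t + D.Sc 0 0 x y t ^ 2)

/-- The potential `v = -2 ∂_y S_{0,0}` in terms of the scalars `S_{m,n}`. -/
noncomputable def v (x y t : ℂ) : ℂ :=
  -2 * (D.Sc 0 2 x y t - D.Sc 2 0 x y t + D.Sc 0 0 x y t * (D.Sc 0 1 x y t - D.Sc 1 0 x y t))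

/-- `∂_x u`. -/
noncomputable def ux (x y t : ℂ) : ℂ :=
  -2 * L.derivWeierstrassP (x + D.a)
    - 2 * (D.Sc 2 0 x y t + 2 * D.Sc 1 1 x y t + D.Sc 0 2 x y t
      + 3 * D.Sc 0 0 x y t * (D.Sc 1 0 x y t + D.Sc 0 1 x y t) + 2 * D.Sc 0 0 x y t ^ 3)

/-- `∂_x² u`. -/
noncomputable def uxx (x y t : ℂ) : ℂ :=
  -2 * deriv2P L (x + D.a)
    - 2 * (D.Sc 3 0 x y t + 3 * D.Sc 2 1 x y t + 3 * D.Sc 1 2 x y t + D.Sc 0 3 x y t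
      + D.Sc 0 0 x y t * (4 * D.Sc 2 0 x y t + 6 * D.Sc 1 1 x y t + 4 * D.Sc 0 2 x y t)
      + 3 * D.Sc 1 0 x y t ^ 2 + 8 * D.Sc 1 0 x y t * D.Sc 0 1 x y t + 3 * D.Sc 0 1 x y t ^ 2
      + 12 * D.Sc 0 0 x y t ^ 2 * (D.Sc 1 0 x y t + D.Sc 0 1 x y t) + 6 * D.Sc 0 0 x y t ^ 4)

variable {D}

lemma hasDerivAt_u_x (h : (x, y, t) ∈ D.Ω) :
    HasDerivAt (fun s => D.u s y t) (D.ux x y t) x := by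
  have hP := hasDerivAt_weierstrassP_shift L h.1
  have H := hasDerivAt_Sc_x h
  have hd := (hP.const_mul (-2)).sub ((((H 1 0).add (H 0 1)).add ((H 0 0).pow 2)).const_mul 2)
  refine hd.congr_deriv ?_
  simp only [ux]
  norm_num
  ring

lemma hasDerivAt_ux_x (h : (x, y, t) ∈ D.Ω) :
    HasDerivAt (fun s => D.ux s y t) (D.uxx x y t) x := by
  have hP := hasDerivAt_derivWeierstrassP_shift L h.1
  have H := hasDerivAt_Sc_x h
  have hd := (hP.const_mul (-2)).sub ((((((H 2 0).add ((H 1 1).const_mul 2)).add (H 0 2)).add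
    (((H 0 0).const_mul 3).mul ((H 1 0).add (H 0 1)))).add
    (((H 0 0).pow 3).const_mul 2)).const_mul 2)
  refine hd.congr_deriv ?_
  simp only [uxx, Pi.add_apply]
  norm_num
  ring

end DressingData

namespace DressingData

variable {L : PeriodPair} {D : DressingData L} {x y t : ℂ}

lemma hasDerivAt_Sc_zero_zero_y (h : (x, y, t) ∈ D.Ω) :
    HasDerivAt (fun s => D.Sc 0 0 x s t)
      (D.Sc 0 2 x y t - D.Sc 2 0 x y t + D.Sc 0 0 x y t * (D.Sc 0 1 x y t - D.Sc 1 0 x y t)) y := by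
  refine (hasDerivAt_Sc_y h 0 0).congr_deriv ?_
  rw [R_y_zero h.1, S_y_zero h.1]
  simp only [br_add_left, br_add_right, br_smul_left, br_smul_right, Sc]
  ring

lemma hasDerivAt_Sc_one_zero_y (h : (x, y, t) ∈ D.Ω) :
    HasDerivAt (fun s => D.Sc 1 0 x s t)
      (D.Sc 1 2 x y t - D.Sc 3 0 x y t + 2 * L.derivWeierstrassP (x + D.a) * D.Sc 0 0 x y t
        + D.Sc 1 1 x y t * D.Sc 0 0 x y t - D.Sc 1 0 x y t ^ 2) y := by
  refine (hasDerivAt_Sc_y h 1 0).congr_deriv ?_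
  rw [R_y_zero h.1, S_y_one h.1]
  simp only [br_add_left, br_add_right, br_smul_left, br_smul_right, Sc]
  ring

lemma hasDerivAt_Sc_zero_one_y (h : (x, y, t) ∈ D.Ω) :
    HasDerivAt (fun s => D.Sc 0 1 x s t)
      (D.Sc 0 3 x y t - D.Sc 2 1 x y t - 2 * L.derivWeierstrassP (x + D.a) * D.Sc 0 0 x y t
        + D.Sc 0 1 x y t ^ 2 - D.Sc 0 0 x y t * D.Sc 1 1 x y t) y := by
  refine (hasDerivAt_Sc_y h 0 1).congr_deriv ?_
  rw [R_y_one h.1, S_y_zero h.1]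
  simp only [br_add_left, br_add_right, br_smul_left, br_smul_right, Sc]
  ring

lemma hasDerivAt_Sc_two_zero_y (h : (x, y, t) ∈ D.Ω) :
    HasDerivAt (fun s => D.Sc 2 0 x s t)
      (D.Sc 2 2 x y t - D.Sc 4 0 x y t + 4 * L.derivWeierstrassP (x + D.a) * D.Sc 1 0 x y t
        + 2 * deriv2P L (x + D.a) * D.Sc 0 0 x y t
        + D.Sc 2 1 x y t * D.Sc 0 0 x y t - D.Sc 2 0 x y t * D.Sc 1 0 x y t) y := by
  refine (hasDerivAt_Sc_y h 2 0).congr_deriv ?_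
  rw [R_y_zero h.1, S_y_two h.1]
  simp only [br_add_left, br_add_right, br_smul_left, br_smul_right, Sc]
  ring

lemma hasDerivAt_Sc_zero_two_y (h : (x, y, t) ∈ D.Ω) :
    HasDerivAt (fun s => D.Sc 0 2 x s t)
      (D.Sc 0 4 x y t - D.Sc 2 2 x y t - 4 * L.derivWeierstrassP (x + D.a) * D.Sc 0 1 x y t
        - 2 * deriv2P L (x + D.a) * D.Sc 0 0 x y t
        + D.Sc 0 1 x y t * D.Sc 0 2 x y t - D.Sc 0 0 x y t * D.Sc 1 2 x y t) y := by
  refine (hasDerivAt_Sc_y h 0 2).congr_deriv ?_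
  rw [R_y_two h.1, S_y_zero h.1]
  simp only [br_add_left, br_add_right, br_smul_left, br_smul_right, Sc]
  ring

lemma hasDerivAt_Sc_zero_zero_t (h : (x, y, t) ∈ D.Ω) :
    HasDerivAt (fun s => D.Sc 0 0 x y s)
      (-4 * D.Sc 3 0 x y t - 4 * D.Sc 0 3 x y t
        + 12 * L.weierstrassP (x + D.a) * (D.Sc 1 0 x y t + D.Sc 0 1 x y t)
        + 12 * L.derivWeierstrassP (x + D.a) * D.Sc 0 0 x y t
        - 4 * (D.Sc 0 2 x y t * D.Sc 0 0 x y t - D.Sc 0 1 x y t * D.Sc 1 0 x y t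
          + D.Sc 0 0 x y t * D.Sc 2 0 x y t)
        + 12 * L.weierstrassP (x + D.a) * D.Sc 0 0 x y t ^ 2) t := by
  refine (hasDerivAt_Sc_t h 0 0).congr_deriv ?_
  rw [R_t_zero h.1, S_t_zero h.1]
  simp only [br_add_left, br_add_right, br_smul_left, br_smul_right, Sc]
  ring

lemma hasDerivAt_Sc_one_zero_t (h : (x, y, t) ∈ D.Ω) :
    HasDerivAt (fun s => D.Sc 1 0 x y s)
      (-4 * D.Sc 4 0 x y t - 4 * D.Sc 1 3 x y t
        + 12 * L.weierstrassP (x + D.a) * (D.Sc 2 0 x y t + D.Sc 1 1 x y t)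
        + 24 * L.derivWeierstrassP (x + D.a) * D.Sc 1 0 x y t
        + 6 * deriv2P L (x + D.a) * D.Sc 0 0 x y t
        - 4 * (D.Sc 1 2 x y t * D.Sc 0 0 x y t - D.Sc 1 1 x y t * D.Sc 1 0 x y t
          + D.Sc 1 0 x y t * D.Sc 2 0 x y t)
        + 12 * L.weierstrassP (x + D.a) * (D.Sc 1 0 x y t * D.Sc 0 0 x y t)) t := by
  refine (hasDerivAt_Sc_t h 1 0).congr_deriv ?_
  rw [R_t_zero h.1, S_t_one h.1]
  simp only [br_add_left, br_add_right, br_smul_left, br_smul_right, Sc]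
  ring

lemma hasDerivAt_Sc_zero_one_t (h : (x, y, t) ∈ D.Ω) :
    HasDerivAt (fun s => D.Sc 0 1 x y s)
      (-4 * D.Sc 3 1 x y t - 4 * D.Sc 0 4 x y t
        + 12 * L.weierstrassP (x + D.a) * (D.Sc 1 1 x y t + D.Sc 0 2 x y t)
        + 24 * L.derivWeierstrassP (x + D.a) * D.Sc 0 1 x y t
        + 6 * deriv2P L (x + D.a) * D.Sc 0 0 x y t
        - 4 * (D.Sc 0 2 x y t * D.Sc 0 1 x y t - D.Sc 0 1 x y t * D.Sc 1 1 x y t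
          + D.Sc 0 0 x y t * D.Sc 2 1 x y t)
        + 12 * L.weierstrassP (x + D.a) * (D.Sc 0 0 x y t * D.Sc 0 1 x y t)) t := by
  refine (hasDerivAt_Sc_t h 0 1).congr_deriv ?_
  rw [R_t_one h.1, S_t_zero h.1]
  simp only [br_add_left, br_add_right, br_smul_left, br_smul_right, Sc]
  ring

/-- The compatibility `v_x = u_y`. -/
lemma pdx_v_eq_pdy_u (h : (x, y, t) ∈ D.Ω) : pdx D.v x y t = pdy D.u x y t := by
  have H := hasDerivAt_Sc_x h
  have hv : HasDerivAt (fun s => D.v s y t) _ x :=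
    (((H 0 2).sub (H 2 0)).add ((H 0 0).mul ((H 0 1).sub (H 1 0)))).const_mul (-2)
  have hu : HasDerivAt (fun s => D.u x s t) _ y :=
    ((((hasDerivAt_Sc_one_zero_y h).add (hasDerivAt_Sc_zero_one_y h)).add
      ((hasDerivAt_Sc_zero_zero_y h).pow 2)).const_mul 2).const_sub
        (-2 * L.weierstrassP (x + D.a))
  rw [pdx, pdy, hv.deriv, hu.deriv]
  simp only [Pi.sub_apply]
  norm_num
  ring

/-- The KP equation for the pair `u`, `v`. -/
lemma kp_equation (h : (x, y, t) ∈ D.Ω) :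
    pdt D.u x y t + pdx D.uxx x y t + 6 * D.u x y t * D.ux x y t + 3 * pdy D.v x y t = 0 := by
  have H := hasDerivAt_Sc_x h
  have hP := hasDerivAt_deriv2P_shift L h.1
  have hxxx : HasDerivAt (fun s => D.uxx s y t) _ x :=
    (hP.const_mul (-2)).sub (((((((((((H 3 0).add ((H 2 1).const_mul 3)).add
      ((H 1 2).const_mul 3)).add (H 0 3)).add ((H 0 0).mul ((((H 2 0).const_mul 4).add
      ((H 1 1).const_mul 6)).add ((H 0 2).const_mul 4)))).add
      (((H 1 0).pow 2).const_mul 3)).add (((H 1 0).const_mul 8).mul (H 0 1))).add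
      (((H 0 1).pow 2).const_mul 3)).add ((((H 0 0).pow 2).const_mul 12).mul
      ((H 1 0).add (H 0 1)))).add (((H 0 0).pow 4).const_mul 6)).const_mul 2)
  have hut : HasDerivAt (fun s => D.u x y s) _ t :=
    ((((hasDerivAt_Sc_one_zero_t h).add (hasDerivAt_Sc_zero_one_t h)).add
      ((hasDerivAt_Sc_zero_zero_t h).pow 2)).const_mul 2).const_sub
        (-2 * L.weierstrassP (x + D.a))
  have hvy : HasDerivAt (fun s => D.v x s t) _ y :=
    (((hasDerivAt_Sc_zero_two_y h).sub (hasDerivAt_Sc_two_zero_y h)).add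
      ((hasDerivAt_Sc_zero_zero_y h).mul ((hasDerivAt_Sc_zero_one_y h).sub
        (hasDerivAt_Sc_one_zero_y h)))).const_mul (-2)
  rw [pdt, pdx, pdy, hxxx.deriv, hut.deriv, hvy.deriv, u, ux]
  simp only [Pi.sub_apply, Pi.add_apply, Pi.pow_apply]
  norm_num
  ring

/-! ### The logarithmic derivatives of `σ τ` -/

lemma dxLog_F (h : (x, y, t) ∈ D.Ω) :
    dxLog D.F x y t = zeta L (x + D.a) - D.Sc 0 0 x y t := by
  have hσ := (hasDerivAt_sigma L h.1).comp_add_const x D.a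
  have hF : HasDerivAt (fun s => D.F s y t) _ x := hσ.mul (hasDerivAt_τ_x h)
  have h1 := sigma_ne_zero h.1
  have h2 : D.τ x y t ≠ 0 := h.2
  rw [dxLog, logDeriv_apply, hF.deriv, F]
  field_simp
  ring

lemma twoDxxLog_F (h : (x, y, t) ∈ D.Ω) : twoDxxLog D.F x y t = D.u x y t := by
  have hd : HasDerivAt (fun s => zeta L (s + D.a) - D.Sc 0 0 s y t) _ x :=
    ((hasDerivAt_zeta L h.1).comp_add_const x D.a).sub (hasDerivAt_Sc_x h 0 0)
  rw [twoDxxLog, pdx_congr (g := fun x y t => zeta L (x + D.a) - D.Sc 0 0 x y t) isOpen_Ω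
    (fun _ _ _ h => dxLog_F h) h, pdx, hd.deriv, u]
  ring

lemma twoDyxLog_F (h : (x, y, t) ∈ D.Ω) : twoDyxLog D.F x y t = D.v x y t := by
  have hd : HasDerivAt (fun s => zeta L (x + D.a) - D.Sc 0 0 x s t) _ y :=
    (hasDerivAt_Sc_zero_zero_y h).const_sub _
  rw [twoDyxLog, pdy_congr (g := fun x y t => zeta L (x + D.a) - D.Sc 0 0 x y t) isOpen_Ω
    (fun _ _ _ h => dxLog_F h) h, pdy, hd.deriv, v]
  ring

lemma analyticAt_u (h : (x, y, t) ∈ D.Ω) :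
    AnalyticAt ℂ (fun p : ℂ × ℂ × ℂ => D.u p.1 p.2.1 p.2.2) (x, y, t) := by
  have hP : AnalyticAt ℂ (fun p : ℂ × ℂ × ℂ => L.weierstrassP (p.1 + D.a)) (x, y, t) :=
    (L.analyticOnNhd_weierstrassP _ h.1).comp (f := fun p : ℂ × ℂ × ℂ => p.1 + D.a)
      (analyticAt_fst.add analyticAt_const)
  have H := analyticAt_Sc h
  exact (analyticAt_const.mul hP).sub (analyticAt_const.mul (((H 1 0).add (H 0 1)).add
    ((H 0 0).pow 2)))

lemma analyticAt_v (h : (x, y, t) ∈ D.Ω) :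
    AnalyticAt ℂ (fun p : ℂ × ℂ × ℂ => D.v p.1 p.2.1 p.2.2) (x, y, t) := by
  have H := analyticAt_Sc h
  exact analyticAt_const.mul (((H 0 2).sub (H 2 0)).add ((H 0 0).mul ((H 0 1).sub (H 1 0))))

/-- The function `2 ∂_x² ln (σ τ)` solves the KP equation. -/
theorem isKPSolutionOn : IsKPSolutionOn D.Ω (twoDxxLog D.F) (twoDyxLog D.F) where
  analytic_u := by
    rintro ⟨x, y, t⟩ h
    refine (analyticAt_u h).congr ?_
    filter_upwards [isOpen_Ω.mem_nhds h] with p hp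
    exact (twoDxxLog_F hp).symm
  analytic_v := by
    rintro ⟨x, y, t⟩ h
    refine (analyticAt_v h).congr ?_
    filter_upwards [isOpen_Ω.mem_nhds h] with p hp
    exact (twoDyxLog_F hp).symm
  potential := by
    intro x y t h
    rw [pdx_congr isOpen_Ω (fun _ _ _ h => twoDyxLog_F h) h,
      pdy_congr isOpen_Ω (fun _ _ _ h => twoDxxLog_F h) h, pdx_v_eq_pdy_u h]
  equation := by
    intro x y t h
    have e1 : ∀ x y t, (x, y, t) ∈ D.Ω → pdx (twoDxxLog D.F) x y t = D.ux x y t := fun x y t h => by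
      rw [pdx_congr isOpen_Ω (fun _ _ _ h => twoDxxLog_F h) h]
      exact (hasDerivAt_u_x h).deriv
    have e2 : ∀ x y t, (x, y, t) ∈ D.Ω → pdx (pdx (twoDxxLog D.F)) x y t = D.uxx x y t :=
      fun x y t h => by
        rw [pdx_congr isOpen_Ω e1 h]
        exact (hasDerivAt_ux_x h).deriv
    rw [pdt_congr isOpen_Ω (fun _ _ _ h => twoDxxLog_F h) h, pdx_congr isOpen_Ω e2 h,
      pdy_congr isOpen_Ω (fun _ _ _ h => twoDyxLog_F h) h, e1 x y t h, twoDxxLog_F h]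
    exact kp_equation h

end DressingData

/-! ### The integral equation -/

lemma discreteIntegral_eq_sum {N N' : ℕ} (k : Fin N → ℂ) (k' : Fin N' → ℂ)
    (B : Matrix (Fin N') (Fin N) ℂ) (f : ℂ → ℂ → ℂ) :
    discreteIntegral k k' B f = ∑ i, ∑ j, B j i * f (k i) (k' j) := by
  simp [discreteIntegral]

namespace DressingData

variable {L : PeriodPair} {D : DressingData L} {x y t : ℂ}

lemma R_zero : D.R 0 x y t = rVec L D.a D.η D.ρ₀ D.k x y t := by
  funext i
  simp only [R, rVec, lameD_zero]

lemma S_zero : D.S 0 x y t = sVec L D.a D.η D.γ₀ D.k' x y t := by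
  funext j
  simp only [S, sVec, lameD_zero]

lemma Sc_zero_zero :
    D.Sc 0 0 x y t = sVec L D.a D.η D.γ₀ D.k' x y t ⬝ᵥ
      (D.B *ᵥ ((1 + D.M x y t * D.B)⁻¹ *ᵥ rVec L D.a D.η D.ρ₀ D.k x y t)) := by
  rw [Sc, br, R_zero, S_zero, Q, dressingMatrix, Matrix.mulVec_mulVec]

/-- The integral term of the integral equation at `κ = k_i` is the action of `M B`. -/
lemma rho_mul_discreteIntegral (ψ : ℂ → ℂ) (i : Fin D.N) :
    rho L D.ρ₀ (D.k i) y t * discreteIntegral D.k D.k' D.B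
        (fun l l' => ψ l * gam L D.γ₀ l' y t * lame₂ L D.a D.η x (D.k i) l')
      = ((D.M x y t * D.B) *ᵥ fun i => ψ (D.k i)) i := by
  rw [discreteIntegral_eq_sum]
  simp only [Matrix.mulVec, dotProduct, Matrix.mul_apply, M, cauchyMatrix, Matrix.of_apply,
    Finset.mul_sum, Finset.sum_mul]
  refine Finset.sum_congr rfl fun l _ => Finset.sum_congr rfl fun j _ => ?_
  ring

lemma discreteIntegral_lame (ψ : ℂ → ℂ) :
    discreteIntegral D.k D.k' D.B (fun l l' => ψ l * gam L D.γ₀ l' y t * lame L D.a D.η x l')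
      = sVec L D.a D.η D.γ₀ D.k' x y t ⬝ᵥ (D.B *ᵥ fun i => ψ (D.k i)) := by
  rw [discreteIntegral_eq_sum, Finset.sum_comm]
  simp only [Matrix.mulVec, dotProduct, sVec, Finset.mul_sum]
  refine Finset.sum_congr rfl fun l _ => Finset.sum_congr rfl fun j _ => ?_
  ring

/-- Evaluation at `κ = k_i` reduces the integral equation to a linear system. -/
lemma eq_inv_mulVec_of_solvesIntegralEq {ψ : ℂ → ℂ → ℂ → ℂ → ℂ}
    (hψ : SolvesIntegralEq L D.a D.η D.ρ₀ D.γ₀ D.k D.k' D.B D.Ω ψ) (h : (x, y, t) ∈ D.Ω) :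
    (fun i => ψ x y t (D.k i))
      = (1 + D.M x y t * D.B)⁻¹ *ᵥ rVec L D.a D.η D.ρ₀ D.k x y t := by
  have hdet : IsUnit (1 + D.M x y t * D.B).det := isUnit_iff_ne_zero.mpr h.2
  have hsys : (1 + D.M x y t * D.B) *ᵥ (fun i => ψ x y t (D.k i))
      = rVec L D.a D.η D.ρ₀ D.k x y t := by
    funext i
    have e := hψ x y t h (D.k i) (D.adm.left i) (D.adm.add i)
    rw [rho_mul_discreteIntegral] at e
    rw [Matrix.add_mulVec, Matrix.one_mulVec, Pi.add_apply, e, rVec, mul_comm]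
  rw [← hsys, Matrix.mulVec_mulVec, Matrix.nonsing_inv_mul _ hdet, Matrix.one_mulVec]

/-- The solution of the linear system extends to a solution at all spectral values. -/
lemma exists_solvesIntegralEq (D : DressingData L) :
    ∃ ψ, SolvesIntegralEq L D.a D.η D.ρ₀ D.γ₀ D.k D.k' D.B D.Ω ψ := by
  -- the equation itself defines `ψ` at every `κ` from the solution `φ` of the linear system
  set φ : ℂ → ℂ → ℂ → Fin D.N → ℂ := fun x y t =>
    (1 + D.M x y t * D.B)⁻¹ *ᵥ rVec L D.a D.η D.ρ₀ D.k x y t with hφ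
  set ψ : ℂ → ℂ → ℂ → ℂ → ℂ := fun x y t κ => lame L D.a D.η x κ * rho L D.ρ₀ κ y t
    - rho L D.ρ₀ κ y t * ∑ i, ∑ j, D.B j i *
      (φ x y t i * gam L D.γ₀ (D.k' j) y t * lame₂ L D.a D.η x κ (D.k' j)) with hψ
  refine ⟨ψ, fun x y t h κ _ _ => ?_⟩
  have hdet : IsUnit (1 + D.M x y t * D.B).det := isUnit_iff_ne_zero.mpr h.2
  have key : ∀ i, ψ x y t (D.k i) = φ x y t i := by
    intro i
    have hsys : (1 + D.M x y t * D.B) *ᵥ φ x y t = rVec L D.a D.η D.ρ₀ D.k x y t := by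
      rw [hφ, Matrix.mulVec_mulVec, Matrix.mul_nonsing_inv _ hdet, Matrix.one_mulVec]
    have e := congrFun hsys i
    rw [Matrix.add_mulVec, Matrix.one_mulVec, Pi.add_apply] at e
    have e2 : rho L D.ρ₀ (D.k i) y t * ∑ i', ∑ j, D.B j i' *
        (φ x y t i' * gam L D.γ₀ (D.k' j) y t * lame₂ L D.a D.η x (D.k i) (D.k' j))
          = ((D.M x y t * D.B) *ᵥ φ x y t) i := by
      simp only [Matrix.mulVec, dotProduct, Matrix.mul_apply, M, cauchyMatrix, Matrix.of_apply,
        Finset.mul_sum, Finset.sum_mul]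
      refine Finset.sum_congr rfl fun l _ => Finset.sum_congr rfl fun j _ => ?_
      ring
    simp only [hψ]
    rw [e2, mul_comm (lame L D.a D.η x (D.k i))]
    rw [rVec] at e
    linear_combination -e
  rw [discreteIntegral_eq_sum]
  simp only [key]
  simp only [hψ]
  ring

lemma background_sub_pdx_Sc (h : (x, y, t) ∈ D.Ω) :
    -2 * L.weierstrassP (x + D.a) - 2 * pdx (D.Sc 0 0) x y t = twoDxxLog D.F x y t := by
  rw [twoDxxLog_F h, pdx, (hasDerivAt_Sc_x h 0 0).deriv, u]
  ring

lemma integral_form (ψ : ℂ → ℂ → ℂ → ℂ → ℂ)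
    (hψ : SolvesIntegralEq L D.a D.η D.ρ₀ D.γ₀ D.k D.k' D.B D.Ω ψ) (h : (x, y, t) ∈ D.Ω) :
    -2 * L.weierstrassP (x + D.a) - 2 * pdx (fun x y t => discreteIntegral D.k D.k' D.B
      (fun l l' => ψ x y t l * gam L D.γ₀ l' y t * lame L D.a D.η x l')) x y t
      = twoDxxLog D.F x y t := by
  rw [← background_sub_pdx_Sc h]
  congr 2
  refine pdx_congr isOpen_Ω (fun x y t h => ?_) h
  rw [discreteIntegral_lame (ψ x y t), Sc_zero_zero, eq_inv_mulVec_of_solvesIntegralEq hψ h]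

lemma matrix_form (h : (x, y, t) ∈ D.Ω) :
    -2 * L.weierstrassP (x + D.a) - 2 * pdx (fun x y t => sVec L D.a D.η D.γ₀ D.k' x y t ⬝ᵥ
      (D.B *ᵥ ((1 + D.M x y t * D.B)⁻¹ *ᵥ rVec L D.a D.η D.ρ₀ D.k x y t))) x y t
      = twoDxxLog D.F x y t := by
  rw [← background_sub_pdx_Sc h]
  congr 2
  exact pdx_congr isOpen_Ω (fun x y t _ => Sc_zero_zero.symm) h

end DressingData

section

/-! ### Principal minors and Schur complements -/

/-- `det (1 + A)` is the sum of all principal minors of `A`. -/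
lemma det_one_add_eq_sum_minors {n : Type*} [Fintype n] [DecidableEq n] (A : Matrix n n ℂ) :
    (1 + A).det = ∑ J : Finset n, (A.submatrix (Subtype.val : J → n) Subtype.val).det := by
  set P : Polynomial ℂ := (1 + (Polynomial.X : Polynomial ℂ) • A.map Polynomial.C).det with hP
  have h1 : P.eval 1 = (1 + A).det := by
    rw [hP, ← Polynomial.coe_evalRingHom, RingHom.map_det]
    congr 1
    ext i j
    simp [Matrix.one_apply, apply_ite]
  have hc := fun k => Matrix.coeff_det_one_add_X_smul_eq_sum_minors A k
  have hdeg : P.natDegree < Fintype.card n + 1 := by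
    rw [Nat.lt_succ_iff, Polynomial.natDegree_le_iff_coeff_eq_zero]
    intro m hm
    rw [hP, hc, Finset.powersetCard_eq_empty.mpr (by simpa using hm), Finset.sum_empty]
  rw [← h1, Polynomial.eval_eq_sum_range' hdeg]
  simp only [one_pow, mul_one, hP, hc]
  rw [← Finset.powerset_univ, Finset.sum_powerset, Finset.card_univ]

/-- Schur complement with respect to a single nonzero diagonal entry. -/
lemma det_option {n : Type*} [Fintype n] [DecidableEq n] (A : Matrix (Option n) (Option n) ℂ)
    (h : A none none ≠ 0) :
    A.det = A none none * (Matrix.of fun i j : n =>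
      A (some i) (some j) - A (some i) none * A none (some j) / A none none).det := by
  let e := Equiv.optionEquivSumPUnit.{0} n
  set D : Matrix PUnit PUnit ℂ := Matrix.of fun _ _ => A none none with hD
  have hdet : D.det = A none none := by rw [Matrix.det_unique]; rfl
  have : Invertible D := D.invertibleOfIsUnitDet (by rw [hdet]; exact isUnit_iff_ne_zero.mpr h)
  have hinv : ⅟D = Matrix.of fun _ _ => (A none none)⁻¹ := by
    refine invOf_eq_right_inv ?_
    ext i j
    simp [Matrix.mul_apply, hD, h]
  have hA : A.submatrix e.symm e.symm = Matrix.fromBlocks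
      (Matrix.of fun i j : n => A (some i) (some j)) (Matrix.of fun i _ => A (some i) none)
      (Matrix.of fun _ j => A none (some j)) D := by
    ext i j
    rcases i with i | i <;> rcases j with j | j <;> rfl
  rw [← Matrix.det_submatrix_equiv_self e.symm A, hA, Matrix.det_fromBlocks₂₂, hdet, hinv]
  congr 2
  ext i j
  simp [Matrix.mul_apply]
  ring

lemma det_subtype_insert {ι : Type*} [DecidableEq ι] {a : ι} {s : Finset ι} (ha : a ∉ s)
    (A : ι → ι → ℂ) (h : A a a ≠ 0) :
    (Matrix.of fun i j : ↥(insert a s) => A i j).det = A a a * (Matrix.of fun i j : s =>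
      A i j - A i a * A a j / A a a).det := by
  rw [← Matrix.det_submatrix_equiv_self (Finset.subtypeInsertEquivOption ha).symm, det_option]
  · rfl
  · exact h

/-! ### The elliptic Cauchy determinant -/

variable (L : PeriodPair)

/-- The kernel `σ(z + K) / (σ(z) σ(K))` of the elliptic Cauchy matrix. -/
noncomputable def sigmaKernel (z K : ℂ) : ℂ := sigma L (z + K) / (sigma L z * sigma L K)

/-- The Schur complement of an elliptic Cauchy matrix is an elliptic Cauchy matrix, up to row and
column factors. This is the three-term relation for `σ`. -/
lemma sigmaKernel_schur {z k l p q : ℂ} (hz : z ∉ L.lattice) (hz' : z + (k + l) ∉ L.lattice)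
    (hkl : k + l ∉ L.lattice) (hpq : p + q ∉ L.lattice) (hpl : p + l ∉ L.lattice)
    (hkq : k + q ∉ L.lattice) :
    sigmaKernel L z (p + q)
        - sigmaKernel L z (p + l) * sigmaKernel L z (k + q) / sigmaKernel L z (k + l)
      = sigma L (p - k) / sigma L (p + l) * (sigma L (q - l) / sigma L (k + q) *
        sigmaKernel L (z + (k + l)) (p + q)) := by
  have h := sigma_three_term L (z + (p + q + (k + l)) / 2) ((p + q - (k + l)) / 2)
    ((p + q + (k + l)) / 2) ((p - k - q + l) / 2)
  rw [show z + (p + q + (k + l)) / 2 + (p + q - (k + l)) / 2 = z + (p + q) by ring,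
    show z + (p + q + (k + l)) / 2 - (p + q - (k + l)) / 2 = z + (k + l) by ring,
    show (p + q + (k + l)) / 2 + (p - k - q + l) / 2 = p + l by ring,
    show (p + q + (k + l)) / 2 - (p - k - q + l) / 2 = k + q by ring,
    show (p + q - (k + l)) / 2 + (p + q + (k + l)) / 2 = p + q by ring,
    show (p + q - (k + l)) / 2 - (p + q + (k + l)) / 2 = -(k + l) by ring,
    show z + (p + q + (k + l)) / 2 + (p - k - q + l) / 2 = z + (p + l) by ring,
    show z + (p + q + (k + l)) / 2 - (p - k - q + l) / 2 = z + (k + q) by ring,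
    show (p + q + (k + l)) / 2 + (z + (p + q + (k + l)) / 2) = z + (k + l) + (p + q) by ring,
    show (p + q + (k + l)) / 2 - (z + (p + q + (k + l)) / 2) = -z by ring,
    show (p + q - (k + l)) / 2 + (p - k - q + l) / 2 = p - k by ring,
    show (p + q - (k + l)) / 2 - (p - k - q + l) / 2 = q - l by ring,
    sigma_neg, sigma_neg] at h
  have s1 := sigma_ne_zero hz
  have s2 := sigma_ne_zero hz'
  have s3 := sigma_ne_zero hkl
  have s4 := sigma_ne_zero hpq
  have s5 := sigma_ne_zero hpl
  have s6 := sigma_ne_zero hkq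
  simp only [sigmaKernel]
  field_simp
  linear_combination h

variable {N : ℕ}

lemma prod_phaseA_insert (k k' : Fin N → ℂ) {a : Fin N} {s : Finset (Fin N)} (ha : ∀ x ∈ s, a < x) :
    ∏ i ∈ insert a s, ∏ j ∈ insert a s with i < j, phaseA L k k' i j
      = (∏ j ∈ s, phaseA L k k' a j) * ∏ i ∈ s, ∏ j ∈ s with i < j, phaseA L k k' i j := by
  rw [Finset.prod_insert fun h => lt_irrefl a (ha a h)]
  congr 1
  · refine Finset.prod_congr ?_ fun _ _ => rfl
    ext j
    simp only [Finset.mem_filter, Finset.mem_insert]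
    constructor
    · rintro ⟨rfl | h, h'⟩
      · exact absurd h' (lt_irrefl _)
      · exact h
    · exact fun h => ⟨Or.inr h, ha j h⟩
  · refine Finset.prod_congr rfl fun i hi => Finset.prod_congr ?_ fun _ _ => rfl
    rw [Finset.filter_insert, if_neg (ha i hi).le.not_gt]

/-- Frobenius' evaluation of the elliptic Cauchy determinant. The smallest index is eliminated by
a Schur complement, which shifts `z` by `k_a + k'_a`; this requires that `z + k_a + k'_a` is not a
period, and the remaining `z` are reached by continuity. -/
lemma det_sigmaKernel (k k' : Fin N → ℂ) (hadd : ∀ i j, k i + k' j ∉ L.lattice)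
    (J : Finset (Fin N)) :
    ∀ z ∉ L.lattice, (Matrix.of fun i j : J => sigmaKernel L z (k i + k' j)).det
      = (∏ i ∈ J, ∏ j ∈ J with i < j, phaseA L k k' i j) *
        (sigma L (z + ∑ i ∈ J, (k i + k' i)) /
          (sigma L z * ∏ i ∈ J, sigma L (k i + k' i))) := by
  induction J using Finset.induction_on_min with
  | empty =>
    intro z hz
    simp [sigma_ne_zero hz]
  | insert a s has ih =>
    have ha : a ∉ s := fun h => lt_irrefl a (has a h)
    have hcont : Continuous (sigma L) := (differentiable_sigma L).continuous
    refine eqOn_of_eqOn_compl_countable (isOpen_compl_lattice L)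
      (countable_shifted L (k a + k' a)) ?_ ?_ ?_
    · refine ContinuousOn.congr (f := fun z => _) ?_ fun z _ => rfl
      rw [continuousOn_iff_continuous_domRestrict]
      refine Continuous.matrix_det (continuous_matrix fun i j => ?_)
      simp only [sigmaKernel, Matrix.of_apply]
      refine Continuous.div (by fun_prop) (by fun_prop) fun z => ?_
      exact mul_ne_zero (sigma_ne_zero z.2) (sigma_ne_zero (hadd _ _))
    · refine ContinuousOn.mul continuousOn_const (ContinuousOn.div (by fun_prop) (by fun_prop) ?_)
      exact fun z hz => mul_ne_zero (sigma_ne_zero hz)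
        (Finset.prod_ne_zero_iff.mpr fun i _ => sigma_ne_zero (hadd i i))
    · intro z hz hz'
      have hz'' : z + (k a + k' a) ∉ L.lattice := hz'
      have hne : sigmaKernel L z (k a + k' a) ≠ 0 :=
        div_ne_zero (sigma_ne_zero hz'')
          (mul_ne_zero (sigma_ne_zero hz) (sigma_ne_zero (hadd a a)))
      rw [det_subtype_insert ha (fun i j => sigmaKernel L z (k i + k' j)) hne]
      simp only [sigmaKernel_schur L hz hz'' (hadd _ _) (hadd _ _) (hadd _ _) (hadd _ _)]
      set K : Matrix s s ℂ := Matrix.of fun i j : s =>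
        sigmaKernel L (z + (k a + k' a)) (k i + k' j) with hK
      have hrc := (Matrix.det_mul_column (fun i : s => sigma L (k i - k a) / sigma L (k i + k' a))
        (Matrix.of fun i j : s => sigma L (k' j - k' a) / sigma L (k a + k' j) * K i j)).trans
        (congrArg _ (Matrix.det_mul_row
          (fun j : s => sigma L (k' j - k' a) / sigma L (k a + k' j)) K))
      simp only [Matrix.of_apply, hK] at hrc
      rw [hrc, ih _ hz'', prod_phaseA_insert L k k' has, Finset.sum_insert ha,
        Finset.prod_insert ha, Finset.prod_coe_sort s (fun i => sigma L (k i - k a) /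
          sigma L (k i + k' a)), Finset.prod_coe_sort s (fun j => sigma L (k' j - k' a) /
          sigma L (k a + k' j))]
      have hI : ∏ j ∈ s, phaseA L k k' a j
          = (∏ i ∈ s, sigma L (k i - k a) / sigma L (k i + k' a)) *
            ∏ j ∈ s, sigma L (k' j - k' a) / sigma L (k a + k' j) := by
        rw [← Finset.prod_mul_distrib]
        refine Finset.prod_congr rfl fun j _ => ?_
        rw [phaseA, ← neg_sub (k j), ← neg_sub (k' j), sigma_neg, sigma_neg, neg_mul_neg,
          add_comm (k' a), div_mul_div_comm, mul_comm (sigma L (k a + k' j))]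
      rw [hI, sigmaKernel, ← add_assoc z (k a + k' a)]
      have s1 := sigma_ne_zero hz
      have s2 := sigma_ne_zero hz''
      have s3 := sigma_ne_zero (hadd a a)
      have s4 : ∏ i ∈ s, sigma L (k i + k' i) ≠ 0 :=
        Finset.prod_ne_zero_iff.mpr fun i _ => sigma_ne_zero (hadd i i)
      field_simp

/-! ### Hirota form of the tau function -/

/-- For a diagonal coupling matrix the principal minors of `M B` are elliptic Cauchy determinants.
-/
lemma tau_diagonal_eq_tauHirota (a η : ℂ) (ρ₀ γ₀ : ℂ → ℂ) (k k' b : Fin N → ℂ)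
    (hadm : Admissible L k k') (x y t : ℂ) (hx : x + a ∉ L.lattice) :
    tau L a η ρ₀ γ₀ k k' (Matrix.diagonal b) x y t
      = tauHirota L a (fun i => b i * (ρ₀ (k i) * γ₀ (k' i) * Complex.exp (-η * (k i + k' i))))
          k k' x y t := by
  rw [tau, det_one_add_eq_sum_minors, tauHirota]
  refine Finset.sum_congr rfl fun J _ => ?_
  set f : Fin N → ℂ := fun i => rho L ρ₀ (k i) y t * Complex.exp (-(zeta L (k i)) * x - η * k i)
  set g : Fin N → ℂ := fun j => gam L γ₀ (k' j) y t *
    Complex.exp (-(zeta L (k' j)) * x - η * k' j) * b j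
  have hM : (cauchyMatrix L a η ρ₀ γ₀ k k' x y t * Matrix.diagonal b).submatrix
      (Subtype.val : J → Fin N) Subtype.val
      = Matrix.of fun i j : J => f i * (Matrix.of fun i j : J => g j *
          (Matrix.of fun i j : J => sigmaKernel L (x + a) (k i + k' j)) i j) i j := by
    ext i j
    simp only [Matrix.submatrix_apply, Matrix.mul_diagonal, cauchyMatrix, Matrix.of_apply, lame₂,
      sigmaKernel, f, g]
    rw [show -(zeta L (k i) + zeta L (k' j)) * x - η * (k i + k' j)
      = (-(zeta L (k i)) * x - η * k i) + (-(zeta L (k' j)) * x - η * k' j) by ring,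
      Complex.exp_add]
    ring
  rw [hM, Matrix.det_mul_column, Matrix.det_mul_row, det_sigmaKernel L k k' hadm.add J _ hx,
    Finset.prod_coe_sort J f, Finset.prod_coe_sort J g, Complex.exp_sum]
  have hfg : (∏ i ∈ J, f i) * ∏ i ∈ J, g i
      = (∏ i ∈ J, b i * (ρ₀ (k i) * γ₀ (k' i) * Complex.exp (-η * (k i + k' i)))) *
        ∏ i ∈ J, Complex.exp (theta L x y t (k i) (k' i)) := by
    rw [← Finset.prod_mul_distrib, ← Finset.prod_mul_distrib]
    refine Finset.prod_congr rfl fun i _ => ?_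
    have e : Complex.exp (-η * (k i + k' i)) * Complex.exp (theta L x y t (k i) (k' i))
        = Complex.exp (L.weierstrassP (k i) * y - 2 * L.derivWeierstrassP (k i) * t) *
          Complex.exp (-(zeta L (k i)) * x - η * k i) *
          Complex.exp (-(L.weierstrassP (k' i)) * y - 2 * L.derivWeierstrassP (k' i) * t) *
          Complex.exp (-(zeta L (k' i)) * x - η * k' i) := by
      simp only [← Complex.exp_add]
      congr 1
      rw [theta]
      ring
    simp only [f, g, rho, gam]
    linear_combination (-(b i * (ρ₀ (k i) * γ₀ (k' i)))) * e
  linear_combination (∏ i ∈ J, ∏ j ∈ J with i < j, phaseA L k k' i j) *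
    (sigma L (x + a + ∑ i ∈ J, (k i + k' i)) /
      (sigma L (x + a) * ∏ i ∈ J, sigma L (k i + k' i))) * hfg

end

/-! ### Rectangular lattices -/

/-- The basic periods are a positive real number and a positive multiple of `i`. -/
structure IsRectangular (L : PeriodPair) : Prop where
  re_ω₁ : 0 < L.ω₁.re
  im_ω₁ : L.ω₁.im = 0
  re_ω₂ : L.ω₂.re = 0
  im_ω₂ : 0 < L.ω₂.im

section Rectangular

open scoped ComplexConjugate

variable {L : PeriodPair}

lemma IsRectangular.conj_mem (hL : IsRectangular L) {l : ℂ} (hl : l ∈ L.lattice) :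
    conj l ∈ L.lattice := by
  have h1 : conj L.ω₁ = L.ω₁ := Complex.conj_eq_iff_im.mpr hL.im_ω₁
  have h2 : conj L.ω₂ = -L.ω₂ := by apply Complex.ext <;> simp [hL.re_ω₂]
  obtain ⟨m, n, rfl⟩ := PeriodPair.mem_lattice.mp hl
  exact PeriodPair.mem_lattice.mpr ⟨m, -n, by simp [h1, h2]⟩

/-- Complex conjugation on a rectangular lattice. -/
def conjLattice (hL : IsRectangular L) : L.lattice ≃ L.lattice where
  toFun l := ⟨conj (l : ℂ), hL.conj_mem l.2⟩
  invFun l := ⟨conj (l : ℂ), hL.conj_mem l.2⟩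
  left_inv l := by simp
  right_inv l := by simp

/-- Complex conjugation on the nonzero points of a rectangular lattice. -/
def conjNonzeroLattice (hL : IsRectangular L) : NonzeroLattice L ≃ NonzeroLattice L :=
  (conjLattice hL).subtypeEquiv fun l => by
    rw [ne_eq, ne_eq, Subtype.ext_iff, Subtype.ext_iff]
    exact not_congr (map_eq_zero_iff _ (starRingEnd ℂ).injective).symm

lemma coe_conjNonzeroLattice (hL : IsRectangular L) (l : NonzeroLattice L) :
    ((conjNonzeroLattice hL l : L.lattice) : ℂ) = conj ((l : L.lattice) : ℂ) := rfl

lemma sigma_conj (hL : IsRectangular L) (z : ℂ) : sigma L (conj z) = conj (sigma L z) := by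
  rw [sigma, ← (conjNonzeroLattice hL).tprod_eq, sigma, map_mul,
    Function.LeftInverse.map_tprod (g := starRingEnd ℂ) (g' := conj) _ Complex.continuous_conj
      Complex.continuous_conj Complex.conj_conj]
  congr 1
  refine tprod_congr fun l => ?_
  simp [coe_conjNonzeroLattice, ← Complex.exp_conj, map_ofNat]

lemma zeta_conj (hL : IsRectangular L) (z : ℂ) : zeta L (conj z) = conj (zeta L z) := by
  rw [zeta, ← (conjNonzeroLattice hL).tsum_eq, zeta, map_add, Complex.conj_tsum]
  congr 1
  · simp
  refine tsum_congr fun l => ?_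
  simp [coe_conjNonzeroLattice]

lemma weierstrassP_conj (hL : IsRectangular L) (z : ℂ) :
    L.weierstrassP (conj z) = conj (L.weierstrassP z) := by
  rw [PeriodPair.weierstrassP, ← (conjLattice hL).tsum_eq, PeriodPair.weierstrassP,
    Complex.conj_tsum]
  refine tsum_congr fun l => ?_
  simp [conjLattice]

lemma derivWeierstrassP_conj (hL : IsRectangular L) (z : ℂ) :
    L.derivWeierstrassP (conj z) = conj (L.derivWeierstrassP z) := by
  rw [PeriodPair.derivWeierstrassP, ← (conjLattice hL).tsum_eq, PeriodPair.derivWeierstrassP,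
    map_neg, Complex.conj_tsum]
  congr 1
  refine tsum_congr fun l => ?_
  simp [conjLattice, map_ofNat]

/-! ### The imaginary half period -/

lemma conj_halfPeriod' (hL : IsRectangular L) : conj (halfPeriod' L) = -halfPeriod' L := by
  have h : conj L.ω₂ = -L.ω₂ := by apply Complex.ext <;> simp [hL.re_ω₂]
  rw [halfPeriod', map_div₀, map_ofNat, h, neg_div]

lemma ofReal_add_halfPeriod'_notMem (hL : IsRectangular L) (x : ℝ) :
    (x : ℂ) + halfPeriod' L ∉ L.lattice := by
  intro h
  obtain ⟨m, n, h⟩ := PeriodPair.mem_lattice.mp h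
  have him := congrArg Complex.im h
  have h2 : (n : ℝ) * L.ω₂.im = L.ω₂.im / 2 := by
    simpa [halfPeriod', hL.im_ω₁] using him
  have h3 : (2 * n : ℝ) = 1 := by
    have := hL.im_ω₂.ne'
    field_simp at h2
    linarith
  have h4 : (2 * n : ℤ) = 1 := by exact_mod_cast h3
  omega

lemma quasiPeriod_ω₂ : quasiPeriod L L.ω₂ = 2 * zeta L (halfPeriod' L) := by
  have h := zeta_add_coe L (neg_notMem L.ω₂_div_two_notMem_lattice) L.ω₂_mem_lattice
  rw [show -(L.ω₂ / 2) + L.ω₂ = L.ω₂ / 2 by ring, zeta_neg] at h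
  rw [halfPeriod']
  linear_combination -h

lemma weierstrassP_add_halfPeriod'_im (hL : IsRectangular L) (x : ℝ) :
    (L.weierstrassP (x + halfPeriod' L)).im = 0 := by
  rw [← Complex.conj_eq_iff_im, ← weierstrassP_conj hL, map_add, Complex.conj_ofReal,
    conj_halfPeriod' hL, ← L.weierstrassP_add_coe _ ⟨L.ω₂, L.ω₂_mem_lattice⟩]
  congr 1
  rw [halfPeriod']
  ring

/-- The ratio `σ(x+w'+K) / σ(x+w')`, made real by the factor `exp(-ζ(w') K)`. -/
noncomputable def halfPeriodRatio (L : PeriodPair) (x K : ℝ) : ℂ :=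
  Complex.exp (-(zeta L (halfPeriod' L)) * K) *
    (sigma L (x + halfPeriod' L + K) / sigma L (x + halfPeriod' L))

/-- Conjugation replaces `w'` by `-w'`, which the quasi-periodicity of `σ` undoes. -/
lemma halfPeriodRatio_im (hL : IsRectangular L) (x K : ℝ) : (halfPeriodRatio L x K).im = 0 := by
  obtain ⟨C, hC, h⟩ := exists_sigma_add_coe L L.ω₂_mem_lattice
  rw [quasiPeriod_ω₂] at h
  have hconj := conj_halfPeriod' hL
  set w := halfPeriod' L with hw
  have h1 := h (x - w + K)
  have h2 := h (x - w)
  rw [show (x : ℂ) - w + K + L.ω₂ = x + w + K by rw [hw, halfPeriod']; ring] at h1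
  rw [show (x : ℂ) - w + L.ω₂ = x + w by rw [hw, halfPeriod']; ring] at h2
  have hζ : conj (zeta L w) = -zeta L w := by rw [← zeta_conj hL, hconj, zeta_neg]
  have hx : (x : ℂ) - w ∉ L.lattice := by
    have := neg_notMem (ofReal_add_halfPeriod'_notMem hL (-x))
    rwa [Complex.ofReal_neg, neg_add, neg_neg, ← sub_eq_add_neg] at this
  have hx' := sigma_ne_zero hx
  rw [← Complex.conj_eq_iff_im, halfPeriodRatio, ← hw, map_mul, map_div₀, ← Complex.exp_conj,
    ← sigma_conj hL, ← sigma_conj hL]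
  simp only [map_mul, map_neg, map_add, Complex.conj_ofReal, hconj, hζ, neg_neg]
  rw [h1, h2, ← sub_eq_add_neg, show 2 * zeta L w * ((x : ℂ) - w + K)
    = 2 * zeta L w * (x - w) + zeta L w * K + zeta L w * K by ring, Complex.exp_add,
    Complex.exp_add, neg_mul, Complex.exp_neg]
  have e1 := Complex.exp_ne_zero (2 * zeta L w * ((x : ℂ) - w))
  have e2 := Complex.exp_ne_zero (zeta L w * K)
  field_simp

lemma halfPeriodRatio_zero (hL : IsRectangular L) (x : ℝ) : halfPeriodRatio L x 0 = 1 := by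
  simp [halfPeriodRatio, sigma_ne_zero (ofReal_add_halfPeriod'_notMem hL x)]

lemma continuous_halfPeriodRatio (L : PeriodPair) (x : ℝ) : Continuous (halfPeriodRatio L x) := by
  have h : Continuous (sigma L) := (differentiable_sigma L).continuous
  unfold halfPeriodRatio
  fun_prop

lemma halfPeriodRatio_ne_zero (hL : IsRectangular L) (x K : ℝ) : halfPeriodRatio L x K ≠ 0 := by
  refine mul_ne_zero (Complex.exp_ne_zero _) (div_ne_zero (sigma_ne_zero ?_)
    (sigma_ne_zero (ofReal_add_halfPeriod'_notMem hL x)))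
  have := ofReal_add_halfPeriod'_notMem hL (x + K)
  rwa [Complex.ofReal_add, add_right_comm] at this

/-- The real function `K ↦ halfPeriodRatio L x K` has no zeros and equals `1` at `K = 0`. -/
lemma halfPeriodRatio_re_pos (hL : IsRectangular L) (x K : ℝ) : 0 < (halfPeriodRatio L x K).re := by
  have hne : ∀ K, (halfPeriodRatio L x K).re ≠ 0 := fun K h =>
    halfPeriodRatio_ne_zero hL x K (Complex.ext h (halfPeriodRatio_im hL x K))
  by_contra hK
  have hc : Continuous fun K => (halfPeriodRatio L x K).re :=
    Complex.continuous_re.comp (continuous_halfPeriodRatio L x)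
  obtain ⟨K', hK'⟩ := mem_range_of_exists_le_of_exists_ge hc ⟨K, not_lt.mp hK⟩
    ⟨0, by simp [halfPeriodRatio_zero hL]⟩
  exact hne K' hK'

/-! ### Reality and positivity of the tau function -/

lemma ofReal_re_of_conj {f : ℂ → ℂ} (hf : ∀ z, f (conj z) = conj (f z)) (x : ℝ) :
    ((f x).re : ℂ) = f x := by
  rw [← Complex.conj_eq_iff_re, ← hf, Complex.conj_ofReal]

/-- The real summand of the tau function belonging to `J`. -/
noncomputable def realTauTerm (L : PeriodPair) {N : ℕ} (k k' c : Fin N → ℝ) (x y t : ℝ)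
    (J : Finset (Fin N)) : ℝ :=
  (∏ i ∈ J, c i / (sigma L (k i + k' i)).re) *
    (∏ i ∈ J, ∏ j ∈ J with i < j,
      (phaseA L (fun i => (k i : ℂ)) (fun i => (k' i : ℂ)) i j).re) *
    (halfPeriodRatio L x (∑ i ∈ J, (k i + k' i))).re *
    Real.exp (∑ i ∈ J, (theta L x y t (k i) (k' i)).re)

lemma ofReal_sigma_re (hL : IsRectangular L) (x : ℝ) : ((sigma L x).re : ℂ) = sigma L x :=
  ofReal_re_of_conj (sigma_conj hL) x

lemma ofReal_theta_re (hL : IsRectangular L) (x y t k k' : ℝ) :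
    ((theta L x y t k k').re : ℂ) = theta L x y t k k' := by
  rw [← Complex.conj_eq_iff_re, theta]
  simp only [map_add, map_sub, map_mul, map_neg, Complex.conj_ofReal, ← zeta_conj hL,
    ← weierstrassP_conj hL, ← derivWeierstrassP_conj hL, map_ofNat]

lemma ofReal_phaseA_re (hL : IsRectangular L) {N : ℕ} (k k' : Fin N → ℝ) (i j : Fin N) :
    ((phaseA L (fun i => (k i : ℂ)) (fun i => (k' i : ℂ)) i j).re : ℂ)
      = phaseA L (fun i => (k i : ℂ)) (fun i => (k' i : ℂ)) i j := by
  rw [← Complex.conj_eq_iff_re, phaseA]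
  simp only [map_add, map_sub, map_mul, map_div₀, Complex.conj_ofReal, ← sigma_conj hL]

lemma tauHirota_eq_sum_realTauTerm (hL : IsRectangular L) {N : ℕ} (k k' c : Fin N → ℝ)
    (x y t : ℝ) :
    tauHirota L (halfPeriod' L)
      (fun i => (c i : ℂ) * Complex.exp (-(zeta L (halfPeriod' L)) * (k i + k' i)))
      (fun i => (k i : ℂ)) (fun i => (k' i : ℂ)) x y t
      = ((∑ J, realTauTerm L k k' c x y t J : ℝ) : ℂ) := by
  rw [tauHirota, Complex.ofReal_sum]
  refine Finset.sum_congr rfl fun J _ => ?_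
  have hR : ((halfPeriodRatio L x (∑ i ∈ J, (k i + k' i))).re : ℂ)
      = halfPeriodRatio L x (∑ i ∈ J, (k i + k' i)) :=
    Complex.conj_eq_iff_re.mp (Complex.conj_eq_iff_im.mpr (halfPeriodRatio_im hL _ _))
  have hσ : ∀ i, ((sigma L (k i + k' i)).re : ℂ) = sigma L (k i + k' i) := fun i => by
    simpa using ofReal_sigma_re hL (k i + k' i)
  simp only [realTauTerm, Complex.ofReal_mul, Complex.ofReal_prod, Complex.ofReal_div,
    Complex.ofReal_exp, Complex.ofReal_sum, hR, hσ, ofReal_theta_re hL, ofReal_phaseA_re hL]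
  rw [halfPeriodRatio, Finset.prod_mul_distrib, Finset.prod_div_distrib, ← Complex.exp_sum,
    ← Finset.mul_sum]
  push_cast
  ring

lemma realTauTerm_empty (hL : IsRectangular L) {N : ℕ} (k k' c : Fin N → ℝ) (x y t : ℝ) :
    realTauTerm L k k' c x y t ∅ = 1 := by
  simp [realTauTerm, halfPeriodRatio_zero hL]

lemma realTauTerm_nonneg (hL : IsRectangular L) {N : ℕ} {k k' c : Fin N → ℝ}
    (hc : ∀ i, 0 ≤ c i * (sigma L ((k i : ℂ) + k' i)).re)
    (hA : ∀ i j, i < j → 0 ≤ (phaseA L (fun i => (k i : ℂ)) (fun i => (k' i : ℂ)) i j).re)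
    (x y t : ℝ) (J : Finset (Fin N)) : 0 ≤ realTauTerm L k k' c x y t J := by
  refine mul_nonneg (mul_nonneg (mul_nonneg ?_ ?_) (halfPeriodRatio_re_pos hL _ _).le)
    (Real.exp_pos _).le
  · exact Finset.prod_nonneg fun i _ => div_nonneg_iff.mpr (mul_nonneg_iff.mp (hc i))
  · exact Finset.prod_nonneg fun i _ => Finset.prod_nonneg fun j hj =>
      hA i j (Finset.mem_filter.mp hj).2

lemma one_le_sum_realTauTerm (hL : IsRectangular L) {N : ℕ} {k k' c : Fin N → ℝ}
    (hc : ∀ i, 0 ≤ c i * (sigma L ((k i : ℂ) + k' i)).re)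
    (hA : ∀ i j, i < j → 0 ≤ (phaseA L (fun i => (k i : ℂ)) (fun i => (k' i : ℂ)) i j).re)
    (x y t : ℝ) : 1 ≤ ∑ J, realTauTerm L k k' c x y t J :=
  (realTauTerm_empty hL k k' c x y t).ge.trans
    (Finset.single_le_sum (fun J _ => realTauTerm_nonneg hL hc hA x y t J) (Finset.mem_univ ∅))

end Rectangular

/-! ### Restriction to the real axis -/

/-- A holomorphic function which is real near a real point has a real derivative there. -/
lemma im_eq_zero_of_hasDerivAt {f : ℂ → ℂ} {f' : ℂ} {x : ℝ} (hf : HasDerivAt f f' x)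
    (h : ∀ᶠ s : ℝ in 𝓝 x, (f s).im = 0) : f'.im = 0 := by
  have h1 : HasDerivAt (fun s : ℝ => (f s).im) f'.im x :=
    Complex.imCLM.hasFDerivAt.comp_hasDerivAt x hf.comp_ofReal
  exact h1.unique ((hasDerivAt_const x (0 : ℝ)).congr_of_eventuallyEq h)

lemma analyticAt_comp_ofReal {f : ℂ × ℂ × ℂ → ℂ} {x y t : ℝ}
    (hf : AnalyticAt ℂ f (x, y, t)) :
    AnalyticAt ℝ (fun p : ℝ × ℝ × ℝ => f (p.1, p.2.1, p.2.2)) (x, y, t) :=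
  hf.restrictScalars.comp (f := fun p : ℝ × ℝ × ℝ => ((p.1 : ℂ), (p.2.1 : ℂ), (p.2.2 : ℂ)))
    ((Complex.ofRealCLM.prodMap (Complex.ofRealCLM.prodMap Complex.ofRealCLM)).analyticAt _)

section Real

variable {f : ℂ → ℂ → ℂ → ℂ} {x y t : ℝ}

lemma pdx_comp_ofReal (h : DifferentiableAt ℂ (fun s => f s y t) x) :
    pdx (fun x y t : ℝ => f x y t) x y t = pdx f x y t :=
  h.hasDerivAt.comp_ofReal.deriv

lemma pdy_comp_ofReal (h : DifferentiableAt ℂ (fun s => f x s t) y) :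
    pdy (fun x y t : ℝ => f x y t) x y t = pdy f x y t :=
  h.hasDerivAt.comp_ofReal.deriv

lemma pdx_re (h : DifferentiableAt ℂ (fun s => f s y t) x) :
    pdx (fun x y t : ℝ => (f x y t).re) x y t = (pdx f x y t).re :=
  h.hasDerivAt.real_of_complex.deriv

lemma pdy_re (h : DifferentiableAt ℂ (fun s => f x s t) y) :
    pdy (fun x y t : ℝ => (f x y t).re) x y t = (pdy f x y t).re :=
  h.hasDerivAt.real_of_complex.deriv

lemma pdt_re (h : DifferentiableAt ℂ (fun s => f x y s) t) :
    pdt (fun x y t : ℝ => (f x y t).re) x y t = (pdt f x y t).re :=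
  h.hasDerivAt.real_of_complex.deriv

/-- The real part of a complex KP solution which is real at real points solves the KP equation. -/
lemma IsKPSolutionOn.re {Ω : Set (ℂ × ℂ × ℂ)} {ΩR : Set (ℝ × ℝ × ℝ)} {u v : ℂ → ℂ → ℂ → ℂ}
    (h : IsKPSolutionOn Ω u v) (hΩR : IsOpen ΩR)
    (hΩ : ∀ x y t : ℝ, (x, y, t) ∈ ΩR → ((x : ℂ), (y : ℂ), (t : ℂ)) ∈ Ω)
    (hu : ∀ x y t : ℝ, (x, y, t) ∈ ΩR → (u x y t).im = 0) :
    IsKPSolutionOn ΩR (fun x y t => (u x y t).re) (fun x y t => (v x y t).re) := by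
  have an : ∀ x y t : ℝ, (x, y, t) ∈ ΩR → AnalyticAt ℂ (fun s : ℂ => u s y t) x :=
    fun x y t hp => (h.analytic_u _ (hΩ x y t hp)).comp (f := fun s : ℂ => (s, (y : ℂ), (t : ℂ)))
      (analyticAt_id.prod (analyticAt_const.prod analyticAt_const))
  have d0 : ∀ x y t : ℝ, (x, y, t) ∈ ΩR → DifferentiableAt ℂ (fun s : ℂ => u s y t) x :=
    fun x y t hp => (an x y t hp).differentiableAt
  have d1 : ∀ x y t : ℝ, (x, y, t) ∈ ΩR → DifferentiableAt ℂ (fun s : ℂ => pdx u s y t) x :=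
    fun x y t hp => (an x y t hp).deriv.differentiableAt
  have d2 : ∀ x y t : ℝ, (x, y, t) ∈ ΩR → DifferentiableAt ℂ (fun s : ℂ => pdx (pdx u) s y t) x :=
    fun x y t hp => (an x y t hp).deriv.deriv.differentiableAt
  have p1 : ∀ x y t : ℝ, (x, y, t) ∈ ΩR →
      pdx (fun x y t : ℝ => (u x y t).re) x y t = (pdx u x y t).re :=
    fun x y t hp => pdx_re (d0 x y t hp)
  have p2 : ∀ x y t : ℝ, (x, y, t) ∈ ΩR →
      pdx (pdx fun x y t : ℝ => (u x y t).re) x y t = (pdx (pdx u) x y t).re :=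
    fun x y t hp => (pdx_congr hΩR p1 hp).trans (pdx_re (d1 x y t hp))
  have p3 : ∀ x y t : ℝ, (x, y, t) ∈ ΩR →
      pdx (pdx (pdx fun x y t : ℝ => (u x y t).re)) x y t = (pdx (pdx (pdx u)) x y t).re :=
    fun x y t hp => (pdx_congr hΩR p2 hp).trans (pdx_re (d2 x y t hp))
  refine ⟨?_, ?_, fun x y t hp => ?_, fun x y t hp => ?_⟩
  · rintro ⟨x, y, t⟩ hp
    exact (Complex.reCLM.analyticAt _).comp (f := fun p : ℝ × ℝ × ℝ => u p.1 p.2.1 p.2.2)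
      (analyticAt_comp_ofReal (h.analytic_u _ (hΩ x y t hp)))
  · rintro ⟨x, y, t⟩ hp
    exact (Complex.reCLM.analyticAt _).comp (f := fun p : ℝ × ℝ × ℝ => v p.1 p.2.1 p.2.2)
      (analyticAt_comp_ofReal (h.analytic_v _ (hΩ x y t hp)))
  · rw [pdx_re (differentiableAt_slice_x (h.analytic_v _ (hΩ x y t hp))),
      pdy_re (differentiableAt_slice_y (h.analytic_u _ (hΩ x y t hp))),
      h.potential _ _ _ (hΩ x y t hp)]
  · rw [pdt_re (differentiableAt_slice_t (h.analytic_u _ (hΩ x y t hp))), p3 x y t hp, p1 x y t hp,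
      pdy_re (differentiableAt_slice_y (h.analytic_v _ (hΩ x y t hp)))]
    have e := congrArg Complex.re (h.equation _ _ _ (hΩ x y t hp))
    simpa [hu x y t hp] using e

/-! ### Logarithmic derivatives at real points -/

variable {F : ℂ → ℂ → ℂ → ℂ}

lemma dxLog_comp_ofReal (h : DifferentiableAt ℂ (fun s => F s y t) x) :
    dxLog (fun x y t : ℝ => F x y t) x y t = dxLog F x y t := by
  rw [dxLog, dxLog, logDeriv_apply, logDeriv_apply, h.hasDerivAt.comp_ofReal.deriv]

variable {ΩR : Set (ℝ × ℝ × ℝ)}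

lemma twoDxxLog_comp_ofReal (hΩR : IsOpen ΩR)
    (hF : ∀ x y t : ℝ, (x, y, t) ∈ ΩR → DifferentiableAt ℂ (fun s => F s y t) x)
    (hd : DifferentiableAt ℂ (fun s => dxLog F s y t) x) (h : (x, y, t) ∈ ΩR) :
    twoDxxLog (fun x y t : ℝ => F x y t) x y t = twoDxxLog F x y t := by
  rw [twoDxxLog, twoDxxLog, pdx_congr hΩR (fun x y t hp => dxLog_comp_ofReal (hF x y t hp)) h,
    pdx_comp_ofReal hd]

lemma twoDyxLog_comp_ofReal (hΩR : IsOpen ΩR)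
    (hF : ∀ x y t : ℝ, (x, y, t) ∈ ΩR → DifferentiableAt ℂ (fun s => F s y t) x)
    (hd : DifferentiableAt ℂ (fun s => dxLog F x s t) y) (h : (x, y, t) ∈ ΩR) :
    twoDyxLog (fun x y t : ℝ => F x y t) x y t = twoDyxLog F x y t := by
  rw [twoDyxLog, twoDyxLog, pdy_congr hΩR (fun x y t hp => dxLog_comp_ofReal (hF x y t hp)) h,
    pdy_comp_ofReal hd]

end Real

namespace DressingData

variable {L : PeriodPair} {D : DressingData L}

/-! ### Real solutions -/

section

variable {x y t : ℂ}

lemma differentiableAt_F_x (h : (x, y, t) ∈ D.Ω) :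
    DifferentiableAt ℂ (fun s => D.F s y t) x :=
  (((hasDerivAt_sigma L h.1).comp_add_const x D.a).mul (hasDerivAt_τ_x h)).differentiableAt

lemma differentiableAt_dxLog_F_x (h : (x, y, t) ∈ D.Ω) :
    DifferentiableAt ℂ (fun s => dxLog D.F s y t) x := by
  refine (((hasDerivAt_zeta L h.1).comp_add_const x D.a).sub
    (hasDerivAt_Sc_x h 0 0)).differentiableAt.congr_of_eventuallyEq ?_
  exact (eventually_slice_x isOpen_Ω h).mono fun s hs => dxLog_F hs

lemma differentiableAt_dxLog_F_y (h : (x, y, t) ∈ D.Ω) :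
    DifferentiableAt ℂ (fun s => dxLog D.F x s t) y := by
  refine ((hasDerivAt_Sc_zero_zero_y h).const_sub
    (zeta L (x + D.a))).differentiableAt.congr_of_eventuallyEq ?_
  exact (eventually_slice_y isOpen_Ω h).mono fun s hs => dxLog_F hs

end

/-- The points of `ℝ³` at which the tau function does not vanish. -/
def ΩR (D : DressingData L) : Set (ℝ × ℝ × ℝ) := {p | D.τ p.1 p.2.1 p.2.2 ≠ 0}

lemma analyticAt_τ_ofReal (ha : ∀ x : ℝ, (x : ℂ) + D.a ∉ L.lattice) (x y t : ℝ) :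
    AnalyticAt ℝ (fun p : ℝ × ℝ × ℝ => D.τ p.1 p.2.1 p.2.2) (x, y, t) :=
  analyticAt_comp_ofReal (analyticAt_τ (ha x))

lemma isOpen_ΩR (ha : ∀ x : ℝ, (x : ℂ) + D.a ∉ L.lattice) : IsOpen D.ΩR := by
  rw [isOpen_iff_mem_nhds]
  rintro ⟨x, y, t⟩ h
  exact (analyticAt_τ_ofReal ha x y t).continuousAt.eventually_ne h

variable {x y t : ℝ}

/-- `S_{0,0} = -τ_x / τ` is real where `τ` is real. -/
lemma Sc_zero_zero_im (ha : ∀ x : ℝ, (x : ℂ) + D.a ∉ L.lattice)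
    (hτ : ∀ x y t : ℝ, (D.τ x y t).im = 0) (h : (x, y, t) ∈ D.ΩR) :
    (D.Sc 0 0 x y t).im = 0 := by
  have hx : ((x : ℂ), (y : ℂ), (t : ℂ)) ∈ D.Ω := ⟨ha x, h⟩
  have h1 := im_eq_zero_of_hasDerivAt (hasDerivAt_τ_x hx) (.of_forall fun s => hτ s y t)
  rw [Complex.neg_im, Complex.mul_im, hτ, zero_mul, add_zero, neg_eq_zero, mul_eq_zero] at h1
  exact h1.resolve_left fun h0 => h (Complex.ext h0 (hτ x y t))

lemma u_im (ha : ∀ x : ℝ, (x : ℂ) + D.a ∉ L.lattice)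
    (hP : ∀ x : ℝ, (L.weierstrassP (x + D.a)).im = 0)
    (hτ : ∀ x y t : ℝ, (D.τ x y t).im = 0) (h : (x, y, t) ∈ D.ΩR) : (D.u x y t).im = 0 := by
  have hx : ((x : ℂ), (y : ℂ), (t : ℂ)) ∈ D.Ω := ⟨ha x, h⟩
  have h1 := im_eq_zero_of_hasDerivAt (hasDerivAt_Sc_x hx 0 0)
    ((eventually_slice_x (isOpen_ΩR ha) h).mono fun s hs => Sc_zero_zero_im ha hτ hs)
  rw [← sq] at h1
  rw [u, Complex.sub_im, Complex.mul_im, Complex.mul_im, hP]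
  simpa using h1

lemma v_im (ha : ∀ x : ℝ, (x : ℂ) + D.a ∉ L.lattice)
    (hτ : ∀ x y t : ℝ, (D.τ x y t).im = 0) (h : (x, y, t) ∈ D.ΩR) : (D.v x y t).im = 0 := by
  have hx : ((x : ℂ), (y : ℂ), (t : ℂ)) ∈ D.Ω := ⟨ha x, h⟩
  have h1 := im_eq_zero_of_hasDerivAt (hasDerivAt_Sc_zero_zero_y hx)
    ((eventually_slice_y (isOpen_ΩR ha) h).mono fun s hs => Sc_zero_zero_im ha hτ hs)
  rw [v, Complex.mul_im, h1]
  simp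

/-- Where the tau function is real on `ℝ³`, the complex solution restricts to a real one. -/
lemma exists_real_solution (ha : ∀ x : ℝ, (x : ℂ) + D.a ∉ L.lattice)
    (hP : ∀ x : ℝ, (L.weierstrassP (x + D.a)).im = 0)
    (hτ : ∀ x y t : ℝ, (D.τ x y t).im = 0) :
    ∃ u v : ℝ → ℝ → ℝ → ℝ,
      (∀ x y t : ℝ, (x, y, t) ∈ D.ΩR →
        (u x y t : ℂ) = twoDxxLog (fun x y t : ℝ => D.F x y t) x y t ∧
        (v x y t : ℂ) = twoDyxLog (fun x y t : ℝ => D.F x y t) x y t) ∧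
      IsKPSolutionOn D.ΩR u v := by
  have hΩ : ∀ x y t : ℝ, (x, y, t) ∈ D.ΩR → ((x : ℂ), (y : ℂ), (t : ℂ)) ∈ D.Ω :=
    fun x y t h => ⟨ha x, h⟩
  have hF : ∀ x y t : ℝ, (x, y, t) ∈ D.ΩR → DifferentiableAt ℂ (fun s => D.F s y t) x :=
    fun x y t h => differentiableAt_F_x (hΩ x y t h)
  refine ⟨_, _, fun x y t h => ⟨?_, ?_⟩, D.isKPSolutionOn.re (isOpen_ΩR ha) hΩ
    fun x y t h => ?_⟩
  · rw [twoDxxLog_comp_ofReal (isOpen_ΩR ha) hF (differentiableAt_dxLog_F_x (hΩ x y t h)) h,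
      twoDxxLog_F (hΩ x y t h)]
    exact Complex.conj_eq_iff_re.mp (Complex.conj_eq_iff_im.mpr (u_im ha hP hτ h))
  · rw [twoDyxLog_comp_ofReal (isOpen_ΩR ha) hF (differentiableAt_dxLog_F_y (hΩ x y t h)) h,
      twoDyxLog_F (hΩ x y t h)]
    exact Complex.conj_eq_iff_re.mp (Complex.conj_eq_iff_im.mpr (v_im ha hτ h))
  · rw [twoDxxLog_F (hΩ x y t h)]
    exact u_im ha hP hτ h

end DressingData

end EllipticKP

theorem mainTheorem3 (L : PeriodPair) :
    -- the solution attached to the discrete measure (`a = η = 0`: no shift)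
    (∀ (a η : ℂ) (ρ₀ γ₀ : ℂ → ℂ) (N N' : ℕ) (k : Fin N → ℂ) (k' : Fin N' → ℂ)
        (B : Matrix (Fin N') (Fin N) ℂ), EllipticKP.Admissible L k k' →
      ∀ (Ω : Set (ℂ × ℂ × ℂ)) (F : ℂ → ℂ → ℂ → ℂ),
        Ω = EllipticKP.regularSet L a η ρ₀ γ₀ k k' B →
        F = (fun x y t =>
          EllipticKP.sigma L (x + a) * EllipticKP.tau L a η ρ₀ γ₀ k k' B x y t) →
        -- the integral equation is solvable, and every solution yields `2 ∂_x² ln (σ τ)`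
        (∃ ψ, EllipticKP.SolvesIntegralEq L a η ρ₀ γ₀ k k' B Ω ψ) ∧
        (∀ ψ, EllipticKP.SolvesIntegralEq L a η ρ₀ γ₀ k k' B Ω ψ →
          ∀ x y t : ℂ, (x, y, t) ∈ Ω →
            (fun i => ψ x y t (k i)) =
              (1 + EllipticKP.cauchyMatrix L a η ρ₀ γ₀ k k' x y t * B)⁻¹ *ᵥ
                EllipticKP.rVec L a η ρ₀ k x y t ∧
            -2 * L.weierstrassP (x + a) - 2 * EllipticKP.pdx (fun x y t =>
                EllipticKP.discreteIntegral k k' B (fun l l' =>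
                  ψ x y t l * EllipticKP.gam L γ₀ l' y t * EllipticKP.lame L a η x l')) x y t
              = EllipticKP.twoDxxLog F x y t) ∧
        -- the matrix form of the solution
        (∀ x y t : ℂ, (x, y, t) ∈ Ω →
          -2 * L.weierstrassP (x + a) - 2 * EllipticKP.pdx (fun x y t =>
              EllipticKP.sVec L a η γ₀ k' x y t ⬝ᵥ (B *ᵥ
                ((1 + EllipticKP.cauchyMatrix L a η ρ₀ γ₀ k k' x y t * B)⁻¹ *ᵥ
                  EllipticKP.rVec L a η ρ₀ k x y t))) x y t
            = EllipticKP.twoDxxLog F x y t) ∧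
        EllipticKP.IsKPSolutionOn Ω (EllipticKP.twoDxxLog F) (EllipticKP.twoDyxLog F)) ∧
    -- the explicit form of the tau function for `N = N'` and `B = I`
    (∀ (a η : ℂ) (ρ₀ γ₀ : ℂ → ℂ) (N : ℕ) (k k' : Fin N → ℂ), EllipticKP.Admissible L k k' →
      ∀ x y t : ℂ, x + a ∉ L.lattice →
        EllipticKP.tau L a η ρ₀ γ₀ k k' 1 x y t =
          EllipticKP.tauHirota L a
            (fun i => ρ₀ (k i) * γ₀ (k' i) * Complex.exp (-η * (k i + k' i))) k k' x y t) ∧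
    -- the shifted solution for a rectangular lattice, real `k_i`, `k'_i` and real constants
    (0 < L.ω₁.re → L.ω₁.im = 0 → L.ω₂.re = 0 → 0 < L.ω₂.im →
      ∀ (N : ℕ) (k k' cReal : Fin N → ℝ),
        EllipticKP.Admissible L (fun i => (k i : ℂ)) (fun i => (k' i : ℂ)) →
      ∀ (τ F : ℝ → ℝ → ℝ → ℂ) (Ω : Set (ℝ × ℝ × ℝ)),
        τ = (fun x y t : ℝ => EllipticKP.tauHirota L (EllipticKP.halfPeriod' L)
          (fun i => (cReal i : ℂ) *
            Complex.exp (-(EllipticKP.zeta L (EllipticKP.halfPeriod' L)) * (k i + k' i)))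
          (fun i => (k i : ℂ)) (fun i => (k' i : ℂ)) x y t) →
        F = (fun x y t : ℝ =>
          EllipticKP.sigma L ((x : ℂ) + EllipticKP.halfPeriod' L) * τ x y t) →
        Ω = {p | τ p.1 p.2.1 p.2.2 ≠ 0} →
        -- no singularities come from the zeros of `σ`, and `τ` is real and real-analytic
        (∀ x : ℝ, EllipticKP.sigma L ((x : ℂ) + EllipticKP.halfPeriod' L) ≠ 0) ∧
        (∀ x y t : ℝ, (τ x y t).im = 0) ∧
        AnalyticOnNhd ℝ (fun p : ℝ × ℝ × ℝ => τ p.1 p.2.1 p.2.2) Set.univ ∧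
        -- the solution is real and real-analytic wherever `τ ≠ 0`
        (∃ u v : ℝ → ℝ → ℝ → ℝ,
          (∀ x y t : ℝ, (x, y, t) ∈ Ω →
            (u x y t : ℂ) = EllipticKP.twoDxxLog F x y t ∧
            (v x y t : ℂ) = EllipticKP.twoDyxLog F x y t) ∧
          EllipticKP.IsKPSolutionOn Ω u v) ∧
        -- under the sign conditions `τ` has no zeros, so the solution is regular everywhere
        ((∀ i, 0 ≤ cReal i * (EllipticKP.sigma L ((k i : ℂ) + k' i)).re) →
          (∀ i j, i < j →
            0 ≤ (EllipticKP.phaseA L (fun i => (k i : ℂ)) (fun i => (k' i : ℂ)) i j).re) →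
          (∀ x y t : ℝ, 1 ≤ (τ x y t).re) ∧ Ω = Set.univ)) := by
  refine ⟨?_, ?_, ?_⟩
  · rintro a η ρ₀ γ₀ N N' k k' B hadm Ω F rfl rfl
    let D : EllipticKP.DressingData L := ⟨a, η, ρ₀, γ₀, N, N', k, k', B, hadm⟩
    exact ⟨D.exists_solvesIntegralEq, fun ψ hψ x y t h =>
      ⟨D.eq_inv_mulVec_of_solvesIntegralEq hψ h, D.integral_form ψ hψ h⟩,
      fun x y t h => D.matrix_form h, D.isKPSolutionOn⟩
  · intro a η ρ₀ γ₀ N k k' hadm x y t hx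
    have h := EllipticKP.tau_diagonal_eq_tauHirota L a η ρ₀ γ₀ k k' 1 hadm x y t hx
    simpa using h
  · rintro h1 h2 h3 h4 N k k' c hadm τ F Ω hτ hF rfl
    have hL : EllipticKP.IsRectangular L := ⟨h1, h2, h3, h4⟩
    -- the `k i` may coincide, so the constants enter through the coupling matrix
    let D : EllipticKP.DressingData L := ⟨EllipticKP.halfPeriod' L,
      EllipticKP.zeta L (EllipticKP.halfPeriod' L), fun _ => 1, fun _ => 1, N, N,
      fun i => (k i : ℂ), fun i => (k' i : ℂ), Matrix.diagonal fun i => (c i : ℂ), hadm⟩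
    have ha : ∀ x : ℝ, (x : ℂ) + D.a ∉ L.lattice :=
      EllipticKP.ofReal_add_halfPeriod'_notMem hL
    have hD : ∀ x y t : ℝ, τ x y t = D.τ x y t := fun x y t => by
      have e := EllipticKP.tau_diagonal_eq_tauHirota L _ (EllipticKP.zeta L
        (EllipticKP.halfPeriod' L)) (fun _ => 1) (fun _ => 1) _ _ (fun i => (c i : ℂ)) hadm
        x y t (ha x)
      simp only [one_mul] at e
      rw [hτ]
      exact e.symm
    have hsum : ∀ x y t : ℝ, τ x y t =
        ((∑ J, EllipticKP.realTauTerm L k k' c x y t J : ℝ) : ℂ) := fun x y t => by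
      rw [hτ]
      exact EllipticKP.tauHirota_eq_sum_realTauTerm hL k k' c x y t
    have him : ∀ x y t : ℝ, (τ x y t).im = 0 := fun x y t => by rw [hsum, Complex.ofReal_im]
    have hτD : τ = fun x y t : ℝ => D.τ x y t := by
      funext x y t
      exact hD x y t
    refine ⟨fun x => EllipticKP.sigma_ne_zero (ha x), him, ?_, ?_, fun hc hA => ?_⟩
    · rintro ⟨x, y, t⟩ -
      rw [hτD]
      exact EllipticKP.DressingData.analyticAt_τ_ofReal ha x y t
    · subst hF hτD
      exact EllipticKP.DressingData.exists_real_solution ha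
        (EllipticKP.weierstrassP_add_halfPeriod'_im hL) him
    · have h := EllipticKP.one_le_sum_realTauTerm hL hc hA
      have hre : ∀ x y t : ℝ, 1 ≤ (τ x y t).re := fun x y t => by
        rw [hsum, Complex.ofReal_re]
        exact h x y t
      refine ⟨hre, Set.eq_univ_of_forall fun p h0 => ?_⟩
      have := hre p.1 p.2.1 p.2.2
      rw [h0, Complex.zero_re] at this
      linarith
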